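/- Let $\mathbf S$ be a category with finite products, with terminal object $\star$, projections $\pi_R\colon R\to\star$ and diagonals $\Delta_R\colon R\to R\times R$. Let $\mathscr V$ be an $\mathbf S$-indexed monoidal derivator, i.e. a pseudofunctor from $\mathbf S^{\mathrm{op}}$ to the 2-category of monoidal derivators, cocontinuous strong monoidal morphisms and monoidal modifications; write $f^*\colon\mathscr V^S\to\mathscr V^R$ for the morphism attached to $f\colon R\to S$, and let $X\boxtimes Y=\pi_S^*X\otimes\pi_R^*Y\in\mathscr V^{R\times S}$, for $X\in\mathscr V^R$ and $Y\in\mathscr V^S$, be the external product (with $\pi_S\colon R\times S\to R$ and $\pi_R\colon R\times S\to S$ here the two product projections). Assume that $\mathscr V$ has indexed homotopy coproducts: each $f^*$ has a left adjoint $f_!$ in the 2-category of derivators, and for each square with top $f\colon A\to B$, left side $h\colon A\to C$, right side $g\colon B\to D$ and bottom $k\colon C\to D$ of one of the following forms, or obtained from one of them by taking products with fixed objects, the Beck–Chevalley map $f_!h^*\to g^*k_!$ is an isomorphism: (a) top $u\times \mathrm{id}\colon A\times C\to B\times C$, left side $\mathrm{id}\times v\colon A\times C\to A\times D$, right side $\mathrm{id}\times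 v\colon B\times C\to B\times D$, bottom $u\times\mathrm{id}\colon A\times D\to B\times D$, for $u\colon A\to B$ and $v\colon C\to D$; (b) top $(\mathrm{id},u)\colon A\to A\times B$, left side $u\colon A\to B$, right side $u\times\mathrm{id}\colon A\times B\to B\times B$, bottom $\Delta_B$, for $u\colon A\to B$; (c) top and left side $\Delta_A\colon A\to A\times A$, right side $\mathrm{id}\times\Delta_A$, bottom $\Delta_A\times\mathrm{id}$, both $A\times A\to A\times A\times A$. Assume also that these coproducts are preserved by $\otimes$ in each variable: for every small category $A$, every $f\colon R\to S$, every $M\in\mathscr V^S(A)$ and every $N\in\mathscr V^R(A)$, the canonical maps $f_!(f^*M\otimes N)\to M\otimes f_!N$ and $f_!(N\otimes f^*M)\to f_!N\otimes M$ are isomorphisms. Then there is a derivator bicategory whose 0-cells are the objects of $\mathbf S$, whose hom-derivators are $\mathscr V^{R\times S}$, and whose composition and units are the morphisms of derivators $$M\odot N=(\mathrm{id}_R\times\pi_S\times\mathrm{id}_T)_!\,(\mathrm{id}_R\times\Delta_S\times\mathrm{id}_T)^*(M\boxtimes N),\qquad I_R=(\Delta_R)_!\,\pi_R^*U,$$ where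 $U$ is the unit of $\mathscr V^\star$. That is, these composition morphisms are cocontinuous in each variable, and there are associativity and unit isomorphisms (invertible modifications) satisfying the pentagon and unit axioms of a bicategory. Moreover, if $\mathscr V$ is symmetric (each $\mathscr V^R$ is a symmetric monoidal derivator and each $f^*$ is symmetric monoidal), then this derivator bicategory has a shadow with values in $\mathscr V^\star$ whose underlying morphisms $\mathscr V^{R\times R}\to\mathscr V^\star$ are $$\langle\!\langle M\rangle\!\rangle=(\pi_R)_!\,\Delta_R^*M .$$ That is, these morphisms are cocontinuous, and there are invertible modifications $\langle\!\langle M\odot N\rangle\!\rangle\cong\langle\!\langle N\odot M\rangle\!\rangle$ satisfying the hexagon and unit axioms of a shadow. -/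

import Mathlib

open CategoryTheory Opposite
open scoped Bicategory Pseudofunctor.StrongTrans

universe w v u v' u'

set_option linter.checkUnivs false in
/-- A prederivator: a 2-functor `Catᵒᵖ ⥤ CAT` (contravariant on functors, covariant on natural
transformations) from small categories to possibly large ones.  We allow arbitrary pseudofunctors;
strict 2-functors are a special case. -/
abbrev Prederivator := Pseudofunctor (Cat.{w, w}ᵒᵖ) Cat.{v, u}

namespace Prederivator

section Axioms

variable (D : Prederivator.{w, v, u})

/-- The category `D(A)` of coherent `A`-shaped diagrams. -/
abbrev diag (A : Cat.{w, w}) : Cat.{v, u} := D.obj (op A)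

/-- The restriction functor `p^* : D(B) ⟶ D(A)` along `p : A ⟶ B`. -/
abbrev pull {A B : Cat.{w, w}} (p : A ⟶ B) : D.diag B ⟶ D.diag A := D.map p.op

/-- A square of functors filled by a natural transformation `α : p ≫ r ⟶ q ≫ s` induces a
transformation `p^* r^* ⟶ q^* s^*`. -/
def pullSquare {X A C B : Cat.{w, w}} (p : X ⟶ A) (r : A ⟶ B) (q : X ⟶ C) (s : C ⟶ B)
    (α : p ≫ r ⟶ q ≫ s) : D.pull r ≫ D.pull p ⟶ D.pull s ≫ D.pull q :=
  (D.mapComp r.op p.op).inv ≫ D.map₂ (Bicategory.Opposite.op2 α) ≫ (D.mapComp s.op q.op).hom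

/-- The terminal small category. -/
abbrev pt : Cat.{w, w} := Cat.of (Discrete PUnit.{w + 1})

/-- The functor from the terminal category picking out an object. -/
abbrev ptHom {B : Cat.{w, w}} (b : B) : pt.{w} ⟶ B := (Functor.fromPUnit b).toCatHom

section Comma

variable {A B : Cat.{w, w}} (p : A ⟶ B) (b : B)

/-- The comma category `(p / b)`, with objects `(a, p a ⟶ b)`. -/
abbrev overCat : Cat.{w, w} := Cat.of (Comma p.toFunctor (Functor.fromPUnit.{w} b))

/-- The projection `(p / b) ⟶ A`. -/
abbrev overFst : overCat p b ⟶ A :=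
  Functor.toCatHom (D := A) (Comma.fst p.toFunctor (Functor.fromPUnit.{w} b))

/-- The projection from `(p / b)` to the terminal category. -/
abbrev overSnd : overCat p b ⟶ pt.{w} :=
  Functor.toCatHom (Comma.snd p.toFunctor (Functor.fromPUnit.{w} b))

/-- The canonical transformation filling the comma square of `p / b`. -/
def overCell : overFst p b ≫ p ⟶ overSnd p b ≫ ptHom b :=
  .ofNatTrans (Comma.natTrans p.toFunctor (Functor.fromPUnit.{w} b))

/-- The comma category `(b / p)`, with objects `(a, b ⟶ p a)`. -/
abbrev underCat : Cat.{w, w} := Cat.of (Comma (Functor.fromPUnit.{w} b) p.toFunctor)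

/-- The projection from `(b / p)` to the terminal category. -/
abbrev underFst : underCat p b ⟶ pt.{w} :=
  Functor.toCatHom (Comma.fst (Functor.fromPUnit.{w} b) p.toFunctor)

/-- The projection `(b / p) ⟶ A`. -/
abbrev underSnd : underCat p b ⟶ A :=
  Functor.toCatHom (D := A) (Comma.snd (Functor.fromPUnit.{w} b) p.toFunctor)

/-- The canonical transformation filling the comma square of `b / p`. -/
def underCell : underFst p b ≫ ptHom b ⟶ underSnd p b ≫ p :=
  .ofNatTrans (Comma.natTrans (Functor.fromPUnit.{w} b) p.toFunctor)

end Comma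

/-- The functor `D(∐ Aᵢ) ⥤ ∏ D(Aᵢ)` given by restriction along the coproduct inclusions. -/
def sigmaRestrict {I : Type w} (A : I → Cat.{w, w}) :
    D.diag (Cat.of (Σ i, A i)) ⥤ ∀ i, D.diag (A i) :=
  Functor.pi' fun i =>
    (D.pull (Functor.toCatHom (C := A i) (Sigma.incl (C := fun i => A i) i))).toFunctor

/-- A prederivator is a derivator if it takes coproducts to products (`der1`), isomorphisms are
detected pointwise (`der2`), the restriction functors have left and right adjoints, the homotopy
Kan extensions (`der3_left`, `der3_right`), and these Kan extensions are computed pointwise: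
for `p : A ⟶ B` and `b : B` the canonical maps `π_! pr^* ⟶ b^* p_!` over `(p / b)` and
`b^* p_* ⟶ π_* pr^*` over `(b / p)` are isomorphisms (`der4_left`, `der4_right`). -/
structure IsDerivator : Prop where
  der1 : ∀ {I : Type w} (A : I → Cat.{w, w}), (D.sigmaRestrict A).IsEquivalence
  der2 : ∀ (A : Cat.{w, w}) {X Y : D.diag A} (f : X ⟶ Y),
    (∀ a : A, IsIso ((D.pull (ptHom a)).toFunctor.map f)) → IsIso f
  der3_left : ∀ {A B : Cat.{w, w}} (p : A ⟶ B),
    ∃ L : D.diag A ⟶ D.diag B, Nonempty (Bicategory.Adjunction L (D.pull p))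
  der3_right : ∀ {A B : Cat.{w, w}} (p : A ⟶ B),
    ∃ R : D.diag A ⟶ D.diag B, Nonempty (Bicategory.Adjunction (D.pull p) R)
  der4_left : ∀ {A B : Cat.{w, w}} (p : A ⟶ B) (b : B)
    {L : D.diag A ⟶ D.diag B} (adj : Bicategory.Adjunction L (D.pull p))
    {L' : D.diag (overCat p b) ⟶ D.diag pt} (adj' : Bicategory.Adjunction L' (D.pull (overSnd p b))),
    IsIso ((Bicategory.mateEquiv adj adj').symm
      (D.pullSquare (overFst p b) p (overSnd p b) (ptHom b) (overCell p b)))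
  der4_right : ∀ {A B : Cat.{w, w}} (p : A ⟶ B) (b : B)
    {R : D.diag A ⟶ D.diag B} (adj : Bicategory.Adjunction (D.pull p) R)
    {R' : D.diag (underCat p b) ⟶ D.diag pt}
    (adj' : Bicategory.Adjunction (D.pull (underFst p b)) R'),
    IsIso (Bicategory.mateEquiv adj adj'
      (D.pullSquare (underFst p b) (ptHom b) (underSnd p b) p (underCell p b)))

end Axioms

/-- A morphism `φ : D ⟶ E` (a pseudonatural transformation) is cocontinuous if it preserves
homotopy left Kan extensions: the canonical map `p_! φ_A ⟶ φ_B p_!` is an isomorphism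
for every functor `p : A ⟶ B`. -/
def IsCocontinuous {D E : Prederivator.{w, v, u}} (φ : D ⟶ E) : Prop :=
  ∀ {A B : Cat.{w, w}} (p : A ⟶ B)
    {L : D.diag A ⟶ D.diag B} (adj : Bicategory.Adjunction L (D.pull p))
    {L' : E.diag A ⟶ E.diag B} (adj' : Bicategory.Adjunction L' (E.pull p)),
    IsIso ((Bicategory.mateEquiv adj adj').symm (φ.naturality p.op).hom)

/-! ### Products -/


/-- The product of two prederivators, formed levelwise. -/
def prod (D E : Prederivator.{w, v, u}) : Prederivator.{w, v, u} where
  obj A := Cat.of (D.obj A × E.obj A)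
  map p := ((D.map p).toFunctor.prod (E.map p).toFunctor).toCatHom
  map₂ α := .ofNatTrans (NatTrans.prod (D.map₂ α).toNatTrans (E.map₂ α).toNatTrans)
  map₂_id p := Cat.Hom₂.ext <| NatTrans.ext <| funext fun X => Prod.ext
    congr($(D.map₂_id p).toNatTrans.app X.1) congr($(E.map₂_id p).toNatTrans.app X.2)
  map₂_comp α β := Cat.Hom₂.ext <| NatTrans.ext <| funext fun X => Prod.ext
    congr($(D.map₂_comp α β).toNatTrans.app X.1) congr($(E.map₂_comp α β).toNatTrans.app X.2)
  mapId A := Cat.Hom.isoMk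
    (NatIso.prod (Cat.Hom.toNatIso (D.mapId A)) (Cat.Hom.toNatIso (E.mapId A)))
  mapComp p q := Cat.Hom.isoMk
    (NatIso.prod (Cat.Hom.toNatIso (D.mapComp p q)) (Cat.Hom.toNatIso (E.mapComp p q)))
  map₂_whisker_left p _ _ α := Cat.Hom₂.ext <| NatTrans.ext <| funext fun X => Prod.ext
    congr($(D.map₂_whisker_left p α).toNatTrans.app X.1)
    congr($(E.map₂_whisker_left p α).toNatTrans.app X.2)
  map₂_whisker_right α p := Cat.Hom₂.ext <| NatTrans.ext <| funext fun X => Prod.ext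
    congr($(D.map₂_whisker_right α p).toNatTrans.app X.1)
    congr($(E.map₂_whisker_right α p).toNatTrans.app X.2)
  map₂_associator p q r := Cat.Hom₂.ext <| NatTrans.ext <| funext fun X => Prod.ext
    congr($(D.map₂_associator p q r).toNatTrans.app X.1)
    congr($(E.map₂_associator p q r).toNatTrans.app X.2)
  map₂_left_unitor p := Cat.Hom₂.ext <| NatTrans.ext <| funext fun X => Prod.ext
    congr($(D.map₂_left_unitor p).toNatTrans.app X.1)
    congr($(E.map₂_left_unitor p).toNatTrans.app X.2)
  map₂_right_unitor p := Cat.Hom₂.ext <| NatTrans.ext <| funext fun X => Prod.ext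
    congr($(D.map₂_right_unitor p).toNatTrans.app X.1)
    congr($(E.map₂_right_unitor p).toNatTrans.app X.2)

/-- The terminal category, in arbitrary universes. -/
inductive Point : Type u
  | star

instance : Category.{v} Point.{u} where
  Hom _ _ := PUnit.{v + 1}
  id _ := .unit
  comp _ _ := .unit

/-- The terminal prederivator. -/
def one : Prederivator.{w, v, u} where
  obj _ := Cat.of Point.{u}
  map _ := 𝟙 _
  map₂ _ := 𝟙 _
  mapId _ := Iso.refl _
  mapComp _ _ := Iso.refl _

/-- The product of two morphisms. -/
def prodMap {D D' E E' : Prederivator.{w, v, u}} (φ : D ⟶ D') (ψ : E ⟶ E') :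
    D.prod E ⟶ D'.prod E' where
  app A := ((φ.app A).toFunctor.prod (ψ.app A).toFunctor).toCatHom
  naturality p := Cat.Hom.isoMk
    (NatIso.prod (Cat.Hom.toNatIso (φ.naturality p)) (Cat.Hom.toNatIso (ψ.naturality p)))
  naturality_naturality α := Cat.Hom₂.ext <| NatTrans.ext <| funext fun X => Prod.ext
    congr($(φ.naturality_naturality α).toNatTrans.app X.1)
    congr($(ψ.naturality_naturality α).toNatTrans.app X.2)
  naturality_id A := Cat.Hom₂.ext <| NatTrans.ext <| funext fun X => Prod.ext
    congr($(φ.naturality_id A).toNatTrans.app X.1)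
    congr($(ψ.naturality_id A).toNatTrans.app X.2)
  naturality_comp p q := Cat.Hom₂.ext <| NatTrans.ext <| funext fun X => Prod.ext
    congr($(φ.naturality_comp p q).toNatTrans.app X.1)
    congr($(ψ.naturality_comp p q).toNatTrans.app X.2)

/-- The morphism `D ⟶ E × E'` with components `φ` and `ψ`. -/
def pair {D E E' : Prederivator.{w, v, u}} (φ : D ⟶ E) (ψ : D ⟶ E') : D ⟶ E.prod E' where
  app A := ((φ.app A).toFunctor.prod' (ψ.app A).toFunctor).toCatHom
  naturality p := Cat.Hom.isoMk (NatIso.ofComponents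
    (fun X => Iso.prod ((Cat.Hom.toNatIso (φ.naturality p)).app X)
      ((Cat.Hom.toNatIso (ψ.naturality p)).app X))
    (fun f => Prod.ext ((φ.naturality p).hom.toNatTrans.naturality f)
      ((ψ.naturality p).hom.toNatTrans.naturality f)))
  naturality_naturality α := Cat.Hom₂.ext <| NatTrans.ext <| funext fun X => Prod.ext
    congr($(φ.naturality_naturality α).toNatTrans.app X)
    congr($(ψ.naturality_naturality α).toNatTrans.app X)
  naturality_id A := Cat.Hom₂.ext <| NatTrans.ext <| funext fun X => Prod.ext
    congr($(φ.naturality_id A).toNatTrans.app X)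
    congr($(ψ.naturality_id A).toNatTrans.app X)
  naturality_comp p q := Cat.Hom₂.ext <| NatTrans.ext <| funext fun X => Prod.ext
    congr($(φ.naturality_comp p q).toNatTrans.app X)
    congr($(ψ.naturality_comp p q).toNatTrans.app X)

/-- The projection `D × E ⟶ D`. -/
def fst (D E : Prederivator.{w, v, u}) : D.prod E ⟶ D where
  app A := (CategoryTheory.Prod.fst (D.obj A) (E.obj A)).toCatHom
  naturality p := Cat.Hom.isoMk (Iso.refl (CategoryTheory.Prod.fst _ _ ⋙ (D.map p).toFunctor))
  naturality_naturality α := Cat.Hom₂.ext <| NatTrans.ext <| funext fun X => by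
    change (D.map₂ α).toNatTrans.app X.1 ≫ 𝟙 _ = 𝟙 _ ≫ (D.map₂ α).toNatTrans.app X.1
    simp
  naturality_id A := Cat.Hom₂.ext <| NatTrans.ext <| funext fun X => by
    change 𝟙 _ ≫ (D.mapId A).hom.toNatTrans.app X.1 =
      (D.mapId A).hom.toNatTrans.app X.1 ≫ 𝟙 _ ≫ 𝟙 _
    simp
  naturality_comp p q := Cat.Hom₂.ext <| NatTrans.ext <| funext fun X => by
    change 𝟙 _ ≫ (D.mapComp p q).hom.toNatTrans.app X.1 =
      (D.mapComp p q).hom.toNatTrans.app X.1 ≫ 𝟙 _ ≫ 𝟙 _ ≫ 𝟙 _ ≫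
        (D.map q).toFunctor.map (𝟙 _) ≫ 𝟙 _
    simp

/-- The projection `D × E ⟶ E`. -/
def snd (D E : Prederivator.{w, v, u}) : D.prod E ⟶ E where
  app A := (CategoryTheory.Prod.snd (D.obj A) (E.obj A)).toCatHom
  naturality p := Cat.Hom.isoMk (Iso.refl (CategoryTheory.Prod.snd _ _ ⋙ (E.map p).toFunctor))
  naturality_naturality α := Cat.Hom₂.ext <| NatTrans.ext <| funext fun X => by
    change (E.map₂ α).toNatTrans.app X.2 ≫ 𝟙 _ = 𝟙 _ ≫ (E.map₂ α).toNatTrans.app X.2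
    simp
  naturality_id A := Cat.Hom₂.ext <| NatTrans.ext <| funext fun X => by
    change 𝟙 _ ≫ (E.mapId A).hom.toNatTrans.app X.2 =
      (E.mapId A).hom.toNatTrans.app X.2 ≫ 𝟙 _ ≫ 𝟙 _
    simp
  naturality_comp p q := Cat.Hom₂.ext <| NatTrans.ext <| funext fun X => by
    change 𝟙 _ ≫ (E.mapComp p q).hom.toNatTrans.app X.2 =
      (E.mapComp p q).hom.toNatTrans.app X.2 ≫ 𝟙 _ ≫ 𝟙 _ ≫ 𝟙 _ ≫
        (E.map q).toFunctor.map (𝟙 _) ≫ 𝟙 _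
    simp

/-- The unique morphism to the terminal prederivator. -/
def toOne (D : Prederivator.{w, v, u}) : D ⟶ one where
  app A := Functor.toCatHom (D := Point.{u}) { obj _ := .star, map _ := .unit }
  naturality p := Cat.Hom.isoMk (Iso.refl
   ({ obj _ := .star, map _ := .unit } : _ ⥤ Point.{u}))
  naturality_naturality _ := rfl
  naturality_id _ := rfl
  naturality_comp _ _ := rfl

/-- The associativity isomorphism of products. -/
def prodAssoc (D E F : Prederivator.{w, v, u}) : (D.prod E).prod F ⟶ D.prod (E.prod F) :=
  pair (fst _ _ ≫ fst _ _) (pair (fst _ _ ≫ snd _ _) (snd _ _))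

/-- The symmetry isomorphism of products. -/
def prodSwap (D E : Prederivator.{w, v, u}) : D.prod E ⟶ E.prod D :=
  pair (snd _ _) (fst _ _)

/-! ### Two-variable morphisms -/

section TwoVariable

variable {D E F : Prederivator.{w, v, u}} (φ : D.prod E ⟶ F)

/-- The product `A × B` of small categories. -/
abbrev prodCat (A B : Cat.{w, w}) : Cat.{w, w} := Cat.of (A × B)

/-- The projection `A × B ⟶ A`. -/
abbrev pr₁ (A B : Cat.{w, w}) : prodCat A B ⟶ A :=
  Functor.toCatHom (D := A) (CategoryTheory.Prod.fst A B)

/-- The projection `A × B ⟶ B`. -/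
abbrev pr₂ (A B : Cat.{w, w}) : prodCat A B ⟶ B :=
  Functor.toCatHom (D := B) (CategoryTheory.Prod.snd A B)

/-- The functor `p × q`. -/
abbrev prodHom {A A' B B' : Cat.{w, w}} (p : A ⟶ A') (q : B ⟶ B') : prodCat A B ⟶ prodCat A' B' :=
  (p.toFunctor.prod q.toFunctor).toCatHom

/-- The external form of a two-variable morphism with the second variable fixed: for `Y` in `E(C)`
the functor `D(A) ⟶ F(A × C)` sending `X` to `φ (pr₁^* X, pr₂^* Y)`. -/
def extLeft {C : Cat.{w, w}} (Y : E.diag C) (A : Cat.{w, w}) : D.diag A ⟶ F.diag (prodCat A C) :=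
  Functor.toCatHom (C := D.diag A) (D := F.diag (prodCat A C))
    ((D.pull (pr₁ A C)).toFunctor ⋙
      CategoryTheory.Prod.sectL (D.diag (prodCat A C)) ((E.pull (pr₂ A C)).toFunctor.obj Y) ⋙
      (φ.app (op (prodCat A C))).toFunctor)

/-- The external form of a two-variable morphism with the first variable fixed: for `X` in `D(C)`
the functor `E(A) ⟶ F(C × A)` sending `Y` to `φ (pr₁^* X, pr₂^* Y)`. -/
def extRight {C : Cat.{w, w}} (X : D.diag C) (A : Cat.{w, w}) : E.diag A ⟶ F.diag (prodCat C A) :=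
  Functor.toCatHom (C := E.diag A) (D := F.diag (prodCat C A))
    ((E.pull (pr₂ C A)).toFunctor ⋙
      CategoryTheory.Prod.sectR ((D.pull (pr₁ C A)).toFunctor.obj X) (E.diag (prodCat C A)) ⋙
      (φ.app (op (prodCat C A))).toFunctor)

/-- The canonical comparison `φ (p^* X, Y) ⟶ (p × 1)^* φ (X, Y)` of external products, natural in
`X` in `D(B)`, for `p : A ⟶ B` and `Y` in `E(C)`. -/
def extLeftPull {A B C : Cat.{w, w}} (p : A ⟶ B) (Y : E.diag C) :
    D.pull p ≫ extLeft φ Y A ⟶ extLeft φ Y B ≫ F.pull (prodHom p (𝟙 C)) :=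
  .ofNatTrans
    { app := fun X =>
        (φ.app (op (prodCat A C))).toFunctor.map
          (Prod.mkHom
            ((D.pullSquare (pr₁ A C) p (prodHom p (𝟙 C)) (pr₁ B C) (𝟙 _)).toNatTrans.app X)
            ((E.mapComp (pr₂ B C).op (prodHom p (𝟙 C)).op).hom.toNatTrans.app Y)) ≫
        (φ.naturality (prodHom p (𝟙 C)).op).hom.toNatTrans.app
          ((D.pull (pr₁ B C)).toFunctor.obj X, (E.pull (pr₂ B C)).toFunctor.obj Y)
      naturality := fun X X' f => by
        have h₁ := (D.pullSquare (pr₁ A C) p (prodHom p (𝟙 C)) (pr₁ B C) (𝟙 _)).toNatTrans.naturality f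
        have h₂ := (φ.naturality (prodHom p (𝟙 C)).op).hom.toNatTrans.naturality
          (Prod.mkHom ((D.pull (pr₁ B C)).toFunctor.map f)
            (𝟙 ((E.pull (pr₂ B C)).toFunctor.obj Y)))
        refine (Category.assoc _ _ _).symm.trans (Eq.trans ?_ (Category.assoc _ _ _).symm)
        refine Eq.trans ?_ (congrArg _ h₂)
        refine Eq.trans ?_ (Category.assoc _ _ _)
        congr 1
        refine ((φ.app (op (prodCat A C))).toFunctor.map_comp _ _).symm.trans
          (Eq.trans ?_ ((φ.app (op (prodCat A C))).toFunctor.map_comp _ _))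
        congr 1
        refine Prod.ext h₁ ?_
        exact (Category.id_comp _).trans ((Category.comp_id _).symm.trans
          (congrArg (fun t => _ ≫ t) (CategoryTheory.Functor.map_id _ _).symm)) }

/-- The canonical comparison `φ (X, p^* Y) ⟶ (1 × p)^* φ (X, Y)` of external products, natural in
`Y` in `E(B)`, for `p : A ⟶ B` and `X` in `D(C)`. -/
def extRightPull {A B C : Cat.{w, w}} (p : A ⟶ B) (X : D.diag C) :
    E.pull p ≫ extRight φ X A ⟶ extRight φ X B ≫ F.pull (prodHom (𝟙 C) p) :=
  .ofNatTrans
    { app := fun Y =>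
        (φ.app (op (prodCat C A))).toFunctor.map
          (Prod.mkHom
            ((D.mapComp (pr₁ C B).op (prodHom (𝟙 C) p).op).hom.toNatTrans.app X)
            ((E.pullSquare (pr₂ C A) p (prodHom (𝟙 C) p) (pr₂ C B) (𝟙 _)).toNatTrans.app Y)) ≫
        (φ.naturality (prodHom (𝟙 C) p).op).hom.toNatTrans.app
          ((D.pull (pr₁ C B)).toFunctor.obj X, (E.pull (pr₂ C B)).toFunctor.obj Y)
      naturality := fun Y Y' f => by
        have h₁ := (E.pullSquare (pr₂ C A) p (prodHom (𝟙 C) p) (pr₂ C B) (𝟙 _)).toNatTrans.naturality f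
        have h₂ := (φ.naturality (prodHom (𝟙 C) p).op).hom.toNatTrans.naturality
          (Prod.mkHom (𝟙 ((D.pull (pr₁ C B)).toFunctor.obj X))
            ((E.pull (pr₂ C B)).toFunctor.map f))
        refine (Category.assoc _ _ _).symm.trans (Eq.trans ?_ (Category.assoc _ _ _).symm)
        refine Eq.trans ?_ (congrArg _ h₂)
        refine Eq.trans ?_ (Category.assoc _ _ _)
        congr 1
        refine ((φ.app (op (prodCat C A))).toFunctor.map_comp _ _).symm.trans
          (Eq.trans ?_ ((φ.app (op (prodCat C A))).toFunctor.map_comp _ _))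
        congr 1
        refine Prod.ext ?_ h₁
        exact (Category.id_comp _).trans ((Category.comp_id _).symm.trans
          (congrArg (fun t => _ ≫ t) (CategoryTheory.Functor.map_id _ _).symm)) }

/-- A two-variable morphism is cocontinuous in the first variable if for every functor `p` and
every `Y` the canonical map `(p × 1)_! φ (X, Y) ⟶ φ (p_! X, Y)` of external products is an
isomorphism, naturally in `X`. -/
def IsCocontinuousLeft : Prop :=
  ∀ {A B C : Cat.{w, w}} (p : A ⟶ B) (Y : E.diag C)
    {L : D.diag A ⟶ D.diag B} (adj : Bicategory.Adjunction L (D.pull p))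
    {L' : F.diag (prodCat A C) ⟶ F.diag (prodCat B C)}
    (adj' : Bicategory.Adjunction L' (F.pull (prodHom p (𝟙 C)))),
    IsIso ((Bicategory.mateEquiv adj adj').symm (extLeftPull φ p Y))

/-- A two-variable morphism is cocontinuous in the second variable if for every functor `p` and
every `X` the canonical map `(1 × p)_! φ (X, Y) ⟶ φ (X, p_! Y)` of external products is an
isomorphism, naturally in `Y`. -/
def IsCocontinuousRight : Prop :=
  ∀ {A B C : Cat.{w, w}} (p : A ⟶ B) (X : D.diag C)
    {L : E.diag A ⟶ E.diag B} (adj : Bicategory.Adjunction L (E.pull p))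
    {L' : F.diag (prodCat C A) ⟶ F.diag (prodCat C B)}
    (adj' : Bicategory.Adjunction L' (F.pull (prodHom (𝟙 C) p))),
    IsIso ((Bicategory.mateEquiv adj adj').symm (extRightPull φ p X))

end TwoVariable

/-! ### Monoidal structures -/

open MonoidalCategory

instance catIdMonoidal (C : Cat.{v, u}) [MonoidalCategory C] : (𝟙 C : C ⟶ C).toFunctor.Monoidal :=
  inferInstanceAs (𝟭 C).Monoidal

instance catCompMonoidal {C D E : Cat.{v, u}} [MonoidalCategory C] [MonoidalCategory D]
    [MonoidalCategory E] (F : C ⟶ D) (G : D ⟶ E) [F.toFunctor.Monoidal] [G.toFunctor.Monoidal] :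
    (F ≫ G).toFunctor.Monoidal :=
  inferInstanceAs (F.toFunctor ⋙ G.toFunctor).Monoidal

/-- A monoidal structure on a prederivator: a lift of the 2-functor to monoidal categories, strong
monoidal functors and monoidal transformations.  Equivalently, a pseudomonoid structure in the
2-category of prederivators; the multiplication and unit morphisms are `tensor` and
`unit` below. -/
class Monoidal (D : Prederivator.{w, v, u}) where
  cat : ∀ A : Cat.{w, w}ᵒᵖ, MonoidalCategory (D.obj A)
  map : ∀ {A B : Cat.{w, w}ᵒᵖ} (p : A ⟶ B), (D.map p).toFunctor.Monoidal
  map₂ : ∀ {A B : Cat.{w, w}ᵒᵖ} {p q : A ⟶ B} (α : p ⟶ q),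
    NatTrans.IsMonoidal (D.map₂ α).toNatTrans
  mapId : ∀ A : Cat.{w, w}ᵒᵖ, NatTrans.IsMonoidal (D.mapId A).hom.toNatTrans
  mapComp : ∀ {A B C : Cat.{w, w}ᵒᵖ} (p : A ⟶ B) (q : B ⟶ C),
    NatTrans.IsMonoidal (D.mapComp p q).hom.toNatTrans

attribute [reducible, instance] Monoidal.cat Monoidal.map
attribute [instance] Monoidal.map₂ Monoidal.mapId Monoidal.mapComp

open Functor.LaxMonoidal

/-- The multiplication `⊗ : D × D ⟶ D` of a monoidal prederivator. -/
def tensor (D : Prederivator.{w, v, u}) [D.Monoidal] : D.prod D ⟶ D where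
  app A := (MonoidalCategory.tensor (D.obj A)).toCatHom
  naturality p := Cat.Hom.isoMk (Functor.Monoidal.μNatIso (D.map p).toFunctor)
  naturality_naturality α := Cat.Hom₂.ext <| NatTrans.ext <| funext fun X =>
    (NatTrans.IsMonoidal.tensor (τ := (D.map₂ α).toNatTrans) X.1 X.2).symm
  naturality_id A := Cat.Hom₂.ext <| NatTrans.ext <| funext fun X => by
    have h := NatTrans.IsMonoidal.tensor (τ := (D.mapId A).hom.toNatTrans) X.1 X.2
    refine h.trans ?_
    change _ ≫ 𝟙 _ = ((D.mapId A).hom.toNatTrans.app X.1 ⊗ₘ (D.mapId A).hom.toNatTrans.app X.2) ≫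
      𝟙 _ ≫ 𝟙 _
    simp
  naturality_comp p q := Cat.Hom₂.ext <| NatTrans.ext <| funext fun X => by
    have h := NatTrans.IsMonoidal.tensor (τ := (D.mapComp p q).hom.toNatTrans) X.1 X.2
    refine h.trans ?_
    change _ ≫ μ (D.map q).toFunctor _ _ ≫ (D.map q).toFunctor.map (μ (D.map p).toFunctor _ _) =
      ((D.mapComp p q).hom.toNatTrans.app X.1 ⊗ₘ (D.mapComp p q).hom.toNatTrans.app X.2) ≫
        𝟙 _ ≫ μ (D.map q).toFunctor _ _ ≫ 𝟙 _ ≫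
        (D.map q).toFunctor.map (μ (D.map p).toFunctor _ _) ≫ 𝟙 _
    simp

/-- The unit object of a monoidal prederivator, as a morphism from the terminal prederivator. -/
def unit (D : Prederivator.{w, v, u}) [D.Monoidal] : one ⟶ D where
  app A := Functor.toCatHom (C := Point.{u}) (D := D.obj A)
    { obj := fun _ => 𝟙_ (D.obj A), map := fun _ => 𝟙 _ }
  naturality {A B} p := Cat.Hom.isoMk (C := Point.{u}) (D := D.obj B)
    (F := { obj := fun _ => 𝟙_ (D.obj B), map := fun _ => 𝟙 _ })
    (G := { obj := fun _ => 𝟙_ (D.obj A), map := fun _ => 𝟙 _ } ⋙ (D.map p).toFunctor)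
    (NatIso.ofComponents (fun _ => Functor.Monoidal.εIso (D.map p).toFunctor)
      (fun _ => by simp))
  naturality_naturality α := Cat.Hom₂.ext <| NatTrans.ext <| funext fun X => by
    refine Eq.trans ?_ (NatTrans.IsMonoidal.unit (τ := (D.map₂ α).toNatTrans)).symm
    exact Category.id_comp _
  naturality_id A := Cat.Hom₂.ext <| NatTrans.ext <| funext fun X => by
    refine (NatTrans.IsMonoidal.unit (τ := (D.mapId A).hom.toNatTrans)).trans ?_
    change 𝟙 _ = 𝟙 _ ≫ 𝟙 _ ≫ 𝟙 _
    simp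
  naturality_comp p q := Cat.Hom₂.ext <| NatTrans.ext <| funext fun X => by
    refine (NatTrans.IsMonoidal.unit (τ := (D.mapComp p q).hom.toNatTrans)).trans ?_
    change Functor.LaxMonoidal.ε (D.map q).toFunctor ≫ (D.map q).toFunctor.map (Functor.LaxMonoidal.ε (D.map p).toFunctor) =
      𝟙 _ ≫ 𝟙 _ ≫ Functor.LaxMonoidal.ε (D.map q).toFunctor ≫ 𝟙 _ ≫
        (D.map q).toFunctor.map (Functor.LaxMonoidal.ε (D.map p).toFunctor) ≫ 𝟙 _
    simp

/-- A strong monoidal structure on a morphism of monoidal prederivators: its components are strong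
monoidal functors and its pseudonaturality isomorphisms are monoidal. -/
class StrongMonoidal {D E : Prederivator.{w, v, u}} [D.Monoidal] [E.Monoidal] (φ : D ⟶ E) where
  app : ∀ A : Cat.{w, w}ᵒᵖ, (φ.app A).toFunctor.Monoidal
  naturality : ∀ {A B : Cat.{w, w}ᵒᵖ} (p : A ⟶ B),
    NatTrans.IsMonoidal (φ.naturality p).hom.toNatTrans

attribute [reducible, instance] StrongMonoidal.app
attribute [instance] StrongMonoidal.naturality

instance idStrongMonoidal (D : Prederivator.{w, v, u}) [D.Monoidal] : StrongMonoidal (𝟙 D) where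
  app A := catIdMonoidal (D.obj A)
  naturality p := by
    let ζ : (D.map p).toFunctor ⋙ 𝟭 _ ⟶ 𝟭 _ ⋙ (D.map p).toFunctor :=
      (Functor.rightUnitor _).hom ≫ (Functor.leftUnitor _).inv
    have h : NatTrans.IsMonoidal ζ := inferInstance
    exact h

instance compStrongMonoidal {D E F : Prederivator.{w, v, u}} [D.Monoidal] [E.Monoidal] [F.Monoidal]
    (φ : D ⟶ E) (ψ : E ⟶ F) [StrongMonoidal φ] [StrongMonoidal ψ] : StrongMonoidal (φ ≫ ψ) where
  app A := catCompMonoidal (φ.app A) (ψ.app A)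
  naturality {A B} p := by
    let Φ : (D.map p).toFunctor ⋙ (φ.app B).toFunctor ⟶ (φ.app A).toFunctor ⋙ (E.map p).toFunctor :=
      (φ.naturality p).hom.toNatTrans
    let Ψ : (E.map p).toFunctor ⋙ (ψ.app B).toFunctor ⟶ (ψ.app A).toFunctor ⋙ (F.map p).toFunctor :=
      (ψ.naturality p).hom.toNatTrans
    have hΦ : NatTrans.IsMonoidal Φ := StrongMonoidal.naturality p
    have hΨ : NatTrans.IsMonoidal Ψ := StrongMonoidal.naturality p
    let ζ : (D.map p).toFunctor ⋙ ((φ.app B).toFunctor ⋙ (ψ.app B).toFunctor) ⟶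
        ((φ.app A).toFunctor ⋙ (ψ.app A).toFunctor) ⋙ (F.map p).toFunctor :=
      (Functor.associator _ _ _).inv ≫ Functor.whiskerRight Φ (ψ.app B).toFunctor ≫
        (Functor.associator _ _ _).hom ≫ Functor.whiskerLeft (φ.app A).toFunctor Ψ ≫
        (Functor.associator _ _ _).inv
    have h : NatTrans.IsMonoidal ζ := inferInstance
    exact h

/-- A modification between strong monoidal morphisms is monoidal if its components are. -/
class IsMonoidalModification {D E : Prederivator.{w, v, u}} [D.Monoidal] [E.Monoidal]
    {φ ψ : D ⟶ E} [StrongMonoidal φ] [StrongMonoidal ψ] (Γ : φ ⟶ ψ) : Prop where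
  app : ∀ A : Cat.{w, w}ᵒᵖ, NatTrans.IsMonoidal (Γ.as.app A).toNatTrans

end Prederivator

open Prederivator

/-! ### Derivator bicategories and shadows -/

set_option linter.checkUnivs false in
/-- The objects, hom-prederivators, composition and units of a derivator bicategory. -/
structure DerivatorBicategoryData where
  Obj : Type u'
  hom : Obj → Obj → Prederivator.{w, v, u}
  comp : ∀ R S T : Obj, (hom R S).prod (hom S T) ⟶ hom R T
  unit : ∀ R : Obj, one ⟶ hom R R

namespace DerivatorBicategoryData

variable (W : DerivatorBicategoryData.{w, v, u, u'})

/-- The composite `M ⊙ N` of `M` in `W(R, S)(A)` and `N` in `W(S, T)(A)`. -/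
abbrev cmp {R S T : W.Obj} {A : Cat.{w, w}} (M : (W.hom R S).diag A) (N : (W.hom S T).diag A) :
    (W.hom R T).diag A :=
  ((W.comp R S T).app (op A)).toFunctor.obj (M, N)

/-- The composite of morphisms of `W(R, S)(A)` and `W(S, T)(A)`. -/
abbrev cmpMap {R S T : W.Obj} {A : Cat.{w, w}} {M M' : (W.hom R S).diag A}
    {N N' : (W.hom S T).diag A} (f : M ⟶ M') (g : N ⟶ N') : W.cmp M N ⟶ W.cmp M' N' :=
  ((W.comp R S T).app (op A)).toFunctor.map (Prod.mkHom f g)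

/-- The unit object `I_{R,A}` in `W(R, R)(A)`. -/
abbrev unitObj (R : W.Obj) (A : Cat.{w, w}) : (W.hom R R).diag A :=
  ((W.unit R).app (op A)).toFunctor.obj Point.star

end DerivatorBicategoryData

/-- Associativity and unit isomorphisms (invertible modifications), not yet subject to axioms. -/
structure DerivatorBicategoryConstraints (W : DerivatorBicategoryData.{w, v, u, u'}) where
  associator : ∀ R S T U : W.Obj,
    prodMap (W.comp R S T) (𝟙 (W.hom T U)) ≫ W.comp R T U ≅
      prodAssoc (W.hom R S) (W.hom S T) (W.hom T U) ≫
        prodMap (𝟙 (W.hom R S)) (W.comp S T U) ≫ W.comp R S U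
  leftUnitor : ∀ R S : W.Obj,
    pair (toOne (W.hom R S) ≫ W.unit R) (𝟙 (W.hom R S)) ≫ W.comp R R S ≅ 𝟙 (W.hom R S)
  rightUnitor : ∀ R S : W.Obj,
    pair (𝟙 (W.hom R S)) (toOne (W.hom R S) ≫ W.unit S) ≫ W.comp R S S ≅ 𝟙 (W.hom R S)

namespace DerivatorBicategoryConstraints

variable {W : DerivatorBicategoryData.{w, v, u, u'}} (K : DerivatorBicategoryConstraints W)
  {R S T U : W.Obj} {A : Cat.{w, w}}

/-- The component `(M ⊙ N) ⊙ P ≅ M ⊙ (N ⊙ P)` of the associativity isomorphism. -/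
def assoc (M : (W.hom R S).diag A) (N : (W.hom S T).diag A) (P : (W.hom T U).diag A) :
    W.cmp (W.cmp M N) P ≅ W.cmp M (W.cmp N P) where
  hom := ((K.associator R S T U).hom.as.app (op A)).toNatTrans.app ((M, N), P)
  inv := ((K.associator R S T U).inv.as.app (op A)).toNatTrans.app ((M, N), P)
  hom_inv_id :=
    congr(($((K.associator R S T U).hom_inv_id).as.app (op A)).toNatTrans.app ((M, N), P))
  inv_hom_id :=
    congr(($((K.associator R S T U).inv_hom_id).as.app (op A)).toNatTrans.app ((M, N), P))

/-- The component `I ⊙ M ⟶ M` of the left unit isomorphism. -/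
def lunit (M : (W.hom R S).diag A) : W.cmp (W.unitObj R A) M ⟶ M :=
  ((K.leftUnitor R S).hom.as.app (op A)).toNatTrans.app M

/-- The component `M ⊙ I ⟶ M` of the right unit isomorphism. -/
def runit (M : (W.hom R S).diag A) : W.cmp M (W.unitObj S A) ⟶ M :=
  ((K.rightUnitor R S).hom.as.app (op A)).toNatTrans.app M

end DerivatorBicategoryConstraints

/-- A derivator bicategory with given objects, homs, composition and units: the homs are
derivators, composition is cocontinuous in each variable, and there are associativity and unit
isomorphisms (invertible modifications) satisfying the pentagon and unit axioms.  As equality of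
modifications is levelwise, these axioms are stated in each `W(-, -)(A)`. -/
structure DerivatorBicategory (W : DerivatorBicategoryData.{w, v, u, u'}) extends
    DerivatorBicategoryConstraints W where
  isDerivator : ∀ R S : W.Obj, (W.hom R S).IsDerivator
  cocontinuousLeft : ∀ R S T : W.Obj, IsCocontinuousLeft (W.comp R S T)
  cocontinuousRight : ∀ R S T : W.Obj, IsCocontinuousRight (W.comp R S T)
  pentagon : ∀ {R S T U X : W.Obj} {A : Cat.{w, w}} (M : (W.hom R S).diag A)
    (N : (W.hom S T).diag A) (P : (W.hom T U).diag A) (Q : (W.hom U X).diag A),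
    W.cmpMap (toDerivatorBicategoryConstraints.assoc M N P).hom (𝟙 Q) ≫
        (toDerivatorBicategoryConstraints.assoc M (W.cmp N P) Q).hom ≫
        W.cmpMap (𝟙 M) (toDerivatorBicategoryConstraints.assoc N P Q).hom =
      (toDerivatorBicategoryConstraints.assoc (W.cmp M N) P Q).hom ≫
        (toDerivatorBicategoryConstraints.assoc M N (W.cmp P Q)).hom
  triangle : ∀ {R S T : W.Obj} {A : Cat.{w, w}} (M : (W.hom R S).diag A) (N : (W.hom S T).diag A),
    (toDerivatorBicategoryConstraints.assoc M (W.unitObj S A) N).hom ≫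
        W.cmpMap (𝟙 M) (toDerivatorBicategoryConstraints.lunit N) =
      W.cmpMap (toDerivatorBicategoryConstraints.runit M) (𝟙 N)

namespace DerivatorBicategory

variable {W : DerivatorBicategoryData.{w, v, u, u'}} (B : DerivatorBicategory W)

/-- The functor `⟨-⟩ : W(R, R)(A) ⥤ T(A)` on objects, for a family of morphisms `⟨-⟩`. -/
abbrev shObj {T : Prederivator.{w, v, u}} (sh : ∀ R : W.Obj, W.hom R R ⟶ T) {R : W.Obj}
    {A : Cat.{w, w}} (M : (W.hom R R).diag A) : T.diag A :=
  ((sh R).app (op A)).toFunctor.obj M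

/-- The functor `⟨-⟩ : W(R, R)(A) ⥤ T(A)` on morphisms. -/
abbrev shMap {T : Prederivator.{w, v, u}} (sh : ∀ R : W.Obj, W.hom R R ⟶ T) {R : W.Obj}
    {A : Cat.{w, w}} {M N : (W.hom R R).diag A} (f : M ⟶ N) : shObj sh M ⟶ shObj sh N :=
  ((sh R).app (op A)).toFunctor.map f

/-- The components `⟨M ⊙ N⟩ ⟶ ⟨N ⊙ M⟩` of a family of cyclicity isomorphisms. -/
def cyc {T : Prederivator.{w, v, u}} {sh : ∀ R : W.Obj, W.hom R R ⟶ T}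
    (θ : ∀ R S : W.Obj,
      W.comp R S R ≫ sh R ≅ prodSwap (W.hom R S) (W.hom S R) ≫ W.comp S R S ≫ sh S)
    {R S : W.Obj} {A : Cat.{w, w}} (M : (W.hom R S).diag A) (N : (W.hom S R).diag A) :
    shObj sh (W.cmp M N) ⟶ shObj sh (W.cmp N M) :=
  ((θ R S).hom.as.app (op A)).toNatTrans.app (M, N)

/-- A shadow on a derivator bicategory with values in `T`, whose underlying morphisms
`⟨-⟩ : W(R, R) ⟶ T` are given: `T` is a derivator, these morphisms are cocontinuous, and there are
cyclicity isomorphisms `⟨M ⊙ N⟩ ≅ ⟨N ⊙ M⟩` (invertible modifications) compatible with the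
associativity isomorphisms (`hexagon`) and the unit isomorphisms. -/
structure Shadow (T : Prederivator.{w, v, u}) (sh : ∀ R : W.Obj, W.hom R R ⟶ T) where
  isDerivator : T.IsDerivator
  cocontinuous : ∀ R : W.Obj, IsCocontinuous (sh R)
  cyclic : ∀ R S : W.Obj,
    W.comp R S R ≫ sh R ≅ prodSwap (W.hom R S) (W.hom S R) ≫ W.comp S R S ≫ sh S
  hexagon : ∀ {R S U : W.Obj} {A : Cat.{w, w}} (M : (W.hom R S).diag A) (N : (W.hom S U).diag A)
    (P : (W.hom U R).diag A),
    shMap sh (B.assoc M N P).hom ≫ cyc cyclic M (W.cmp N P) ≫ shMap sh (B.assoc N P M).hom =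
      cyc cyclic (W.cmp M N) P ≫
        shMap sh (B.assoc P M N).inv ≫ cyc cyclic (W.cmp P M) N
  cyclic_lunit : ∀ {R : W.Obj} {A : Cat.{w, w}} (M : (W.hom R R).diag A),
    cyc cyclic M (W.unitObj R A) ≫ shMap sh (B.lunit M) = shMap sh (B.runit M)
  cyclic_runit : ∀ {R : W.Obj} {A : Cat.{w, w}} (M : (W.hom R R).diag A),
    cyc cyclic (W.unitObj R A) M ≫ shMap sh (B.runit M) = shMap sh (B.lunit M)

end DerivatorBicategory

/-! ### Indexed monoidal derivators -/

open MonoidalCategory CartesianMonoidalCategory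

set_option linter.checkUnivs false in
/-- An `S`-indexed monoidal derivator: a pseudofunctor from `Sᵒᵖ` to the 2-category of monoidal
derivators, cocontinuous strong monoidal morphisms and monoidal modifications.  (All 2-cells of
the source are identities, so monoidality of their images is automatic.) -/
structure IndexedMonoidalDerivator (S : Type u') [Category.{v'} S] where
  functor : Pseudofunctor (LocallyDiscrete Sᵒᵖ) Prederivator.{w, v, u}
  isDerivator : ∀ R, (functor.obj R).IsDerivator
  monoidal : ∀ R, (functor.obj R).Monoidal
  tensor_cocontinuousLeft : ∀ R, IsCocontinuousLeft (tensor (functor.obj R))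
  tensor_cocontinuousRight : ∀ R, IsCocontinuousRight (tensor (functor.obj R))
  strongMonoidal : ∀ {R T} (f : R ⟶ T), StrongMonoidal (functor.map f)
  cocontinuous : ∀ {R T} (f : R ⟶ T), IsCocontinuous (functor.map f)
  mapId_monoidal : ∀ R, IsMonoidalModification (functor.mapId R).hom
  mapComp_monoidal : ∀ {R T U} (f : R ⟶ T) (g : T ⟶ U),
    IsMonoidalModification (functor.mapComp f g).hom

attribute [instance] IndexedMonoidalDerivator.monoidal IndexedMonoidalDerivator.strongMonoidal

/-- `IsHomotopyPullback f h g k` says that the commutative square with top `f : A ⟶ B`, left side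
`h : A ⟶ C`, right side `g : B ⟶ D` and bottom `k : C ⟶ D` is a homotopy pullback square: it belongs
to one of the three families `exchange`, `graph`, `diagonal` (with corners `A × C, B × C, A × D, B × D`;
`A, A × B, B, B × B`; `A, A × A, A × A, A × A × A`), or it is obtained from such a square by taking
products with a fixed object. -/
inductive IsHomotopyPullback {S : Type u'} [Category.{v'} S] [CartesianMonoidalCategory S] :
    ∀ {A B C D : S}, (A ⟶ B) → (A ⟶ C) → (B ⟶ D) → (C ⟶ D) → Prop
  | exchange {A B C D : S} (f : A ⟶ B) (g : C ⟶ D) :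
      IsHomotopyPullback (f ▷ C) (A ◁ g) (B ◁ g) (f ▷ D)
  | graph {A B : S} (f : A ⟶ B) :
      IsHomotopyPullback (lift (𝟙 A) f) f (f ▷ B) (lift (𝟙 B) (𝟙 B))
  | diagonal (A : S) :
      IsHomotopyPullback (lift (𝟙 A) (𝟙 A)) (lift (𝟙 A) (𝟙 A)) (A ◁ lift (𝟙 A) (𝟙 A))
        (lift (𝟙 A) (𝟙 A) ▷ A ≫ (α_ A A A).hom)
  | prodLeft (Z : S) {A B C D : S} {f : A ⟶ B} {h : A ⟶ C} {g : B ⟶ D} {k : C ⟶ D} :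
      IsHomotopyPullback f h g k → IsHomotopyPullback (Z ◁ f) (Z ◁ h) (Z ◁ g) (Z ◁ k)
  | prodRight (Z : S) {A B C D : S} {f : A ⟶ B} {h : A ⟶ C} {g : B ⟶ D} {k : C ⟶ D} :
      IsHomotopyPullback f h g k → IsHomotopyPullback (f ▷ Z) (h ▷ Z) (g ▷ Z) (k ▷ Z)

theorem IsHomotopyPullback.w {S : Type u'} [Category.{v'} S] [CartesianMonoidalCategory S]
    {A B C D : S} {f : A ⟶ B} {h : A ⟶ C} {g : B ⟶ D} {k : C ⟶ D}
    (sq : IsHomotopyPullback f h g k) : f ≫ g = h ≫ k := by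
  induction sq with
  | exchange f g => exact (whisker_exchange f g).symm
  | graph f => ext <;> simp
  | diagonal A => ext <;> simp
  | prodLeft Z _ ih => rw [← whiskerLeft_comp, ih, whiskerLeft_comp]
  | prodRight Z _ ih => rw [← comp_whiskerRight, ih, comp_whiskerRight]

/-- The morphism `id × Δ × id : R × T × U ⟶ (R × T) × (T × U)`. -/
def insertDiagonal {S : Type u'} [Category.{v'} S] [CartesianMonoidalCategory S] (R T U : S) :
    R ⊗ (T ⊗ U) ⟶ (R ⊗ T) ⊗ (T ⊗ U) :=
  lift (R ◁ CartesianMonoidalCategory.fst T U) (CartesianMonoidalCategory.snd R (T ⊗ U))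

/-- The morphism `id × π × id : R × T × U ⟶ R × U`. -/
def projectMiddle {S : Type u'} [Category.{v'} S] [CartesianMonoidalCategory S] (R T U : S) :
    R ⊗ (T ⊗ U) ⟶ R ⊗ U :=
  R ◁ CartesianMonoidalCategory.snd T U

namespace IndexedMonoidalDerivator

section

variable {S : Type u'} [Category.{v'} S] (V : IndexedMonoidalDerivator.{w, v, u} S)

/-- The monoidal derivator `V^R`. -/
abbrev fib (R : S) : Prederivator.{w, v, u} := V.functor.obj ⟨op R⟩

/-- The reindexing morphism `f^* : V^T ⟶ V^R` along `f : R ⟶ T`. -/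
abbrev pb {R T : S} (f : R ⟶ T) : V.fib T ⟶ V.fib R := V.functor.map f.op.toLoc

/-- The isomorphism `h^* k^* ≅ f^* g^*` attached to a commutative square. -/
def pbSquare {A B C D : S} {f : A ⟶ B} {h : A ⟶ C} {g : B ⟶ D} {k : C ⟶ D}
    (e : f ≫ g = h ≫ k) : V.pb k ≫ V.pb h ≅ V.pb g ≫ V.pb f :=
  V.functor.isoMapOfCommSq (CommSq.mk e).op.toLoc

/-- A symmetry on an indexed monoidal derivator: each monoidal derivator `V^R` is symmetric, and the
reindexing morphisms are symmetric monoidal. -/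
structure Symmetric where
  symmetric : ∀ (R : S) (A : Cat.{w, w}), SymmetricCategory ((V.fib R).diag A)
  pull_braided : ∀ (R : S) {A B : Cat.{w, w}} (p : A ⟶ B) (X Y : (V.fib R).diag B),
    Functor.LaxMonoidal.μ ((V.fib R).pull p).toFunctor X Y ≫
        ((V.fib R).pull p).toFunctor.map (β_ X Y).hom =
      (β_ _ _).hom ≫ Functor.LaxMonoidal.μ ((V.fib R).pull p).toFunctor Y X
  pb_braided : ∀ {R T : S} (f : R ⟶ T) (A : Cat.{w, w}) (X Y : (V.fib T).diag A),
    Functor.LaxMonoidal.μ ((V.pb f).app (op A)).toFunctor X Y ≫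
        ((V.pb f).app (op A)).toFunctor.map (β_ X Y).hom =
      (β_ _ _).hom ≫ Functor.LaxMonoidal.μ ((V.pb f).app (op A)).toFunctor Y X

end

section

variable {S : Type u'} [Category.{v'} S] [CartesianMonoidalCategory S]
  (V : IndexedMonoidalDerivator.{w, v, u} S)

/-- Indexed homotopy coproducts: every reindexing morphism `f^*` has a left adjoint `f_!` in the
2-category of derivators, and for every homotopy pullback square the Beck-Chevalley map
`f_! h^* ⟶ g^* k_!` is an isomorphism. -/
structure IndexedHomotopyCoproducts where
  pf : ∀ {R T : S} (_ : R ⟶ T), V.fib R ⟶ V.fib T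
  adj : ∀ {R T : S} (f : R ⟶ T), Bicategory.Adjunction (pf f) (V.pb f)
  beckChevalley : ∀ {A B C D : S} {f : A ⟶ B} {h : A ⟶ C} {g : B ⟶ D} {k : C ⟶ D}
    (sq : IsHomotopyPullback f h g k),
    IsIso ((Bicategory.mateEquiv (adj k) (adj f)).symm (V.pbSquare sq.w).hom)

/-- The external product `X ⊠ Y = π_T^* X ⊗ π_R^* Y`, as a morphism `V^R × V^T ⟶ V^(R × T)`. -/
def ext (R T : S) : (V.fib R).prod (V.fib T) ⟶ V.fib (R ⊗ T) :=
  prodMap (V.pb (CartesianMonoidalCategory.fst R T)) (V.pb (CartesianMonoidalCategory.snd R T)) ≫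
    tensor (V.fib (R ⊗ T))

variable {V}

namespace IndexedHomotopyCoproducts

variable (P : V.IndexedHomotopyCoproducts)

/-- The map `f_! (f^* M ⊗ N) ⟶ M ⊗ f_! N`. -/
def projLeft {R T : S} (f : R ⟶ T) {A : Cat.{w, w}} (M : (V.fib T).diag A) (N : (V.fib R).diag A) :
    ((P.pf f).app (op A)).toFunctor.obj (((V.pb f).app (op A)).toFunctor.obj M ⊗ N) ⟶
      M ⊗ ((P.pf f).app (op A)).toFunctor.obj N :=
  ((P.pf f).app (op A)).toFunctor.map
      (((V.pb f).app (op A)).toFunctor.obj M ◁ ((P.adj f).unit.as.app (op A)).toNatTrans.app N) ≫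
    ((P.pf f).app (op A)).toFunctor.map
      (Functor.LaxMonoidal.μ ((V.pb f).app (op A)).toFunctor M
        (((P.pf f).app (op A)).toFunctor.obj N)) ≫
    ((P.adj f).counit.as.app (op A)).toNatTrans.app _

/-- The map `f_! (N ⊗ f^* M) ⟶ f_! N ⊗ M`. -/
def projRight {R T : S} (f : R ⟶ T) {A : Cat.{w, w}} (M : (V.fib T).diag A) (N : (V.fib R).diag A) :
    ((P.pf f).app (op A)).toFunctor.obj (N ⊗ ((V.pb f).app (op A)).toFunctor.obj M) ⟶
      ((P.pf f).app (op A)).toFunctor.obj N ⊗ M :=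
  ((P.pf f).app (op A)).toFunctor.map
      (((P.adj f).unit.as.app (op A)).toNatTrans.app N ▷ ((V.pb f).app (op A)).toFunctor.obj M) ≫
    ((P.pf f).app (op A)).toFunctor.map
      (Functor.LaxMonoidal.μ ((V.pb f).app (op A)).toFunctor
        (((P.pf f).app (op A)).toFunctor.obj N) M) ≫
    ((P.adj f).counit.as.app (op A)).toNatTrans.app _

/-- The tensor product preserves indexed homotopy coproducts in each variable (the projection
formula), levelwise. -/
structure PreservedByTensor : Prop where
  left : ∀ {R T : S} (f : R ⟶ T) {A : Cat.{w, w}} (M : (V.fib T).diag A) (N : (V.fib R).diag A),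
    IsIso (P.projLeft f M N)
  right : ∀ {R T : S} (f : R ⟶ T) {A : Cat.{w, w}} (M : (V.fib T).diag A) (N : (V.fib R).diag A),
    IsIso (P.projRight f M N)

end IndexedHomotopyCoproducts

end

end IndexedMonoidalDerivator

/-!
The composite `M ⊙ N` should be thought of as the coproduct over `t : T` of `M(r, t) ⊗ N(t, u)`, and
the proof makes this literal with generalized elements.  For `r : Z ⟶ R` and `t : Z ⟶ T` put
`M(r, t) = (r, t)^* M`, an object over `Z` (`ev`).  The insertion into the coproduct defining `M ⊙ N`
restricts to balancing maps `M(r, t) ⊗ N(t, u) ⟶ (M ⊙ N)(r, u)` (`Coproducts.bal`), natural in `M`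
and `N` and stable under change of `Z`; there are similar points `𝟙 ⟶ I(r, r)` (`Coproducts.point`)
and trace maps `M(r, r) ⟶ ⟨M⟩` (`Coproducts.tr`).

Fix a small category `A`.  The categories `V^R(A)` form an indexed monoidal category with indexed
coproducts (`IndexedMonoidalDerivator.level`, `IndexedHomotopyCoproducts.level`), and coproducts are
described by universal arrows `E ⟶ k^* L`.  The Beck-Chevalley condition for exchange squares shows
that balancing maps are universal over any product decomposition (`isUniversalArrow_bal`), and the
projection formula shows that universality survives tensoring and iteration
(`isUniversalArrow_whiskerRight_bal`, `isUniversalArrow_whiskerLeft_bal`).  So a morphism out of a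
composite, an iterated composite or a shadow is the same as a suitable family of morphisms out of
tensor products of values.  The associativity, unit and cyclicity isomorphisms are defined to be the
morphisms which, at all generalized elements, are the associator, the unitors and the symmetry of `⊗`
(`balLeft_comp_assocHom`, `map_lunitInv`, `map_runitInv`, `balTr_comp_cyc`); invertibility follows
from universality on both sides, and the pentagon, triangle and hexagon reduce to those of `⊗`.

Restriction along `p : A ⟶ B` is a strong monoidal morphism of indexed monoidal categories that
preserves the coproducts (`IndexedHomotopyCoproducts.restrict`).  As the constraints are characterized
by their behaviour on balancing maps, such a morphism carries constraints to constraints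
(`carries_assocHom`, `carries_lunitInv`, `carries_runitInv`, `carries_cyc`), which says exactly that
they are modifications (`isoOfComparison`).

Finally, a morphism of derivators is cocontinuous if and only if it preserves arrows universal to
restriction functors (`isCocontinuous_iff` and its two-variable forms).  With this description,
cocontinuity of left adjoints and of composites is immediate, and composition and shadow are built
from the tensor product, restrictions and left adjoints.
-/

/-! ### Universal arrows -/

section UniversalArrow

universe v₁ u₁ v₂ u₂ v₃ u₃

variable {C : Type u₁} [Category.{v₁} C] {D : Type u₂} [Category.{v₂} D]
  {E : Type u₃} [Category.{v₃} E]

/-- An arrow `e : X ⟶ G Y` is universal from `X` to `G` if every arrow `X ⟶ G W` factors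
uniquely as `e` followed by the image of an arrow `Y ⟶ W`. -/
def IsUniversalArrow (G : D ⥤ C) {X : C} {Y : D} (e : X ⟶ G.obj Y) : Prop :=
  ∀ W : D, Function.Bijective fun f : Y ⟶ W => e ≫ G.map f

namespace IsUniversalArrow

theorem hom_ext {G : D ⥤ C} {X : C} {Y W : D} {e : X ⟶ G.obj Y} (he : IsUniversalArrow G e)
    {f g : Y ⟶ W} (h : e ≫ G.map f = e ≫ G.map g) : f = g :=
  (he W).1 h

theorem exists_fac {G : D ⥤ C} {X : C} {Y W : D} {e : X ⟶ G.obj Y} (he : IsUniversalArrow G e)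
    (k : X ⟶ G.obj W) : ∃ f : Y ⟶ W, e ≫ G.map f = k :=
  (he W).2 k

theorem iso_comp {G : D ⥤ C} {X X' : C} {Y : D} {e : X ⟶ G.obj Y} (he : IsUniversalArrow G e)
    (i : X' ⟶ X) [IsIso i] : IsUniversalArrow G (i ≫ e) := fun W => by
  refine ⟨fun f g h => he.hom_ext ?_, fun k => ?_⟩
  · exact (cancel_epi i).1 (by simpa only [Category.assoc] using h)
  · obtain ⟨f, hf⟩ := he.exists_fac (inv i ≫ k)
    exact ⟨f, by simp [hf]⟩

theorem comp_map_iso {G : D ⥤ C} {X : C} {Y Y' : D} {e : X ⟶ G.obj Y}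
    (he : IsUniversalArrow G e) (j : Y ⟶ Y') [IsIso j] : IsUniversalArrow G (e ≫ G.map j) :=
  fun W => by
    refine ⟨fun f g h => ?_, fun k => ?_⟩
    · rw [← cancel_epi j]
      exact he.hom_ext (by simpa using h)
    · obtain ⟨f, hf⟩ := he.exists_fac k
      exact ⟨inv j ≫ f, by simp [hf]⟩

theorem comp_natIso {G G' : D ⥤ C} {X : C} {Y : D} {e : X ⟶ G.obj Y}
    (he : IsUniversalArrow G e) (α : G ≅ G') : IsUniversalArrow G' (e ≫ α.hom.app Y) :=
  fun W => by
    refine ⟨fun f g h => he.hom_ext ?_, fun k => ?_⟩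
    · rw [← cancel_mono (α.hom.app W)]
      simpa only [Category.assoc, α.hom.naturality] using h
    · obtain ⟨f, hf⟩ := he.exists_fac (k ≫ α.inv.app W)
      refine ⟨f, ?_⟩
      change (e ≫ α.hom.app Y) ≫ G'.map f = k
      rw [Category.assoc, ← α.hom.naturality, reassoc_of% hf, Iso.inv_hom_id_app, Category.comp_id]

theorem trans {G : D ⥤ C} {H : E ⥤ D} {X : C} {Y : D} {Z : E} {e : X ⟶ G.obj Y}
    {e' : Y ⟶ H.obj Z} (he : IsUniversalArrow G e) (he' : IsUniversalArrow H e') :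
    IsUniversalArrow (H ⋙ G) (e ≫ G.map e') := fun W => by
  refine ⟨fun f g h => he'.hom_ext (he.hom_ext ?_), fun k => ?_⟩
  · simpa using h
  · obtain ⟨f, hf⟩ := he.exists_fac k
    obtain ⟨g, hg⟩ := he'.exists_fac f
    exact ⟨g, by simp [← hf, ← hg]⟩

theorem isIso_of_fac {G : D ⥤ C} {X : C} {Y Y' : D} {e : X ⟶ G.obj Y} {e' : X ⟶ G.obj Y'}
    (he : IsUniversalArrow G e) (he' : IsUniversalArrow G e') (f : Y ⟶ Y')
    (hf : e ≫ G.map f = e') : IsIso f := by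
  obtain ⟨g, hg⟩ := he'.exists_fac e
  refine ⟨g, he.hom_ext ?_, he'.hom_ext ?_⟩
  · simp [reassoc_of% hf, hg]
  · simp [reassoc_of% hg, hf]

theorem of_isIso_fac {G : D ⥤ C} {X : C} {Y Y' : D} {e : X ⟶ G.obj Y} {e' : X ⟶ G.obj Y'}
    (he : IsUniversalArrow G e) (f : Y ⟶ Y') [IsIso f]
    (hf : e ≫ G.map f = e') : IsUniversalArrow G e' :=
  hf ▸ he.comp_map_iso f

/-- Universal arrows to an equivalence are invertible. -/
theorem isIso {G : D ⥤ C} [G.IsEquivalence] {X : C} {Y : D} {e : X ⟶ G.obj Y}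
    (he : IsUniversalArrow G e) : IsIso e := by
  obtain ⟨f, hf⟩ := he.exists_fac (W := G.objPreimage X) (G.objObjPreimageIso X).inv
  refine ⟨G.map f ≫ (G.objObjPreimageIso X).hom, by simp [reassoc_of% hf], ?_⟩
  have : f ≫ G.preimage ((G.objObjPreimageIso X).hom ≫ e) = 𝟙 _ :=
    he.hom_ext (by simp [reassoc_of% hf])
  simpa using congrArg G.map this

theorem of_isIso {G : D ⥤ C} [G.Full] [G.Faithful] {X : C} {Y : D} (e : X ⟶ G.obj Y) [IsIso e] :
    IsUniversalArrow G e := fun W => by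
  refine ⟨fun f g h => G.map_injective ?_, fun k => ⟨G.preimage (inv e ≫ k), by simp⟩⟩
  exact (cancel_epi e).1 h

theorem congr {G : D ⥤ C} {X : C} {Y : D} {e e' : X ⟶ G.obj Y} (he : IsUniversalArrow G e)
    (h : e = e') : IsUniversalArrow G e' :=
  h ▸ he

theorem of_comp_map {G : D ⥤ C} {H : E ⥤ D} {X : C} {Y : D} {Z : E} {e : X ⟶ G.obj Y}
    {e' : Y ⟶ H.obj Z} (he : IsUniversalArrow G e)
    (h : IsUniversalArrow (H ⋙ G) (Y := Z) (e ≫ G.map e')) : IsUniversalArrow H e' := fun W => by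
  refine ⟨fun f g hfg => h.hom_ext ?_, fun k => ?_⟩
  · simpa using congr(e ≫ G.map $hfg)
  · obtain ⟨f, hf⟩ := h.exists_fac (e ≫ G.map k)
    exact ⟨f, he.hom_ext (by simpa using hf)⟩

end IsUniversalArrow

theorem isUniversalArrow_unit {L : C ⥤ D} {R : D ⥤ C} (adj : L ⊣ R) (X : C) :
    IsUniversalArrow R (adj.unit.app X) := fun W =>
  ⟨fun f g h => (adj.homEquiv X W).injective
      (by simpa [Adjunction.homEquiv_unit] using h),
    fun k => ⟨(adj.homEquiv X W).symm k,
      (adj.homEquiv_unit ..).symm.trans ((adj.homEquiv X W).apply_symm_apply k)⟩⟩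

end UniversalArrow

/-! ### Comparison squares -/

section CommSquares

universe v₁ u₁ v₂ u₂

variable {C : Type u₁} [Category.{v₁} C] {D : Type u₂} [Category.{v₂} D]

/-- The functor `F` carries `f` to `f'`, relative to the comparison maps `c` and `c'`: the square
formed by `F f`, `f'`, `c` and `c'` commutes.  In the applications `F` is a restriction functor or
a component of a morphism of indexed categories, and `X'`, `Y'` are formed in the target in the
same way as `X`, `Y` in the source. -/
def Carries (F : C ⥤ D) {X Y : C} {X' Y' : D} (c : F.obj X ⟶ X') (c' : F.obj Y ⟶ Y')
    (f : X ⟶ Y) (f' : X' ⟶ Y') : Prop :=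
  F.map f ≫ c' = c ≫ f'

namespace Carries

variable {F : C ⥤ D} {X Y Z : C} {X' Y' Z' : D}

theorem id (c : F.obj X ⟶ X') : Carries F c c (𝟙 X) (𝟙 X') := by simp [Carries]

theorem comp {c : F.obj X ⟶ X'} {c' : F.obj Y ⟶ Y'} {c'' : F.obj Z ⟶ Z'} {f : X ⟶ Y} {g : Y ⟶ Z}
    {f' : X' ⟶ Y'} {g' : Y' ⟶ Z'} (hf : Carries F c c' f f') (hg : Carries F c' c'' g g') :
    Carries F c c'' (f ≫ g) (f' ≫ g') := by
  unfold Carries at *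
  rw [F.map_comp, Category.assoc, hg, reassoc_of% hf]

theorem inv {c : F.obj X ⟶ X'} {c' : F.obj Y ⟶ Y'} {f : X ⟶ Y} {f' : X' ⟶ Y'} [IsIso f]
    [IsIso f'] (h : Carries F c c' f f') :
    Carries F c' c (CategoryTheory.inv f) (CategoryTheory.inv f') := by
  unfold Carries at *
  rw [IsIso.eq_comp_inv, Category.assoc, ← h, ← Functor.map_comp_assoc]
  simp

/-- Morphisms out of `X'` are determined by what they are carried from, as soon as the comparison
map of the source is invertible. -/
theorem unique {c : F.obj X ⟶ X'} {c' : F.obj Y ⟶ Y'} [IsIso c] {f : X ⟶ Y}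
    {f' f'' : X' ⟶ Y'} (h : Carries F c c' f f') (h' : Carries F c c' f f'') : f' = f'' := by
  unfold Carries at *
  rwa [h, cancel_epi] at h'

end Carries

variable [MonoidalCategory C] [MonoidalCategory D] (F : C ⥤ D) [F.Monoidal]

open Functor.LaxMonoidal Functor.OplaxMonoidal

/-- The comparison map `F (X ⊗ Y) ⟶ X' ⊗ Y'` obtained from comparison maps for `X` and `Y`. -/
def tensorComparison {X Y : C} {X' Y' : D} (c : F.obj X ⟶ X') (d : F.obj Y ⟶ Y') :
    F.obj (X ⊗ Y) ⟶ X' ⊗ Y' :=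
  δ F X Y ≫ (c ⊗ₘ d)

instance {X Y : C} {X' Y' : D} (c : F.obj X ⟶ X') (d : F.obj Y ⟶ Y') [IsIso c] [IsIso d] :
    IsIso (tensorComparison F c d) := by
  unfold tensorComparison; infer_instance

variable {F}

theorem tensorComparison_comp {X Y : C} {X' Y' X'' Y'' : D} (c : F.obj X ⟶ X')
    (d : F.obj Y ⟶ Y') (f : X' ⟶ X'') (g : Y' ⟶ Y'') :
    tensorComparison F c d ≫ (f ⊗ₘ g) = tensorComparison F (c ≫ f) (d ≫ g) := by
  simp [tensorComparison]

theorem map_tensorHom_comp_tensorComparison {X Y X₁ Y₁ : C} {X' Y' : D} (f : X₁ ⟶ X)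
    (g : Y₁ ⟶ Y) (c : F.obj X ⟶ X') (d : F.obj Y ⟶ Y') :
    F.map (f ⊗ₘ g) ≫ tensorComparison F c d = tensorComparison F (F.map f ≫ c) (F.map g ≫ d) := by
  simp [tensorComparison, ← δ_natural_assoc]

theorem μ_comp_tensorComparison {X Y : C} {X' Y' : D} (c : F.obj X ⟶ X')
    (d : F.obj Y ⟶ Y') : μ F X Y ≫ tensorComparison F c d = c ⊗ₘ d := by
  simp [tensorComparison]

namespace Carries

theorem tensor {X₁ Y₁ X₂ Y₂ : C} {X₁' Y₁' X₂' Y₂' : D} {c₁ : F.obj X₁ ⟶ X₁'}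
    {d₁ : F.obj Y₁ ⟶ Y₁'} {c₂ : F.obj X₂ ⟶ X₂'} {d₂ : F.obj Y₂ ⟶ Y₂'} {f₁ : X₁ ⟶ Y₁}
    {f₁' : X₁' ⟶ Y₁'} {f₂ : X₂ ⟶ Y₂} {f₂' : X₂' ⟶ Y₂'} (h₁ : Carries F c₁ d₁ f₁ f₁')
    (h₂ : Carries F c₂ d₂ f₂ f₂') :
    Carries F (tensorComparison F c₁ c₂) (tensorComparison F d₁ d₂) (f₁ ⊗ₘ f₂) (f₁' ⊗ₘ f₂') := by
  unfold Carries at *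
  rw [map_tensorHom_comp_tensorComparison, h₁, h₂, tensorComparison_comp]

theorem whiskerRight {X₁ Y₁ X₂ : C} {X₁' Y₁' X₂' : D} {c₁ : F.obj X₁ ⟶ X₁'}
    {d₁ : F.obj Y₁ ⟶ Y₁'} (c₂ : F.obj X₂ ⟶ X₂') {f₁ : X₁ ⟶ Y₁}
    {f₁' : X₁' ⟶ Y₁'} (h₁ : Carries F c₁ d₁ f₁ f₁') :
    Carries F (tensorComparison F c₁ c₂) (tensorComparison F d₁ c₂) (f₁ ▷ X₂) (f₁' ▷ X₂') := by
  simpa using h₁.tensor (Carries.id c₂)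

theorem whiskerLeft {X₁ Y₁ X₂ : C} {X₁' Y₁' X₂' : D} {c₁ : F.obj X₁ ⟶ X₁'}
    {d₁ : F.obj Y₁ ⟶ Y₁'} (c₂ : F.obj X₂ ⟶ X₂') {f₁ : X₁ ⟶ Y₁}
    {f₁' : X₁' ⟶ Y₁'} (h₁ : Carries F c₁ d₁ f₁ f₁') :
    Carries F (tensorComparison F c₂ c₁) (tensorComparison F c₂ d₁) (X₂ ◁ f₁) (X₂' ◁ f₁') := by
  simpa using (Carries.id c₂).tensor h₁

theorem associator {X Y Z : C} {X' Y' Z' : D} (c : F.obj X ⟶ X') (d : F.obj Y ⟶ Y')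
    (e : F.obj Z ⟶ Z') :
    Carries F (tensorComparison F (tensorComparison F c d) e)
      (tensorComparison F c (tensorComparison F d e)) (α_ X Y Z).hom (α_ X' Y' Z').hom := by
  simp only [Carries, tensorComparison, Category.assoc]
  have h₁ : (δ F X Y ≫ (c ⊗ₘ d)) ⊗ₘ e = δ F X Y ▷ F.obj Z ≫ ((c ⊗ₘ d) ⊗ₘ e) := by
    simp [MonoidalCategory.tensorHom_def]
  have h₂ : c ⊗ₘ (δ F Y Z ≫ (d ⊗ₘ e)) = F.obj X ◁ δ F Y Z ≫ (c ⊗ₘ (d ⊗ₘ e)) := by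
    rw [← id_tensorHom, tensorHom_comp_tensorHom, Category.id_comp]
  rw [h₁, h₂, Category.assoc, associator_naturality]
  simp

theorem leftUnitor_inv {X : C} {X' : D} (c : F.obj X ⟶ X') :
    Carries F c (tensorComparison F (η F) c) (λ_ X).inv (λ_ X').inv := by
  simp only [Carries, tensorComparison, MonoidalCategory.tensorHom_def]
  rw [leftUnitor_inv_naturality]
  simp [Functor.OplaxMonoidal.left_unitality]

theorem rightUnitor_inv {X : C} {X' : D} (c : F.obj X ⟶ X') :
    Carries F c (tensorComparison F c (η F)) (ρ_ X).inv (ρ_ X').inv := by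
  simp only [Carries, tensorComparison, MonoidalCategory.tensorHom_def']
  rw [rightUnitor_inv_naturality]
  simp [Functor.OplaxMonoidal.right_unitality]

theorem braiding [SymmetricCategory C] [SymmetricCategory D]
    (hF : ∀ X Y : C, μ F X Y ≫ F.map (β_ X Y).hom = (β_ _ _).hom ≫ μ F Y X)
    {X Y : C} {X' Y' : D} (c : F.obj X ⟶ X') (d : F.obj Y ⟶ Y') :
    Carries F (tensorComparison F c d) (tensorComparison F d c) (β_ X Y).hom (β_ X' Y').hom := by
  simp only [Carries]
  rw [← cancel_epi (μ F X Y), reassoc_of% hF X Y, μ_comp_tensorComparison, ← Category.assoc,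
    μ_comp_tensorComparison, BraidedCategory.braiding_naturality]

end Carries

end CommSquares

/-! ### Indexed monoidal categories -/

set_option linter.checkUnivs false in
/-- An indexed monoidal category over `S`: the structure that an indexed monoidal derivator has at
each fixed small category.  The comparison `pullComp` takes the composite as an extra
argument, so that restrictions along propositionally equal maps can be compared without
transport.  The isomorphisms `pullId` carry no coherence: they serve to show that restriction
along an isomorphism is an equivalence, which is a property. -/
structure IndexedMonoidalCategory (S : Type u') [Category.{v'} S] where
  Fib : S → Type u
  cat : ∀ Z, Category.{v} (Fib Z)
  mon : ∀ Z, MonoidalCategory (Fib Z)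
  pull : ∀ {Z X : S}, (Z ⟶ X) → Fib X ⥤ Fib Z
  pullMon : ∀ {Z X : S} (x : Z ⟶ X), (pull x).Monoidal
  pullComp : ∀ {Z' Z X : S} (z : Z' ⟶ Z) (x : Z ⟶ X) (y : Z' ⟶ X), z ≫ x = y →
    (pull x ⋙ pull z ≅ pull y)
  pullComp_isMonoidal : ∀ {Z' Z X : S} (z : Z' ⟶ Z) (x : Z ⟶ X) (y : Z' ⟶ X) (h : z ≫ x = y),
    NatTrans.IsMonoidal (pullComp z x y h).hom
  pullComp_assoc : ∀ {Z₂ Z₁ Z₀ X : S} (w : Z₂ ⟶ Z₁) (z : Z₁ ⟶ Z₀) (x : Z₀ ⟶ X) (wz : Z₂ ⟶ Z₀)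
    (zx : Z₁ ⟶ X) (y : Z₂ ⟶ X) (h : w ≫ z = wz) (h' : z ≫ x = zx) (h₁ : w ≫ zx = y)
    (h₂ : wz ≫ x = y) (M : Fib X),
    (pull w).map ((pullComp z x zx h').hom.app M) ≫ (pullComp w zx y h₁).hom.app M =
      (pullComp w z wz h).hom.app ((pull x).obj M) ≫ (pullComp wz x y h₂).hom.app M
  pullId : ∀ Z, pull (𝟙 Z) ≅ 𝟭 (Fib Z)

attribute [instance] IndexedMonoidalCategory.cat IndexedMonoidalCategory.mon
  IndexedMonoidalCategory.pullMon
attribute [instance] IndexedMonoidalCategory.pullComp_isMonoidal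

namespace IndexedMonoidalCategory

open Functor.LaxMonoidal Functor.OplaxMonoidal

section

variable {S : Type u'} [Category.{v'} S] (V : IndexedMonoidalCategory.{v, u} S)

instance isEquivalence_pull {Z X : S} (x : Z ⟶ X) [IsIso x] : (V.pull x).IsEquivalence :=
  (CategoryTheory.Equivalence.mk (V.pull x) (V.pull (inv x))
    ((V.pullId X).symm ≪≫ (V.pullComp (inv x) x (𝟙 X) (by simp)).symm)
    (V.pullComp x (inv x) (𝟙 Z) (by simp) ≪≫ V.pullId Z)).isEquivalence_functor

/-- The comparison `z^* x^* M ⟶ y^* M` for `z ≫ x = y`. -/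
abbrev cmpr {Z' Z X : S} (z : Z' ⟶ Z) (x : Z ⟶ X) (y : Z' ⟶ X) (h : z ≫ x = y) (M : V.Fib X) :
    (V.pull z).obj ((V.pull x).obj M) ⟶ (V.pull y).obj M :=
  (V.pullComp z x y h).hom.app M

theorem carries_pull_map {Z' Z X : S} (z : Z' ⟶ Z) (x : Z ⟶ X) (y : Z' ⟶ X) (h : z ≫ x = y)
    {M N : V.Fib X} (f : M ⟶ N) :
    Carries (V.pull z) (V.cmpr z x y h M) (V.cmpr z x y h N) ((V.pull x).map f)
      ((V.pull y).map f) :=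
  (V.pullComp z x y h).hom.naturality f

variable {V}

/-- Compatibility with `pullComp` of comparison maps for two objects passes to their tensor
product, since `pullComp` is monoidal. -/
theorem map_tensorComparison_comp {Z₂ Z₁ Z₀ : S} {w : Z₂ ⟶ Z₁} {z : Z₁ ⟶ Z₀} {y : Z₂ ⟶ Z₀}
    (h : w ≫ z = y)
    {M N : V.Fib Z₀} {M₁ N₁ : V.Fib Z₁} {M₂ N₂ : V.Fib Z₂} {a : (V.pull z).obj M ⟶ M₁}
    {b : (V.pull z).obj N ⟶ N₁} {c : (V.pull w).obj M₁ ⟶ M₂} {d : (V.pull w).obj N₁ ⟶ N₂}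
    {a' : (V.pull y).obj M ⟶ M₂} {b' : (V.pull y).obj N ⟶ N₂}
    (ha : (V.pull w).map a ≫ c = V.cmpr w z y h M ≫ a')
    (hb : (V.pull w).map b ≫ d = V.cmpr w z y h N ≫ b') :
    (V.pull w).map (tensorComparison (V.pull z) a b) ≫ tensorComparison (V.pull w) c d =
      V.cmpr w z y h (M ⊗ N) ≫ tensorComparison (V.pull y) a' b' := by
  have hm := NatTrans.IsMonoidal.tensor (τ := (V.pullComp w z y h).hom) M N
  simp only [Functor.LaxMonoidal.comp_μ, Category.assoc] at hm
  rw [← cancel_epi ((V.pull w).map (μ (V.pull z) M N)), ← cancel_epi (μ (V.pull w) _ _)]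
  rw [reassoc_of% hm, μ_comp_tensorComparison, ← Functor.map_comp_assoc, μ_comp_tensorComparison,
    map_tensorHom_comp_tensorComparison, μ_comp_tensorComparison, ha, hb,
    tensorHom_comp_tensorHom]

/-! ### Beck-Chevalley squares -/

/-- A commutative square with top `f`, left side `h`, right side `g` and bottom `k` is a
Beck-Chevalley square if restricting along it takes arrows universal over `k` to arrows universal
over `f`.  When the restriction functors have left adjoints, this says that the Beck-Chevalley map
`f_! h^* ⟶ g^* k_!` is invertible. -/
def IsBeckChevalley (V : IndexedMonoidalCategory.{v, u} S) {A B C D : S} (f : A ⟶ B) (h : A ⟶ C)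
    (g : B ⟶ D) (k : C ⟶ D) : Prop :=
  ∀ (y : A ⟶ D) (hy : h ≫ k = y) (hy' : f ≫ g = y) {E : V.Fib C} {L : V.Fib D}
    (e : E ⟶ (V.pull k).obj L), IsUniversalArrow (V.pull k) e →
    IsUniversalArrow (V.pull f)
      ((V.pull h).map e ≫ V.cmpr h k y hy L ≫ (V.pullComp f g y hy').inv.app L)

theorem IsBeckChevalley.paste {A B C D A' B' : S} {f : A ⟶ B} {h : A ⟶ C} {g : B ⟶ D} {k : C ⟶ D}
    {h' : A' ⟶ A} {g' : B' ⟶ B} {f' : A' ⟶ B'} (sq : V.IsBeckChevalley f h g k)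
    (sq' : V.IsBeckChevalley f' h' g' f) (e : f ≫ g = h ≫ k) (e' : f' ≫ g' = h' ≫ f) :
    V.IsBeckChevalley f' (h' ≫ h) (g' ≫ g) k := by
  intro y hy hy' E L x hx
  have := sq' _ e'.symm rfl _ (sq _ rfl e _ hx)
  have := (this.comp_map_iso ((V.pullComp g' g _ rfl).hom.app L)).iso_comp
    ((V.pullComp h' h _ rfl).inv.app E)
  convert this using 1
  rw [← cancel_mono ((V.pullComp f' (g' ≫ g) y hy').hom.app L)]
  have h₁ := V.pullComp_assoc f' g' g _ _ y rfl rfl hy' (by simpa using hy') L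
  have h₂ := V.pullComp_assoc h' f g (f' ≫ g') (h ≫ k) y e'.symm e (by simpa using hy)
    (by simpa using hy') L
  have h₃ := V.pullComp_assoc h' h k _ _ y rfl rfl (by simpa using hy) hy L
  have h₄ : (V.pull (h' ≫ h)).map x = (V.pullComp h' h _ rfl).inv.app E ≫
      (V.pull h').map ((V.pull h).map x) ≫ V.cmpr h' h _ rfl _ := by
    have := V.carries_pull_map h' h _ rfl x
    unfold Carries at this
    rw [this]; simp
  simp only [Category.assoc, Iso.inv_hom_id_app, Category.comp_id, Functor.map_comp]
  rw [h₁, Iso.inv_hom_id_app_assoc, h₄]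
  simp only [Category.assoc]
  rw [← h₃]
  congr 3
  rw [← cancel_epi ((V.pull h').map ((V.pullComp f g (h ≫ k) e).hom.app L)), h₂,
    ← Functor.map_comp_assoc, Iso.hom_inv_id_app]
  erw [CategoryTheory.Functor.map_id]
  rw [Category.id_comp]

theorem isBeckChevalley_of_isIso {A B C D : S} (f : A ⟶ B) (h : A ⟶ C) (g : B ⟶ D) (k : C ⟶ D)
    [IsIso h] [IsIso g] : V.IsBeckChevalley f h g k := by
  intro y hy hy' E L x hx
  -- As `g^*` is essentially surjective, it is enough to test against objects in its image.
  suffices H : ∀ W : V.Fib D, Function.Bijective fun t : (V.pull g).obj L ⟶ (V.pull g).obj W =>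
      ((V.pull h).map x ≫ V.cmpr h k y hy L ≫ (V.pullComp f g y hy').inv.app L) ≫
        (V.pull f).map t by
    intro W
    let i := (V.pull g).objObjPreimageIso W
    refine ⟨fun s t hst => ?_, fun s => ?_⟩
    · refine (cancel_mono i.inv).1 ((H _).1 ?_)
      dsimp only at hst ⊢
      rw [Functor.map_comp, Functor.map_comp, ← Category.assoc, hst, Category.assoc]
    · obtain ⟨t, ht⟩ := (H _).2 (s ≫ (V.pull f).map i.inv)
      refine ⟨t ≫ i.hom, ?_⟩
      dsimp only at ht ⊢
      rw [Functor.map_comp, ← Category.assoc, ht, Category.assoc, ← Functor.map_comp]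
      simp
  intro W
  have key (t : L ⟶ W) :
      ((V.pull h).map x ≫ V.cmpr h k y hy L ≫ (V.pullComp f g y hy').inv.app L) ≫
        (V.pull f).map ((V.pull g).map t) =
      (V.pull h).map (x ≫ (V.pull k).map t) ≫ V.cmpr h k y hy W ≫
        (V.pullComp f g y hy').inv.app W := by
    have h₁ := (V.pullComp f g y hy').inv.naturality t
    have h₂ := (V.pullComp h k y hy).hom.naturality t
    dsimp only [Functor.comp_map] at h₁ h₂
    rw [Category.assoc, Category.assoc, ← h₁, Functor.map_comp, Category.assoc, reassoc_of% h₂]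
  refine ⟨fun s t hst => ?_, fun s => ?_⟩
  · obtain ⟨s, rfl⟩ := (V.pull g).map_surjective s
    obtain ⟨t, rfl⟩ := (V.pull g).map_surjective t
    dsimp only at hst
    rw [key, key, cancel_mono] at hst
    rw [hx.hom_ext ((V.pull h).map_injective hst)]
  · obtain ⟨t, ht⟩ := hx.exists_fac ((V.pull h).preimage
      (s ≫ (V.pullComp f g y hy').hom.app W ≫ (V.pullComp h k y hy).inv.app W))
    exact ⟨(V.pull g).map t, by dsimp only; rw [key, ht]; simp⟩

end
end IndexedMonoidalCategory

/-! ### Indexed coproducts -/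

namespace IndexedMonoidalCategory

open Functor.LaxMonoidal Functor.OplaxMonoidal

open CartesianMonoidalCategory renaming fst → p₁, snd → p₂

section

variable {S : Type u'} [Category.{v'} S] [CartesianMonoidalCategory S]

theorem insertDiagonal_comp_fst (R T U : S) : insertDiagonal R T U ≫ p₁ (R ⊗ T) (T ⊗ U) =
    lift (p₁ R (T ⊗ U)) (p₂ R (T ⊗ U) ≫ p₁ T U) := by
  ext <;> simp [insertDiagonal]

theorem insertDiagonal_comp_snd (R T U : S) : insertDiagonal R T U ≫ p₂ (R ⊗ T) (T ⊗ U) =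
    lift (p₂ R (T ⊗ U) ≫ p₁ T U) (p₂ R (T ⊗ U) ≫ p₂ T U) := by
  ext <;> simp [insertDiagonal]

end

section

variable {S : Type u'} [Category.{v'} S] [CartesianMonoidalCategory S]
  {V : IndexedMonoidalCategory.{v, u} S}

/-- Indexed coproducts in an indexed monoidal category, preserved by the tensor product in each
variable, for which the squares of exchange type satisfy the Beck-Chevalley condition.  The left
adjoint `k_!` of `k^*` is encoded by its unit `ins`, which is required to consist of universal
arrows, and the projection formulas `projLeft` and `projRight` by the universality of the arrows
`k^* M ⊗ E ⟶ k^* (M ⊗ k_! E)` and `E ⊗ k^* M ⟶ k^* (k_! E ⊗ M)`. -/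
structure Coproducts (V : IndexedMonoidalCategory.{v, u} S) where
  push : ∀ {C D : S}, (C ⟶ D) → V.Fib C ⥤ V.Fib D
  ins : ∀ {C D : S} (k : C ⟶ D) (E : V.Fib C), E ⟶ (V.pull k).obj ((push k).obj E)
  ins_naturality : ∀ {C D : S} (k : C ⟶ D) {E F : V.Fib C} (f : E ⟶ F),
    f ≫ ins k F = ins k E ≫ (V.pull k).map ((push k).map f)
  universal : ∀ {C D : S} (k : C ⟶ D) (E : V.Fib C), IsUniversalArrow (V.pull k) (ins k E)
  exchange : ∀ {A B C D : S} (f : A ⟶ B) (g : C ⟶ D),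
    V.IsBeckChevalley (f ▷ C) (A ◁ g) (B ◁ g) (f ▷ D)
  projLeft : ∀ {C D : S} (k : C ⟶ D) (M : V.Fib D) (E : V.Fib C),
    IsUniversalArrow (V.pull k) ((V.pull k).obj M ◁ ins k E ≫ μ (V.pull k) M _)
  projRight : ∀ {C D : S} (k : C ⟶ D) (M : V.Fib D) (E : V.Fib C),
    IsUniversalArrow (V.pull k) (ins k E ▷ (V.pull k).obj M ≫ μ (V.pull k) _ M)

namespace Coproducts

variable (P : V.Coproducts)

include P

theorem isUniversalArrow_whiskerRight {C D : S} {k : C ⟶ D} {E : V.Fib C} {L : V.Fib D}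
    {e : E ⟶ (V.pull k).obj L} (he : IsUniversalArrow (V.pull k) e) (M : V.Fib D) :
    IsUniversalArrow (V.pull k) (e ▷ (V.pull k).obj M ≫ μ (V.pull k) L M) := by
  obtain ⟨f, hf⟩ := (P.universal k E).exists_fac e
  have := (P.universal k E).isIso_of_fac he f hf
  refine (P.projRight k M E).of_isIso_fac (f ▷ M) ?_
  rw [← hf, Category.assoc, ← μ_natural_left, comp_whiskerRight, Category.assoc]

theorem isUniversalArrow_whiskerLeft {C D : S} {k : C ⟶ D} {E : V.Fib C} {L : V.Fib D}
    {e : E ⟶ (V.pull k).obj L} (he : IsUniversalArrow (V.pull k) e) (M : V.Fib D) :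
    IsUniversalArrow (V.pull k) ((V.pull k).obj M ◁ e ≫ μ (V.pull k) M L) := by
  obtain ⟨f, hf⟩ := (P.universal k E).exists_fac e
  have := (P.universal k E).isIso_of_fac he f hf
  refine (P.projLeft k M E).of_isIso_fac (M ◁ f) ?_
  rw [← hf, Category.assoc, ← μ_natural_right, MonoidalCategory.whiskerLeft_comp, Category.assoc]

/-- The square with horizontal sides the projections of `Z × T` and `Y × T` onto the first factors
and vertical sides `m × id` and `m`, for arbitrary product decompositions of the two corners.  It is
an exchange square for `T ⟶ 1` and `m`, up to isomorphisms. -/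
theorem isBeckChevalley_projection {X B Z Y T : S} (k : X ⟶ Z) (t : X ⟶ T) [IsIso (lift k t)]
    (a : B ⟶ Y) (b : B ⟶ T) [IsIso (lift a b)] (m : Z ⟶ Y) (z : X ⟶ B) (ha : z ≫ a = k ≫ m)
    (hb : z ≫ b = t) : V.IsBeckChevalley k z m a := by
  have h₁ : IsIso (lift t k) := by
    rw [show lift t k = lift k t ≫ lift (p₂ _ _) (p₁ _ _) by simp]
    have : IsIso (lift (p₂ Z T) (p₁ Z T)) := ⟨lift (p₂ _ _) (p₁ _ _), by simp, by simp⟩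
    infer_instance
  have h₂ : IsIso (lift b a) := by
    rw [show lift b a = lift a b ≫ lift (p₂ _ _) (p₁ _ _) by simp]
    have : IsIso (lift (p₂ Y T) (p₁ Y T)) := ⟨lift (p₂ _ _) (p₁ _ _), by simp, by simp⟩
    infer_instance
  have s₁ := isBeckChevalley_of_isIso (V := V) k (lift t k) (λ_ Z).inv (toUnit T ▷ Z)
  have s₂ := P.exchange (toUnit T) m
  have s₃ := isBeckChevalley_of_isIso (V := V) (toUnit T ▷ Y) (inv (lift b a)) (λ_ Y).hom a
  have e₃ : (toUnit T ▷ Y) ≫ (λ_ Y).hom = inv (lift b a) ≫ a := by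
    rw [← cancel_epi (lift b a)]
    simp [leftUnitor_hom]
  have e₂ : toUnit T ▷ Z ≫ 𝟙_ S ◁ m = T ◁ m ≫ toUnit T ▷ Y := (whisker_exchange _ _).symm
  have s := (s₃.paste s₂ e₃ e₂).paste s₁
    (by rw [Category.assoc, ← e₃, ← Category.assoc, e₂, Category.assoc])
    (by rw [← cancel_mono (λ_ Z).hom]; simp [leftUnitor_hom])
  convert s using 1
  · rw [← cancel_mono (lift b a)]
    simp only [Category.assoc, IsIso.inv_hom_id, Category.comp_id]
    ext <;> simp [ha, hb]
  · simp

/-- The square with horizontal sides `j × id` and `j`, and vertical sides projections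
onto the first factors, for arbitrary product decompositions of the two upper corners.  It is an
exchange square for `j` and `W ⟶ 1`, up to isomorphisms. -/
theorem isBeckChevalley_embedding {X Y C D W : S} (k : X ⟶ Y) (r : X ⟶ C) (s : X ⟶ W)
    [IsIso (lift r s)] (m : Y ⟶ D) (n : Y ⟶ W) [IsIso (lift m n)] (j : C ⟶ D)
    (hm : k ≫ m = r ≫ j) (hn : k ≫ n = s) : V.IsBeckChevalley k r m j := by
  have s₁ := isBeckChevalley_of_isIso (V := V) k (lift r s) (lift m n) (j ▷ W)
  have s₂ := P.exchange j (toUnit W)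
  have s₃ := isBeckChevalley_of_isIso (V := V) (j ▷ 𝟙_ S) (ρ_ C).hom (ρ_ D).hom j
  have e₂ : j ▷ W ≫ D ◁ toUnit W = C ◁ toUnit W ≫ j ▷ 𝟙_ S := (whisker_exchange _ _).symm
  have e₃ : j ▷ 𝟙_ S ≫ (ρ_ D).hom = (ρ_ C).hom ≫ j := by simp
  have s := (s₃.paste s₂ e₃ e₂).paste s₁
    (by rw [Category.assoc, ← e₃, ← Category.assoc, e₂, Category.assoc]) (by ext <;> simp [hm, hn])
  convert s using 1 <;> simp [rightUnitor_hom]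

omit P

/-! ### Composition and its balancing maps -/

/-- The composite `M ⊙ N`, the coproduct over `t : T` of `M(r, t) ⊗ N(t, u)`. -/
noncomputable def comp {R T U : S} (M : V.Fib (R ⊗ T)) (N : V.Fib (T ⊗ U)) : V.Fib (R ⊗ U) :=
  (P.push (projectMiddle R T U)).obj ((V.pull (insertDiagonal R T U)).obj
    ((V.pull (p₁ (R ⊗ T) (T ⊗ U))).obj M ⊗ (V.pull (p₂ (R ⊗ T) (T ⊗ U))).obj N))

/-- The composite of morphisms. -/
noncomputable def compMap {R T U : S} {M M' : V.Fib (R ⊗ T)} {N N' : V.Fib (T ⊗ U)}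
    (f : M ⟶ M') (g : N ⟶ N') : P.comp M N ⟶ P.comp M' N' :=
  (P.push (projectMiddle R T U)).map ((V.pull (insertDiagonal R T U)).map
    ((V.pull (p₁ (R ⊗ T) (T ⊗ U))).map f ⊗ₘ (V.pull (p₂ (R ⊗ T) (T ⊗ U))).map g))

end Coproducts

/-- The value `M(r, t) = (r, t)^* M` of `M` at generalized elements `r` and `t`. -/
abbrev ev {R T Z : S} (M : V.Fib (R ⊗ T)) (r : Z ⟶ R) (t : Z ⟶ T) : V.Fib Z :=
  (V.pull (lift r t)).obj M

/-- The comparison `w^* M(r, t) ⟶ M(w ≫ r, w ≫ t)`. -/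
abbrev evCmpr {R T Z Z' : S} (M : V.Fib (R ⊗ T)) (w : Z' ⟶ Z) {r : Z ⟶ R} {t : Z ⟶ T}
    {r' : Z' ⟶ R} {t' : Z' ⟶ T} (hr : w ≫ r = r') (ht : w ≫ t = t') :
    (V.pull w).obj (ev M r t) ⟶ ev M r' t' :=
  V.cmpr w (lift r t) (lift r' t') (by rw [comp_lift, hr, ht]) M

omit [CartesianMonoidalCategory S] in
/-- Two restrictions `f` and `g` of the same morphism `e`, along `z` and `w ≫ z`, are related by
restriction along `w`.  This is how stability of the balancing maps under restriction follows from
their definition as restrictions of universal ones. -/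
theorem carries_of_carries {Z₂ Z₁ Z₀ : S} {w : Z₂ ⟶ Z₁} {z : Z₁ ⟶ Z₀} {y : Z₂ ⟶ Z₀}
    (h : w ≫ z = y) {E F : V.Fib Z₀} {E₁ F₁ : V.Fib Z₁} {E₂ F₂ : V.Fib Z₂} {e : E ⟶ F}
    {f : E₁ ⟶ F₁} {g : E₂ ⟶ F₂} {a : (V.pull z).obj E ⟶ E₁} {b : (V.pull z).obj F ⟶ F₁} [IsIso a]
    {c : (V.pull w).obj E₁ ⟶ E₂} {d : (V.pull w).obj F₁ ⟶ F₂}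
    {a' : (V.pull y).obj E ⟶ E₂} {b' : (V.pull y).obj F ⟶ F₂}
    (hf : Carries (V.pull z) a b e f) (hg : Carries (V.pull y) a' b' e g)
    (ha : (V.pull w).map a ≫ c = V.cmpr w z y h E ≫ a')
    (hb : (V.pull w).map b ≫ d = V.cmpr w z y h F ≫ b') :
    Carries (V.pull w) c d f g := by
  have hn := V.carries_pull_map w z y h e
  unfold Carries at *
  rw [← cancel_epi ((V.pull w).map a), reassoc_of% ha, ← hg, ← Functor.map_comp_assoc, ← hf,
    Functor.map_comp_assoc, hb, reassoc_of% hn]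

namespace Coproducts

variable (P : V.Coproducts) {R T U : S}

theorem compMap_id (M : V.Fib (R ⊗ T)) (N : V.Fib (T ⊗ U)) :
    P.compMap (𝟙 M) (𝟙 N) = 𝟙 (P.comp M N) := by
  simp [compMap, comp]

theorem compMap_comp {M M' M'' : V.Fib (R ⊗ T)} {N N' N'' : V.Fib (T ⊗ U)} (f : M ⟶ M')
    (f' : M' ⟶ M'') (g : N ⟶ N') (g' : N' ⟶ N'') :
    P.compMap (f ≫ f') (g ≫ g') = P.compMap f g ≫ P.compMap f' g' := by
  simp only [compMap, Functor.map_comp, ← tensorHom_comp_tensorHom]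
  rfl

/-- The universal balancing map over `R × T × U`: the insertion of
`(id × Δ × id)^* (M ⊠ N)` into its coproduct `M ⊙ N`, rewritten in terms of generalized
elements. -/
noncomputable def genericBal (M : V.Fib (R ⊗ T)) (N : V.Fib (T ⊗ U)) :
    ev M (p₁ R (T ⊗ U)) (p₂ R (T ⊗ U) ≫ p₁ T U) ⊗
        ev N (p₂ R (T ⊗ U) ≫ p₁ T U) (p₂ R (T ⊗ U) ≫ p₂ T U) ⟶
      (V.pull (projectMiddle R T U)).obj (P.comp M N) :=
  inv (tensorComparison (V.pull (insertDiagonal R T U))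
      (V.cmpr (insertDiagonal R T U) (p₁ _ _) _ (insertDiagonal_comp_fst R T U) M)
      (V.cmpr (insertDiagonal R T U) (p₂ _ _) _ (insertDiagonal_comp_snd R T U) N)) ≫
    P.ins (projectMiddle R T U) _

theorem isUniversalArrow_genericBal (M : V.Fib (R ⊗ T)) (N : V.Fib (T ⊗ U)) :
    IsUniversalArrow (V.pull (projectMiddle R T U)) (P.genericBal M N) :=
  (P.universal _ _).iso_comp _

theorem tensorComparison_comp_genericBal (M : V.Fib (R ⊗ T)) (N : V.Fib (T ⊗ U)) :
    tensorComparison (V.pull (insertDiagonal R T U))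
      (V.cmpr (insertDiagonal R T U) (p₁ _ _) _ (insertDiagonal_comp_fst R T U) M)
      (V.cmpr (insertDiagonal R T U) (p₂ _ _) _ (insertDiagonal_comp_snd R T U) N) ≫
        P.genericBal M N = P.ins (projectMiddle R T U) _ :=
  IsIso.hom_inv_id_assoc _ _

theorem genericBal_naturality {M M' : V.Fib (R ⊗ T)} {N N' : V.Fib (T ⊗ U)} (f : M ⟶ M')
    (g : N ⟶ N') :
    ((V.pull _).map f ⊗ₘ (V.pull _).map g) ≫ P.genericBal M' N' =
      P.genericBal M N ≫ (V.pull (projectMiddle R T U)).map (P.compMap f g) := by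
  rw [← cancel_epi (tensorComparison (V.pull (insertDiagonal R T U))
      (V.cmpr (insertDiagonal R T U) (p₁ _ _) _ (insertDiagonal_comp_fst R T U) M)
      (V.cmpr (insertDiagonal R T U) (p₂ _ _) _ (insertDiagonal_comp_snd R T U) N))]
  have := (V.carries_pull_map (insertDiagonal R T U) (p₁ _ _) _
    (insertDiagonal_comp_fst R T U) f).tensor
    (V.carries_pull_map (insertDiagonal R T U) (p₂ _ _) _ (insertDiagonal_comp_snd R T U) g)
  unfold Carries at this
  rw [← reassoc_of% this, tensorComparison_comp_genericBal,
    ← Category.assoc, tensorComparison_comp_genericBal]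
  exact P.ins_naturality (projectMiddle R T U) _

variable {Z : S}

/-- The balancing map `M(r, t) ⊗ N(t, u) ⟶ (M ⊙ N)(r, u)` at generalized elements `r`, `t` and
`u`, the restriction of the universal one along `(r, t, u)`. -/
noncomputable def bal (M : V.Fib (R ⊗ T)) (N : V.Fib (T ⊗ U)) (r : Z ⟶ R) (t : Z ⟶ T)
    (u : Z ⟶ U) : ev M r t ⊗ ev N t u ⟶ ev (P.comp M N) r u :=
  inv (tensorComparison (V.pull (lift r (lift t u)))
      (evCmpr M (lift r (lift t u)) (r' := r) (t' := t) (by simp) (by simp))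
      (evCmpr N (lift r (lift t u)) (r' := t) (t' := u) (by simp) (by simp))) ≫
    (V.pull (lift r (lift t u))).map (P.genericBal M N) ≫
    V.cmpr (lift r (lift t u)) (projectMiddle R T U) _ (by ext <;> simp [projectMiddle]) _

theorem carries_genericBal (M : V.Fib (R ⊗ T)) (N : V.Fib (T ⊗ U)) (z : Z ⟶ R ⊗ (T ⊗ U))
    (r : Z ⟶ R) (t : Z ⟶ T) (u : Z ⟶ U) (hr : z ≫ p₁ _ _ = r) (ht : z ≫ p₂ _ _ ≫ p₁ _ _ = t)
    (hu : z ≫ p₂ _ _ ≫ p₂ _ _ = u) :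
    Carries (V.pull z) (tensorComparison (V.pull z) (evCmpr M z hr ht) (evCmpr N z ht hu))
      (V.cmpr z (projectMiddle R T U) _ (by ext <;> simp [projectMiddle, ← hr, ← hu]) _)
      (P.genericBal M N) (P.bal M N r t u) := by
  obtain rfl : z = lift r (lift t u) := by ext <;> simp [hr, ht, hu]
  simp [Carries, bal]

/-- The balancing maps are stable under change of the generalized elements. -/
theorem carries_bal (M : V.Fib (R ⊗ T)) (N : V.Fib (T ⊗ U)) {Z' : S} (w : Z' ⟶ Z) {r : Z ⟶ R}
    {t : Z ⟶ T} {u : Z ⟶ U} {r' : Z' ⟶ R} {t' : Z' ⟶ T} {u' : Z' ⟶ U} (hr : w ≫ r = r')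
    (ht : w ≫ t = t') (hu : w ≫ u = u') :
    Carries (V.pull w) (tensorComparison (V.pull w) (evCmpr M w hr ht) (evCmpr N w ht hu))
      (evCmpr (P.comp M N) w hr hu) (P.bal M N r t u) (P.bal M N r' t' u') := by
  have h : w ≫ lift r (lift t u) = lift r' (lift t' u') := by ext <;> simp [hr, ht, hu]
  refine carries_of_carries h
    (P.carries_genericBal M N (lift r (lift t u)) r t u (by simp) (by simp) (by simp))
    (P.carries_genericBal M N (lift r' (lift t' u')) r' t' u' (by simp) (by simp) (by simp)) ?_ ?_
  · exact map_tensorComparison_comp h (V.pullComp_assoc ..) (V.pullComp_assoc ..)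
  · exact V.pullComp_assoc ..

theorem bal_naturality {M M' : V.Fib (R ⊗ T)} {N N' : V.Fib (T ⊗ U)} (f : M ⟶ M')
    (g : N ⟶ N') (r : Z ⟶ R) (t : Z ⟶ T) (u : Z ⟶ U) :
    ((V.pull (lift r t)).map f ⊗ₘ (V.pull (lift t u)).map g) ≫ P.bal M' N' r t u =
      P.bal M N r t u ≫ (V.pull (lift r u)).map (P.compMap f g) := by
  have h := P.carries_genericBal M N (lift r (lift t u)) r t u (by simp) (by simp) (by simp)
  have h' := P.carries_genericBal M' N' (lift r (lift t u)) r t u (by simp) (by simp) (by simp)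
  have hf := V.carries_pull_map (lift r (lift t u)) (lift (p₁ R (T ⊗ U)) (p₂ R (T ⊗ U) ≫ p₁ T U))
    (lift r t) (by ext <;> simp) f
  have hg := V.carries_pull_map (lift r (lift t u))
    (lift (p₂ R (T ⊗ U) ≫ p₁ T U) (p₂ R (T ⊗ U) ≫ p₂ T U)) (lift t u) (by ext <;> simp) g
  have hc := V.carries_pull_map (lift r (lift t u)) (projectMiddle R T U) (lift r u)
    (by ext <;> simp [projectMiddle]) (P.compMap f g)
  refine ((hf.tensor hg).comp h').unique ?_
  rw [P.genericBal_naturality]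
  exact h.comp hc

/-- Over a product of `Z` and `T`, the balancing maps exhibit `(M ⊙ N)(r, u)` as a coproduct
along the projection to `Z`. -/
theorem isUniversalArrow_bal (M : V.Fib (R ⊗ T)) (N : V.Fib (T ⊗ U)) {X : S} (k : X ⟶ Z)
    (t : X ⟶ T) [IsIso (lift k t)] {r : Z ⟶ R} {u : Z ⟶ U} {r' : X ⟶ R} {u' : X ⟶ U}
    (hr : k ≫ r = r') (hu : k ≫ u = u') :
    IsUniversalArrow (V.pull k) (P.bal M N r' t u' ≫ inv (evCmpr (P.comp M N) k hr hu)) := by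
  have : IsIso (lift (projectMiddle R T U) (p₂ R (T ⊗ U) ≫ p₁ T U)) :=
    ⟨lift (p₁ _ _ ≫ p₁ _ _) (lift (p₂ _ _) (p₁ _ _ ≫ p₂ _ _)),
      by ext <;> simp [projectMiddle], by ext <;> simp [projectMiddle]⟩
  have sq := P.isBeckChevalley_projection k t (projectMiddle R T U) (p₂ R (T ⊗ U) ≫ p₁ T U)
    (lift r u) (lift r' (lift t u')) (by ext <;> simp [projectMiddle, hr, hu]) (by simp)
  have := (sq (lift r' u') (by ext <;> simp [projectMiddle]) (by ext <;> simp [hr, hu]) _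
    (P.isUniversalArrow_genericBal M N)).iso_comp (inv (tensorComparison
      (V.pull (lift r' (lift t u')))
      (evCmpr M (lift r' (lift t u')) (r' := r') (t' := t) (by simp) (by simp))
      (evCmpr N (lift r' (lift t u')) (r' := t) (t' := u') (by simp) (by simp))))
  convert this using 1
  rw [bal]
  simp only [Category.assoc]
  congr 3
  simp [evCmpr, cmpr]

end Coproducts

end

end IndexedMonoidalCategory

namespace IndexedMonoidalCategory

open Functor.LaxMonoidal Functor.OplaxMonoidal

open CartesianMonoidalCategory renaming fst → p₁, snd → p₂
open MonoidalCategoryStruct renaming associator → αₘ, leftUnitor → lₘ, rightUnitor → rₘ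

section

variable {S : Type u'} [Category.{v'} S] [CartesianMonoidalCategory S]
  {V : IndexedMonoidalCategory.{v, u} S}

omit [CartesianMonoidalCategory S] in
theorem _root_.IsUniversalArrow.comp_pull {X Y Z : S} {k : X ⟶ Y} {m : Y ⟶ Z} {y : X ⟶ Z}
    (h : k ≫ m = y) {E : V.Fib X} {L : V.Fib Y} {K : V.Fib Z} {e : E ⟶ (V.pull k).obj L}
    {f : L ⟶ (V.pull m).obj K} (he : IsUniversalArrow (V.pull k) e)
    (hf : IsUniversalArrow (V.pull m) f) :
    IsUniversalArrow (V.pull y) (e ≫ (V.pull k).map f ≫ V.cmpr k m y h K) := by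
  simpa using (he.trans hf).comp_natIso (V.pullComp k m y h)

/-! ### Associativity -/

namespace Coproducts

variable (P : V.Coproducts) {R T U W Y Z : S}

/-- If `E` has coproduct `M` along `(r, u, w)`, then `E ⊗ L(u, w)` has coproduct `M ⊙ L` along
`(r, w)`: the tensor product preserves the first coproduct, and coproducts compose. -/
theorem isUniversalArrow_whiskerRight_bal {E : V.Fib Z} (M : V.Fib (R ⊗ U)) (L : V.Fib (U ⊗ W))
    {r : Z ⟶ R} {u : Z ⟶ U} {w : Z ⟶ W} (e : E ⟶ ev M r u)
    (he : IsUniversalArrow (V.pull (lift r (lift u w)))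
      (e ≫ inv (evCmpr M (lift r (lift u w)) (r := p₁ _ _) (t := p₂ _ _ ≫ p₁ _ _) (r' := r)
        (t' := u) (by simp) (by simp)))) :
    IsUniversalArrow (V.pull (lift r w)) (e ▷ ev L u w ≫ P.bal M L r u w) := by
  have h := ((P.isUniversalArrow_whiskerRight he (ev L (p₂ R (U ⊗ W) ≫ p₁ _ _)
    (p₂ R (U ⊗ W) ≫ p₂ _ _))).comp_pull (y := lift r w) (by ext <;> simp [projectMiddle])
    (P.isUniversalArrow_genericBal M L)).iso_comp
    (E ◁ inv (evCmpr L (lift r (lift u w)) (r := p₂ _ _ ≫ p₁ _ _) (t := p₂ _ _ ≫ p₂ _ _)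
      (r' := u) (t' := w) (by simp) (by simp)))
  have hc := P.carries_genericBal M L (lift r (lift u w)) r u w (by simp) (by simp) (by simp)
  unfold Carries at hc
  rw [hc] at h
  convert h using 1
  rw [Category.assoc]
  slice_rhs 3 4 => rw [μ_comp_tensorComparison]
  simp [MonoidalCategory.tensorHom_def, ← comp_whiskerRight_assoc, ← whisker_exchange_assoc]

/-- If `E` has coproduct `N` along `(r, t, w)`, then `M(r, t) ⊗ E` has coproduct `M ⊙ N` along
`(r, w)`. -/
theorem isUniversalArrow_whiskerLeft_bal {E : V.Fib Z} (M : V.Fib (R ⊗ T)) (N : V.Fib (T ⊗ W))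
    {r : Z ⟶ R} {t : Z ⟶ T} {w : Z ⟶ W} (e : E ⟶ ev N t w)
    (he : IsUniversalArrow (V.pull (lift r (lift t w)))
      (e ≫ inv (evCmpr N (lift r (lift t w)) (r := p₂ _ _ ≫ p₁ _ _) (t := p₂ _ _ ≫ p₂ _ _)
        (r' := t) (t' := w) (by simp) (by simp)))) :
    IsUniversalArrow (V.pull (lift r w)) (ev M r t ◁ e ≫ P.bal M N r t w) := by
  have h := ((P.isUniversalArrow_whiskerLeft he (ev M (p₁ R (T ⊗ W))
    (p₂ R (T ⊗ W) ≫ p₁ _ _))).comp_pull (y := lift r w) (by ext <;> simp [projectMiddle])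
    (P.isUniversalArrow_genericBal M N)).iso_comp
    (inv (evCmpr M (lift r (lift t w)) (r := p₁ _ _) (t := p₂ _ _ ≫ p₁ _ _)
      (r' := r) (t' := t) (by simp) (by simp)) ▷ E)
  have hc := P.carries_genericBal M N (lift r (lift t w)) r t w (by simp) (by simp) (by simp)
  unfold Carries at hc
  rw [hc] at h
  convert h using 1
  rw [Category.assoc]
  slice_rhs 3 4 => rw [μ_comp_tensorComparison]
  simp [MonoidalCategory.tensorHom_def', ← MonoidalCategory.whiskerLeft_comp_assoc,
    whisker_exchange_assoc]

/-- The threefold balancing map `(M(r, t) ⊗ N(t, u)) ⊗ L(u, w) ⟶ ((M ⊙ N) ⊙ L)(r, w)`. -/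
noncomputable def balLeft (M : V.Fib (R ⊗ T)) (N : V.Fib (T ⊗ U)) (L : V.Fib (U ⊗ W)) (r : Z ⟶ R)
    (t : Z ⟶ T) (u : Z ⟶ U) (w : Z ⟶ W) :
    (ev M r t ⊗ ev N t u) ⊗ ev L u w ⟶ ev (P.comp (P.comp M N) L) r w :=
  P.bal M N r t u ▷ ev L u w ≫ P.bal (P.comp M N) L r u w

/-- The threefold balancing map `M(r, t) ⊗ (N(t, u) ⊗ L(u, w)) ⟶ (M ⊙ (N ⊙ L))(r, w)`. -/
noncomputable def balRight (M : V.Fib (R ⊗ T)) (N : V.Fib (T ⊗ U)) (L : V.Fib (U ⊗ W)) (r : Z ⟶ R)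
    (t : Z ⟶ T) (u : Z ⟶ U) (w : Z ⟶ W) :
    ev M r t ⊗ (ev N t u ⊗ ev L u w) ⟶ ev (P.comp M (P.comp N L)) r w :=
  ev M r t ◁ P.bal N L t u w ≫ P.bal M (P.comp N L) r t w

variable (M : V.Fib (R ⊗ T)) (N : V.Fib (T ⊗ U)) (L : V.Fib (U ⊗ W))

theorem carries_balLeft {Z' : S} (z : Z' ⟶ Z) {r : Z ⟶ R} {t : Z ⟶ T} {u : Z ⟶ U} {w : Z ⟶ W}
    {r' : Z' ⟶ R} {t' : Z' ⟶ T} {u' : Z' ⟶ U} {w' : Z' ⟶ W} (hr : z ≫ r = r')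
    (ht : z ≫ t = t') (hu : z ≫ u = u') (hw : z ≫ w = w') :
    Carries (V.pull z) (tensorComparison (V.pull z) (tensorComparison (V.pull z)
        (evCmpr M z hr ht) (evCmpr N z ht hu)) (evCmpr L z hu hw))
      (evCmpr _ z hr hw) (P.balLeft M N L r t u w) (P.balLeft M N L r' t' u' w') :=
  ((P.carries_bal M N z hr ht hu).whiskerRight _).comp (P.carries_bal _ L z hr hu hw)

theorem carries_balRight {Z' : S} (z : Z' ⟶ Z) {r : Z ⟶ R} {t : Z ⟶ T} {u : Z ⟶ U} {w : Z ⟶ W}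
    {r' : Z' ⟶ R} {t' : Z' ⟶ T} {u' : Z' ⟶ U} {w' : Z' ⟶ W} (hr : z ≫ r = r')
    (ht : z ≫ t = t') (hu : z ≫ u = u') (hw : z ≫ w = w') :
    Carries (V.pull z) (tensorComparison (V.pull z) (evCmpr M z hr ht)
        (tensorComparison (V.pull z) (evCmpr N z ht hu) (evCmpr L z hu hw)))
      (evCmpr _ z hr hw) (P.balRight M N L r t u w) (P.balRight M N L r' t' u' w') :=
  ((P.carries_bal N L z ht hu hw).whiskerLeft _).comp (P.carries_bal M _ z hr ht hw)

theorem isUniversalArrow_balLeft (r : Z ⟶ R) (t : Z ⟶ T) (u : Z ⟶ U) (w : Z ⟶ W)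
    [IsIso (lift (lift r (lift u w)) t)] :
    IsUniversalArrow (V.pull (lift r w)) (P.balLeft M N L r t u w) :=
  P.isUniversalArrow_whiskerRight_bal _ _ _ (P.isUniversalArrow_bal M N _ t (by simp) (by simp))

theorem isUniversalArrow_balRight (r : Z ⟶ R) (t : Z ⟶ T) (u : Z ⟶ U) (w : Z ⟶ W)
    [IsIso (lift (lift r (lift t w)) u)] :
    IsUniversalArrow (V.pull (lift r w)) (P.balRight M N L r t u w) :=
  P.isUniversalArrow_whiskerLeft_bal _ _ _ (P.isUniversalArrow_bal N L _ u (by simp) (by simp))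

section Generic

variable (R T U W)

/-- The first generic element of `R × T × U × W`. -/
abbrev g₁ : R ⊗ (T ⊗ (U ⊗ W)) ⟶ R := p₁ _ _

/-- The second generic element of `R × T × U × W`. -/
abbrev g₂ : R ⊗ (T ⊗ (U ⊗ W)) ⟶ T := p₂ _ _ ≫ p₁ _ _

/-- The third generic element of `R × T × U × W`. -/
abbrev g₃ : R ⊗ (T ⊗ (U ⊗ W)) ⟶ U := p₂ _ _ ≫ p₂ _ _ ≫ p₁ _ _

/-- The fourth generic element of `R × T × U × W`. -/
abbrev g₄ : R ⊗ (T ⊗ (U ⊗ W)) ⟶ W := p₂ _ _ ≫ p₂ _ _ ≫ p₂ _ _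

instance : IsIso (lift (lift (g₁ R T U W) (lift (g₃ R T U W) (g₄ R T U W))) (g₂ R T U W)) :=
  ⟨lift (p₁ _ _ ≫ p₁ _ _) (lift (p₂ _ _) (p₁ _ _ ≫ p₂ _ _)), by ext <;> simp, by ext <;> simp⟩

instance : IsIso (lift (lift (g₁ R T U W) (lift (g₂ R T U W) (g₄ R T U W))) (g₃ R T U W)) :=
  ⟨lift (p₁ _ _ ≫ p₁ _ _) (lift (p₁ _ _ ≫ p₂ _ _ ≫ p₁ _ _)
    (lift (p₂ _ _) (p₁ _ _ ≫ p₂ _ _ ≫ p₂ _ _))), by ext <;> simp, by ext <;> simp⟩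

instance : IsIso (lift (lift (g₁ R T U W) (g₄ R T U W)) (lift (g₂ R T U W) (g₃ R T U W))) :=
  ⟨lift (p₁ _ _ ≫ p₁ _ _) (lift (p₂ _ _ ≫ p₁ _ _) (lift (p₂ _ _ ≫ p₂ _ _) (p₁ _ _ ≫ p₂ _ _))),
    by ext <;> simp, by ext <;> simp⟩

end Generic

variable {M N L} in
/-- Morphisms out of `M ⊙ N` are determined by their composites with the balancing maps at all
generalized elements. -/
theorem comp_hom_ext {K : V.Fib (R ⊗ U)} {f g : P.comp M N ⟶ K}
    (h : ∀ {Z : S} (r : Z ⟶ R) (t : Z ⟶ T) (u : Z ⟶ U),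
      P.bal M N r t u ≫ (V.pull (lift r u)).map f = P.bal M N r t u ≫ (V.pull (lift r u)).map g) :
    f = g := by
  refine (P.isUniversalArrow_genericBal M N).hom_ext ?_
  have h' := h (p₁ R (T ⊗ U)) (p₂ R (T ⊗ U) ≫ p₁ _ _) (p₂ R (T ⊗ U) ≫ p₂ _ _)
  have hc := P.carries_genericBal M N (𝟙 _) (p₁ R (T ⊗ U)) (p₂ R (T ⊗ U) ≫ p₁ _ _)
    (p₂ R (T ⊗ U) ≫ p₂ _ _) (by simp) (by simp) (by simp)
  have e : 𝟙 _ ≫ projectMiddle R T U = lift (p₁ R (T ⊗ U)) (p₂ R (T ⊗ U) ≫ p₂ _ _) := by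
    ext <;> simp [projectMiddle]
  have hf := hc.comp (V.carries_pull_map (𝟙 _) _ _ e f)
  have hg := hc.comp (V.carries_pull_map (𝟙 _) _ _ e g)
  unfold Carries at hf hg
  rw [h', ← hg, cancel_mono] at hf
  exact (V.pull _).map_injective hf

variable {M N L} in
theorem comp_comp_hom_ext {K : V.Fib (R ⊗ W)} {f g : P.comp (P.comp M N) L ⟶ K}
    (h : ∀ {Z : S} (r : Z ⟶ R) (t : Z ⟶ T) (u : Z ⟶ U) (w : Z ⟶ W),
      P.balLeft M N L r t u w ≫ (V.pull (lift r w)).map f =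
        P.balLeft M N L r t u w ≫ (V.pull (lift r w)).map g) :
    f = g :=
  (P.isUniversalArrow_balLeft M N L (g₁ R T U W) (g₂ R T U W) (g₃ R T U W) (g₄ R T U W)).hom_ext
    (h _ _ _ _)

theorem exists_assoc : ∃ a : P.comp (P.comp M N) L ⟶ P.comp M (P.comp N L),
    P.balLeft M N L (g₁ R T U W) (g₂ R T U W) (g₃ R T U W) (g₄ R T U W) ≫ (V.pull _).map a =
      (αₘ _ _ _).hom ≫
        P.balRight M N L (g₁ R T U W) (g₂ R T U W) (g₃ R T U W) (g₄ R T U W) :=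
  (P.isUniversalArrow_balLeft M N L _ _ _ _).exists_fac _

/-- The associativity map `(M ⊙ N) ⊙ L ⟶ M ⊙ (N ⊙ L)`, characterized by
`balLeft_comp_assocHom`. -/
noncomputable def assocHom : P.comp (P.comp M N) L ⟶ P.comp M (P.comp N L) :=
  (P.exists_assoc M N L).choose

instance isIso_assocHom : IsIso (P.assocHom M N L) :=
  (P.isUniversalArrow_balLeft M N L _ _ _ _).isIso_of_fac
    ((P.isUniversalArrow_balRight M N L (g₁ R T U W) (g₂ R T U W) (g₃ R T U W)
      (g₄ R T U W)).iso_comp (αₘ _ _ _).hom) _ (P.exists_assoc M N L).choose_spec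

/-- At all generalized elements, the associativity map of `⊙` is the associator of `⊗`. -/
theorem balLeft_comp_assocHom (r : Z ⟶ R) (t : Z ⟶ T) (u : Z ⟶ U) (w : Z ⟶ W) :
    P.balLeft M N L r t u w ≫ (V.pull (lift r w)).map (P.assocHom M N L) =
      (αₘ _ _ _).hom ≫ P.balRight M N L r t u w := by
  have hl := P.carries_balLeft M N L (lift r (lift t (lift u w))) (r := g₁ R T U W)
    (t := g₂ R T U W) (u := g₃ R T U W) (w := g₄ R T U W) (r' := r) (t' := t) (u' := u) (w' := w)
    (by simp) (by simp) (by simp) (by simp)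
  have hr := P.carries_balRight M N L (lift r (lift t (lift u w))) (r := g₁ R T U W)
    (t := g₂ R T U W) (u := g₃ R T U W) (w := g₄ R T U W) (r' := r) (t' := t) (u' := u) (w' := w)
    (by simp) (by simp) (by simp) (by simp)
  refine (hl.comp (V.carries_pull_map _ _ _ (by ext <;> simp) (P.assocHom M N L))).unique ?_
  have := (Carries.associator _ _ _).comp hr
  rwa [← (P.exists_assoc M N L).choose_spec] at this

theorem balLeft_comp_assocHom_assoc (r : Z ⟶ R) (t : Z ⟶ T) (u : Z ⟶ U) (w : Z ⟶ W)
    {E : V.Fib Z} (f : (V.pull (lift r w)).obj (P.comp M (P.comp N L)) ⟶ E) :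
    P.balLeft M N L r t u w ≫ (V.pull (lift r w)).map (P.assocHom M N L) ≫ f =
      (αₘ _ _ _).hom ≫ P.balRight M N L r t u w ≫ f := by
  rw [← Category.assoc, balLeft_comp_assocHom, Category.assoc]

theorem balRight_comp_inv_assocHom (r : Z ⟶ R) (t : Z ⟶ T) (u : Z ⟶ U) (w : Z ⟶ W) :
    P.balRight M N L r t u w ≫ (V.pull (lift r w)).map (inv (P.assocHom M N L)) =
      (αₘ _ _ _).inv ≫ P.balLeft M N L r t u w := by
  rw [Functor.map_inv, IsIso.comp_inv_eq, Category.assoc, balLeft_comp_assocHom,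
    Iso.inv_hom_id_assoc]

/-- Over a product of `Z` and `T × U`, the threefold balancing maps exhibit
`((M ⊙ N) ⊙ L)(r, w)` as a coproduct along the projection to `Z`. -/
theorem isUniversalArrow_balLeft_local {X : S} (k : X ⟶ Z) (t : X ⟶ T) (u : X ⟶ U)
    [IsIso (lift k (lift t u))] {r : Z ⟶ R} {w : Z ⟶ W} {r' : X ⟶ R} {w' : X ⟶ W}
    (hr : k ≫ r = r') (hw : k ≫ w = w') :
    IsUniversalArrow (V.pull k) (P.balLeft M N L r' t u w' ≫ inv (evCmpr _ k hr hw)) := by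
  have sq := P.isBeckChevalley_projection k (lift t u) (lift (g₁ R T U W) (g₄ R T U W))
    (lift (g₂ R T U W) (g₃ R T U W)) (lift r w) (lift r' (lift t (lift u w')))
    (by ext <;> simp [hr, hw]) (by ext <;> simp)
  have h := (sq (lift r' w') (by ext <;> simp) (by ext <;> simp [hr, hw]) _
    (P.isUniversalArrow_balLeft M N L (g₁ R T U W) (g₂ R T U W) (g₃ R T U W) (g₄ R T U W)))
  have hc := P.carries_balLeft M N L (lift r' (lift t (lift u w'))) (r := g₁ R T U W)
    (t := g₂ R T U W) (u := g₃ R T U W) (w := g₄ R T U W) (r' := r') (t' := t) (u' := u) (w' := w')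
    (by simp) (by simp) (by simp) (by simp)
  unfold Carries at hc
  rw [reassoc_of% hc] at h
  have h' := h.iso_comp (inv (tensorComparison (V.pull _) (tensorComparison (V.pull _)
        (evCmpr M (lift r' (lift t (lift u w'))) (r := g₁ R T U W) (t := g₂ R T U W) (r' := r')
          (t' := t) (by simp) (by simp))
        (evCmpr N (lift r' (lift t (lift u w'))) (r := g₂ R T U W) (t := g₃ R T U W) (r' := t)
          (t' := u) (by simp) (by simp)))
        (evCmpr L (lift r' (lift t (lift u w'))) (r := g₃ R T U W) (t := g₄ R T U W) (r' := u)
          (t' := w') (by simp) (by simp))))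
  rw [IsIso.inv_hom_id_assoc] at h'
  convert h' using 2
  simp [evCmpr, cmpr]

variable {M N L} in
/-- Morphisms out of `((M ⊙ N) ⊙ L) ⊙ Q` are determined by their composites with the fourfold
balancing maps. -/
theorem comp_comp_comp_hom_ext {Q : V.Fib (W ⊗ Y)} {K : V.Fib (R ⊗ Y)}
    {f g : P.comp (P.comp (P.comp M N) L) Q ⟶ K}
    (h : ∀ {Z : S} (r : Z ⟶ R) (t : Z ⟶ T) (u : Z ⟶ U) (w : Z ⟶ W) (y : Z ⟶ Y),
      P.balLeft M N L r t u w ▷ ev Q w y ≫ P.bal _ Q r w y ≫ (V.pull (lift r y)).map f =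
        P.balLeft M N L r t u w ▷ ev Q w y ≫ P.bal _ Q r w y ≫ (V.pull (lift r y)).map g) :
    f = g := by
  -- The generic elements live over `R × W × Y × T × U`, ordered so that the coproduct over `T × U`
  -- is taken along a first projection.
  refine IsUniversalArrow.hom_ext (P.isUniversalArrow_whiskerRight_bal
    (Z := (R ⊗ (W ⊗ Y)) ⊗ (T ⊗ U)) _ Q (r := p₁ _ _ ≫ p₁ _ _)
    (u := p₁ _ _ ≫ p₂ _ _ ≫ p₁ _ _) (w := p₁ _ _ ≫ p₂ _ _ ≫ p₂ _ _)
    (P.balLeft M N L _ (p₂ _ _ ≫ p₁ _ _) (p₂ _ _ ≫ p₂ _ _) _) ?_) ?_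
  · have : IsIso (lift (lift (p₁ (R ⊗ (W ⊗ Y)) (T ⊗ U) ≫ p₁ _ _)
        (lift (p₁ (R ⊗ (W ⊗ Y)) (T ⊗ U) ≫ p₂ _ _ ≫ p₁ _ _)
          (p₁ (R ⊗ (W ⊗ Y)) (T ⊗ U) ≫ p₂ _ _ ≫ p₂ _ _)))
        (lift (p₂ (R ⊗ (W ⊗ Y)) (T ⊗ U) ≫ p₁ _ _) (p₂ (R ⊗ (W ⊗ Y)) (T ⊗ U) ≫ p₂ _ _))) :=
      ⟨𝟙 _, by ext <;> simp, by ext <;> simp⟩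
    exact P.isUniversalArrow_balLeft_local M N L _ _ _ (by simp) (by simp)
  · simpa only [Category.assoc] using h _ _ _ _ _

theorem assocHom_naturality {M' : V.Fib (R ⊗ T)} {N' : V.Fib (T ⊗ U)} {L' : V.Fib (U ⊗ W)}
    (f : M ⟶ M') (g : N ⟶ N') (h : L ⟶ L') :
    P.compMap (P.compMap f g) h ≫ P.assocHom M' N' L' =
      P.assocHom M N L ≫ P.compMap f (P.compMap g h) := by
  refine P.comp_comp_hom_ext fun r t u w => ?_
  have hL : P.balLeft M N L r t u w ≫ (V.pull (lift r w)).map (P.compMap (P.compMap f g) h) =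
      (((V.pull _).map f ⊗ₘ (V.pull _).map g) ⊗ₘ (V.pull _).map h) ≫
        P.balLeft M' N' L' r t u w := by
    rw [balLeft, balLeft, Category.assoc, ← bal_naturality, ← tensorHom_id, ← tensorHom_id,
      tensorHom_comp_tensorHom_assoc, tensorHom_comp_tensorHom_assoc, Category.id_comp,
      Category.comp_id, bal_naturality]
  have hR : P.balRight M N L r t u w ≫ (V.pull (lift r w)).map (P.compMap f (P.compMap g h)) =
      ((V.pull _).map f ⊗ₘ ((V.pull _).map g ⊗ₘ (V.pull _).map h)) ≫
        P.balRight M' N' L' r t u w := by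
    rw [balRight, balRight, Category.assoc, ← bal_naturality, ← id_tensorHom, ← id_tensorHom,
      tensorHom_comp_tensorHom_assoc, tensorHom_comp_tensorHom_assoc, Category.id_comp,
      Category.comp_id, bal_naturality]
  rw [Functor.map_comp, reassoc_of% hL, balLeft_comp_assocHom, Functor.map_comp,
    balLeft_comp_assocHom_assoc, hR, associator_naturality_assoc]

theorem bal_comp_compMap_id {M' : V.Fib (R ⊗ T)} (f : M ⟶ M') (r : Z ⟶ R) (t : Z ⟶ T)
    (u : Z ⟶ U) : P.bal M N r t u ≫ (V.pull (lift r u)).map (P.compMap f (𝟙 N)) =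
      (V.pull (lift r t)).map f ▷ ev N t u ≫ P.bal M' N r t u := by
  rw [← bal_naturality, CategoryTheory.Functor.map_id, tensorHom_id]

theorem bal_comp_id_compMap {N' : V.Fib (T ⊗ U)} (f : N ⟶ N') (r : Z ⟶ R) (t : Z ⟶ T)
    (u : Z ⟶ U) : P.bal M N r t u ≫ (V.pull (lift r u)).map (P.compMap (𝟙 M) f) =
      ev M r t ◁ (V.pull (lift t u)).map f ≫ P.bal M N' r t u := by
  rw [← bal_naturality, CategoryTheory.Functor.map_id, id_tensorHom]

theorem balLeft_whiskerRight_comp_bal (Q : V.Fib (W ⊗ Y)) (r : Z ⟶ R) (t : Z ⟶ T) (u : Z ⟶ U)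
    (w : Z ⟶ W) (y : Z ⟶ Y) : P.balLeft M N L r t u w ▷ ev Q w y ≫ P.bal _ Q r w y =
      P.bal M N r t u ▷ ev L u w ▷ ev Q w y ≫ P.balLeft (P.comp M N) L Q r u w y := by
  simp [balLeft]

theorem balRight_whiskerRight_comp_bal (Q : V.Fib (W ⊗ Y)) (r : Z ⟶ R) (t : Z ⟶ T) (u : Z ⟶ U)
    (w : Z ⟶ W) (y : Z ⟶ Y) : P.balRight M N L r t u w ▷ ev Q w y ≫ P.bal _ Q r w y =
      (ev M r t ◁ P.bal N L t u w) ▷ ev Q w y ≫ P.balLeft M (P.comp N L) Q r t w y := by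
  simp [balLeft, balRight]

/-- At all generalized elements, this is the pentagon of the tensor product. -/
theorem pentagon (Q : V.Fib (W ⊗ Y)) :
    P.compMap (P.assocHom M N L) (𝟙 Q) ≫ P.assocHom M (P.comp N L) Q ≫
        P.compMap (𝟙 M) (P.assocHom N L Q) =
      P.assocHom (P.comp M N) L Q ≫ P.assocHom M N (P.comp L Q) := by
  refine P.comp_comp_comp_hom_ext fun r t u w y => ?_
  have hl : P.balLeft M N L r t u w ▷ ev Q w y ≫ P.bal _ Q r w y ≫ (V.pull (lift r y)).map
      (P.compMap (P.assocHom M N L) (𝟙 Q) ≫ P.assocHom M (P.comp N L) Q ≫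
        P.compMap (𝟙 M) (P.assocHom N L Q)) =
      (αₘ _ _ _).hom ▷ ev Q w y ≫ (αₘ _ _ _).hom ≫ ev M r t ◁ (αₘ _ _ _).hom ≫
        ev M r t ◁ P.balRight N L Q t u w y ≫ P.bal _ _ r t y := by
    rw [Functor.map_comp, Functor.map_comp, ← Category.assoc (P.bal _ _ _ _ _),
      bal_comp_compMap_id, Category.assoc, ← comp_whiskerRight_assoc, balLeft_comp_assocHom,
      comp_whiskerRight_assoc, ← Category.assoc (P.balRight _ _ _ _ _ _ _ ▷ _),
      balRight_whiskerRight_comp_bal, Category.assoc, balLeft_comp_assocHom_assoc, balRight,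
      Category.assoc, bal_comp_id_compMap, associator_naturality_middle_assoc,
      ← MonoidalCategory.whiskerLeft_comp_assoc, ← MonoidalCategory.whiskerLeft_comp_assoc,
      ← balLeft, balLeft_comp_assocHom,
      MonoidalCategory.whiskerLeft_comp_assoc]
  have hr : P.balLeft M N L r t u w ▷ ev Q w y ≫ P.bal _ Q r w y ≫ (V.pull (lift r y)).map
      (P.assocHom (P.comp M N) L Q ≫ P.assocHom M N (P.comp L Q)) =
      (αₘ _ _ _).hom ≫ (αₘ _ _ _).hom ≫
        ev M r t ◁ P.balRight N L Q t u w y ≫ P.bal _ _ r t y := by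
    rw [← Category.assoc, balLeft_whiskerRight_comp_bal, Functor.map_comp, Category.assoc,
      balLeft_comp_assocHom_assoc, associator_naturality_left_assoc, balRight, Category.assoc,
      ← whisker_exchange_assoc, ← Category.assoc (P.bal M N r t u ▷ _), ← balLeft,
      balLeft_comp_assocHom, associator_naturality_right_assoc, balRight, balRight,
      MonoidalCategory.whiskerLeft_comp_assoc]
  rw [hl, hr, MonoidalCategory.pentagon_assoc]

end Coproducts

end

end IndexedMonoidalCategory

namespace IndexedMonoidalCategory

open Functor.LaxMonoidal Functor.OplaxMonoidal

open CartesianMonoidalCategory renaming fst → p₁, snd → p₂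
open MonoidalCategoryStruct renaming associator → αₘ, leftUnitor → lₘ, rightUnitor → rₘ

section

variable {S : Type u'} [Category.{v'} S] [CartesianMonoidalCategory S]
  {V : IndexedMonoidalCategory.{v, u} S}

/-! ### Units -/

omit [CartesianMonoidalCategory S] in
theorem map_η_comp_η {Z₂ Z₁ Z₀ : S} {w : Z₂ ⟶ Z₁} {z : Z₁ ⟶ Z₀} {y : Z₂ ⟶ Z₀}
    (h : w ≫ z = y) :
    (V.pull w).map (η (V.pull z)) ≫ η (V.pull w) = V.cmpr w z y h (𝟙_ _) ≫ η (V.pull y) := by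
  have hm := NatTrans.IsMonoidal.unit (τ := (V.pullComp w z y h).hom)
  simp only [Functor.LaxMonoidal.comp_ε, Category.assoc] at hm
  rw [← cancel_epi ((V.pull w).map (Functor.LaxMonoidal.ε (V.pull z))),
    ← cancel_epi (Functor.LaxMonoidal.ε (V.pull w)), reassoc_of% hm, ← Functor.map_comp_assoc]
  simp

namespace Coproducts

variable (P : V.Coproducts) {R T U W Y Z : S}

/-- The unit `I_R`, the coproduct of the unit object along the diagonal. -/
noncomputable def unitObj (R : S) : V.Fib (R ⊗ R) :=
  (P.push (lift (𝟙 R) (𝟙 R))).obj ((V.pull (toUnit R)).obj (𝟙_ (V.Fib (𝟙_ S))))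

/-- The universal point of the unit on the diagonal. -/
noncomputable def genericPoint (R : S) :
    𝟙_ (V.Fib R) ⟶ (V.pull (lift (𝟙 R) (𝟙 R))).obj (P.unitObj R) :=
  Functor.LaxMonoidal.ε (V.pull (toUnit R)) ≫ P.ins (lift (𝟙 R) (𝟙 R)) _

theorem isUniversalArrow_genericPoint (R : S) :
    IsUniversalArrow (V.pull (lift (𝟙 R) (𝟙 R))) (P.genericPoint R) :=
  (P.universal _ _).iso_comp _

/-- The point `𝟙 ⟶ I_R(r, r)`. -/
noncomputable def point (r : Z ⟶ R) : 𝟙_ (V.Fib Z) ⟶ ev (P.unitObj R) r r :=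
  Functor.LaxMonoidal.ε (V.pull r) ≫ (V.pull r).map (P.genericPoint R) ≫
    V.cmpr r (lift (𝟙 R) (𝟙 R)) (lift r r) (by simp) _

theorem carries_genericPoint (r : Z ⟶ R) :
    Carries (V.pull r) (η (V.pull r)) (V.cmpr r (lift (𝟙 R) (𝟙 R)) (lift r r) (by simp) _)
      (P.genericPoint R) (P.point r) := by
  simp [Carries, point]

theorem carries_point {Z' : S} (w : Z' ⟶ Z) {r : Z ⟶ R} {r' : Z' ⟶ R} (hr : w ≫ r = r') :
    Carries (V.pull w) (η (V.pull w)) (evCmpr (P.unitObj R) w hr hr) (P.point r) (P.point r') :=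
  carries_of_carries hr (P.carries_genericPoint r) (P.carries_genericPoint r')
    (map_η_comp_η hr) (V.pullComp_assoc ..)

/-- Over a product of `R × R` and `W`, the point exhibits `I_R(m, m')` as a coproduct along the
diagonal `R × W ⟶ R × R × W`. -/
theorem isUniversalArrow_point {X : S} (k : X ⟶ Y) (r : X ⟶ R) (s : X ⟶ W) [IsIso (lift r s)]
    {m m' : Y ⟶ R} (n : Y ⟶ W) [IsIso (lift (lift m m') n)] (hm : k ≫ m = r) (hm' : k ≫ m' = r)
    (hn : k ≫ n = s) :
    IsUniversalArrow (V.pull k) (P.point r ≫ inv (evCmpr (P.unitObj R) k hm hm')) := by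
  have sq := P.isBeckChevalley_embedding k r s (lift m m') n (lift (𝟙 R) (𝟙 R))
    (by ext <;> simp [hm, hm']) hn
  have h := (sq (lift r r) (by simp) (by ext <;> simp [hm, hm']) _
    (P.isUniversalArrow_genericPoint R)).iso_comp (Functor.LaxMonoidal.ε (V.pull r))
  convert h using 1
  simp [point, evCmpr, cmpr]

/-- The map `M(r, t) ≅ 𝟙 ⊗ M(r, t) ⟶ I(r, r) ⊗ M(r, t) ⟶ (I ⊙ M)(r, t)`. -/
noncomputable def insLeft (M : V.Fib (R ⊗ T)) (r : Z ⟶ R) (t : Z ⟶ T) :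
    ev M r t ⟶ ev (P.comp (P.unitObj R) M) r t :=
  (lₘ _).inv ≫ P.point r ▷ ev M r t ≫ P.bal (P.unitObj R) M r r t

/-- The map `M(r, t) ≅ M(r, t) ⊗ 𝟙 ⟶ M(r, t) ⊗ I(t, t) ⟶ (M ⊙ I)(r, t)`. -/
noncomputable def insRight (M : V.Fib (R ⊗ T)) (r : Z ⟶ R) (t : Z ⟶ T) :
    ev M r t ⟶ ev (P.comp M (P.unitObj T)) r t :=
  (rₘ _).inv ≫ ev M r t ◁ P.point t ≫ P.bal M (P.unitObj T) r t t

variable (M : V.Fib (R ⊗ T))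

theorem carries_insLeft {Z' : S} (w : Z' ⟶ Z) {r : Z ⟶ R} {t : Z ⟶ T} {r' : Z' ⟶ R} {t' : Z' ⟶ T}
    (hr : w ≫ r = r') (ht : w ≫ t = t') :
    Carries (V.pull w) (evCmpr M w hr ht) (evCmpr _ w hr ht) (P.insLeft M r t)
      (P.insLeft M r' t') :=
  (Carries.leftUnitor_inv _).comp
    (((P.carries_point w hr).whiskerRight _).comp (P.carries_bal _ M w hr hr ht))

theorem carries_insRight {Z' : S} (w : Z' ⟶ Z) {r : Z ⟶ R} {t : Z ⟶ T} {r' : Z' ⟶ R} {t' : Z' ⟶ T}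
    (hr : w ≫ r = r') (ht : w ≫ t = t') :
    Carries (V.pull w) (evCmpr M w hr ht) (evCmpr _ w hr ht) (P.insRight M r t)
      (P.insRight M r' t') :=
  (Carries.rightUnitor_inv _).comp
    (((P.carries_point w ht).whiskerLeft _).comp (P.carries_bal M _ w hr ht ht))

/-- The point exhibits `I` as a coproduct along the diagonal and the balancing map exhibits `I ⊙ M`
as a coproduct along a projection; together they exhibit `I ⊙ M` as the coproduct of `M` along the
composite, which is an isomorphism. -/
theorem isIso_insLeft (r : Z ⟶ R) (t : Z ⟶ T) [IsIso (lift r t)] : IsIso (P.insLeft M r t) := by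
  have : IsIso (lift (lift (p₁ R (R ⊗ T)) (p₂ R (R ⊗ T) ≫ p₁ _ _)) (p₂ R (R ⊗ T) ≫ p₂ _ _)) :=
    ⟨lift (p₁ _ _ ≫ p₁ _ _) (lift (p₁ _ _ ≫ p₂ _ _) (p₂ _ _)), by ext <;> simp, by ext <;> simp⟩
  have := (P.isUniversalArrow_whiskerRight_bal (P.unitObj R) M (r := r) (u := r) (w := t)
    (P.point r)
    (P.isUniversalArrow_point _ r t (p₂ _ _ ≫ p₂ _ _) (by simp) (by simp) (by simp))).isIso
  unfold insLeft
  infer_instance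

theorem isIso_insRight (r : Z ⟶ R) (t : Z ⟶ T) [IsIso (lift r t)] : IsIso (P.insRight M r t) := by
  have : IsIso (lift (lift (p₂ R (T ⊗ T) ≫ p₁ _ _) (p₂ R (T ⊗ T) ≫ p₂ _ _)) (p₁ R (T ⊗ T))) :=
    ⟨lift (p₂ _ _) (p₁ _ _), by ext <;> simp, by ext <;> simp⟩
  have : IsIso (lift t r) := by
    rw [show lift t r = lift r t ≫ lift (p₂ _ _) (p₁ _ _) by simp]
    have : IsIso (lift (p₂ R T) (p₁ R T)) := ⟨lift (p₂ _ _) (p₁ _ _), by simp, by simp⟩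
    infer_instance
  have := (P.isUniversalArrow_whiskerLeft_bal M (P.unitObj T) (r := r) (t := t) (w := t)
    (P.point t)
    (P.isUniversalArrow_point _ t r (p₁ _ _) (by simp) (by simp) (by simp))).isIso
  unfold insRight
  infer_instance

end Coproducts

/-- Morphisms `M ⟶ N` are determined by their effect on all generalized elements. -/
theorem hom_ext_ev {R T : S} {M N : V.Fib (R ⊗ T)} {f g : M ⟶ N}
    (h : ∀ {Z : S} (r : Z ⟶ R) (t : Z ⟶ T),
      (V.pull (lift r t)).map f = (V.pull (lift r t)).map g) : f = g := by
  have : IsIso (lift (p₁ R T) (p₂ R T)) := by rw [lift_fst_snd]; infer_instance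
  exact (V.pull (lift (p₁ R T) (p₂ R T))).map_injective (h _ _)

/-- A family of morphisms `M(r, t) ⟶ N(r, t)`, stable under change of the generalized elements,
comes from a morphism `M ⟶ N`. -/
theorem exists_map_ev {R T : S} {M N : V.Fib (R ⊗ T)}
    (φ : ∀ {Z : S} (r : Z ⟶ R) (t : Z ⟶ T), ev M r t ⟶ ev N r t)
    (hφ : ∀ {Z Z' : S} (w : Z' ⟶ Z) {r : Z ⟶ R} {t : Z ⟶ T} {r' : Z' ⟶ R} {t' : Z' ⟶ T}
      (hr : w ≫ r = r') (ht : w ≫ t = t'),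
      Carries (V.pull w) (evCmpr M w hr ht) (evCmpr N w hr ht) (φ r t) (φ r' t')) :
    ∃ f : M ⟶ N, ∀ {Z : S} (r : Z ⟶ R) (t : Z ⟶ T), (V.pull (lift r t)).map f = φ r t := by
  have : IsIso (lift (p₁ R T) (p₂ R T)) := by rw [lift_fst_snd]; infer_instance
  refine ⟨(V.pull (lift (p₁ R T) (p₂ R T))).preimage (φ _ _), fun {Z} r t => ?_⟩
  have h := V.carries_pull_map (lift r t) (lift (p₁ R T) (p₂ R T)) (lift r t) (by simp)
    ((V.pull (lift (p₁ R T) (p₂ R T))).preimage (φ _ _))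
  rw [Functor.map_preimage] at h
  exact h.unique (hφ _ (by simp) (by simp))

theorem isIso_of_ev {R T : S} {M N : V.Fib (R ⊗ T)} (f : M ⟶ N)
    (h : ∀ {Z : S} (r : Z ⟶ R) (t : Z ⟶ T) [IsIso (lift r t)],
      IsIso ((V.pull (lift r t)).map f)) : IsIso f := by
  have : IsIso (lift (p₁ R T) (p₂ R T)) := by rw [lift_fst_snd]; infer_instance
  have := h (p₁ R T) (p₂ R T)
  exact isIso_of_reflects_iso f (V.pull (lift (p₁ R T) (p₂ R T)))

namespace Coproducts

variable (P : V.Coproducts) {R T U W Y Z : S} (M : V.Fib (R ⊗ T))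

/-- The inverse `M ⟶ I ⊙ M` of the left unit isomorphism. -/
noncomputable def lunitInv : M ⟶ P.comp (P.unitObj R) M :=
  (exists_map_ev (P.insLeft M) (P.carries_insLeft M)).choose

/-- The inverse `M ⟶ M ⊙ I` of the right unit isomorphism. -/
noncomputable def runitInv : M ⟶ P.comp M (P.unitObj T) :=
  (exists_map_ev (P.insRight M) (P.carries_insRight M)).choose

theorem map_lunitInv (r : Z ⟶ R) (t : Z ⟶ T) :
    (V.pull (lift r t)).map (P.lunitInv M) = P.insLeft M r t :=
  (exists_map_ev (P.insLeft M) (P.carries_insLeft M)).choose_spec r t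

theorem map_runitInv (r : Z ⟶ R) (t : Z ⟶ T) :
    (V.pull (lift r t)).map (P.runitInv M) = P.insRight M r t :=
  (exists_map_ev (P.insRight M) (P.carries_insRight M)).choose_spec r t

instance isIso_lunitInv : IsIso (P.lunitInv M) :=
  isIso_of_ev _ fun r t _ => by rw [map_lunitInv]; exact P.isIso_insLeft M r t

instance isIso_runitInv : IsIso (P.runitInv M) :=
  isIso_of_ev _ fun r t _ => by rw [map_runitInv]; exact P.isIso_insRight M r t

variable {M}

theorem lunitInv_naturality {M' : V.Fib (R ⊗ T)} (f : M ⟶ M') :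
    f ≫ P.lunitInv M' = P.lunitInv M ≫ P.compMap (𝟙 _) f := by
  refine hom_ext_ev fun r t => ?_
  rw [Functor.map_comp, Functor.map_comp, map_lunitInv, map_lunitInv, insLeft, insLeft,
    Category.assoc, Category.assoc, bal_comp_id_compMap, leftUnitor_inv_naturality_assoc,
    whisker_exchange_assoc]

theorem runitInv_naturality {M' : V.Fib (R ⊗ T)} (f : M ⟶ M') :
    f ≫ P.runitInv M' = P.runitInv M ≫ P.compMap f (𝟙 _) := by
  refine hom_ext_ev fun r t => ?_
  rw [Functor.map_comp, Functor.map_comp, map_runitInv, map_runitInv, insRight, insRight,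
    Category.assoc, Category.assoc, bal_comp_compMap_id, rightUnitor_inv_naturality_assoc,
    ← whisker_exchange_assoc]

variable (M)

/-- The unit axiom, for the inverses of the unit isomorphisms; at all generalized elements it is
the triangle axiom of the tensor product. -/
theorem triangle (N : V.Fib (T ⊗ U)) :
    P.compMap (P.runitInv M) (𝟙 N) ≫ P.assocHom M (P.unitObj T) N =
      P.compMap (𝟙 M) (P.lunitInv N) := by
  refine P.comp_hom_ext fun r t u => ?_
  rw [Functor.map_comp, ← Category.assoc, bal_comp_compMap_id, bal_comp_id_compMap, map_runitInv,
    map_lunitInv, insRight, insLeft, comp_whiskerRight, comp_whiskerRight, Category.assoc,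
    Category.assoc, Category.assoc, ← Category.assoc (P.bal M (P.unitObj T) r t t ▷ _), ← balLeft,
    balLeft_comp_assocHom, balRight, associator_naturality_middle_assoc,
    ← triangle_assoc_comp_left_inv, Category.assoc, Iso.inv_hom_id_assoc,
    MonoidalCategory.whiskerLeft_comp, MonoidalCategory.whiskerLeft_comp, Category.assoc,
    Category.assoc]

theorem assocHom_comp_compMap_inv (N : V.Fib (T ⊗ U)) :
    P.assocHom M (P.unitObj T) N ≫ P.compMap (𝟙 M) (inv (P.lunitInv N)) =
      P.compMap (inv (P.runitInv M)) (𝟙 N) := by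
  have h₁ : P.compMap (inv (P.runitInv M)) (𝟙 N) ≫ P.compMap (P.runitInv M) (𝟙 N) = 𝟙 _ := by
    rw [← compMap_comp, IsIso.inv_hom_id, Category.comp_id, compMap_id]
  have h₂ : P.compMap (𝟙 M) (P.lunitInv N) ≫ P.compMap (𝟙 M) (inv (P.lunitInv N)) = 𝟙 _ := by
    rw [← compMap_comp, IsIso.hom_inv_id, Category.comp_id, compMap_id]
  rw [← Category.id_comp (P.assocHom _ _ _), ← h₁]
  simp only [Category.assoc]
  rw [← Category.assoc (P.compMap (P.runitInv M) (𝟙 N)), triangle, h₂, Category.comp_id]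

end Coproducts

end

end IndexedMonoidalCategory

namespace IndexedMonoidalCategory

open Functor.LaxMonoidal Functor.OplaxMonoidal

open CartesianMonoidalCategory renaming fst → p₁, snd → p₂
open MonoidalCategoryStruct renaming associator → αₘ

section

variable {S : Type u'} [Category.{v'} S] [CartesianMonoidalCategory S]
  {V : IndexedMonoidalCategory.{v, u} S}

/-! ### Shadows -/

namespace Coproducts

variable (P : V.Coproducts) {R T U W Y Z : S}

/-- The shadow `⟨M⟩`, the coproduct over `r : R` of `M(r, r)`. -/
noncomputable def sh (M : V.Fib (R ⊗ R)) : V.Fib (𝟙_ S) :=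
  (P.push (toUnit R)).obj ((V.pull (lift (𝟙 R) (𝟙 R))).obj M)

/-- The shadow of a morphism. -/
noncomputable def shMap {M N : V.Fib (R ⊗ R)} (f : M ⟶ N) : P.sh M ⟶ P.sh N :=
  (P.push (toUnit R)).map ((V.pull (lift (𝟙 R) (𝟙 R))).map f)

instance isIso_shMap {M N : V.Fib (R ⊗ R)} (f : M ⟶ N) [IsIso f] : IsIso (P.shMap f) :=
  inferInstanceAs (IsIso ((P.push (toUnit R)).map ((V.pull (lift (𝟙 R) (𝟙 R))).map f)))

theorem shMap_inv {M N : V.Fib (R ⊗ R)} (f : M ⟶ N) [IsIso f] :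
    P.shMap (inv f) = inv (P.shMap f) :=
  (congrArg (P.push (toUnit R)).map (Functor.map_inv _ f)).trans (Functor.map_inv _ _)

/-- The universal trace map, the insertion of `Δ^* M` into its coproduct. -/
noncomputable def genericTr (M : V.Fib (R ⊗ R)) :
    ev M (𝟙 R) (𝟙 R) ⟶ (V.pull (toUnit R)).obj (P.sh M) :=
  P.ins (toUnit R) _

theorem isUniversalArrow_genericTr (M : V.Fib (R ⊗ R)) :
    IsUniversalArrow (V.pull (toUnit R)) (P.genericTr M) :=
  P.universal _ _

theorem genericTr_naturality {M N : V.Fib (R ⊗ R)} (f : M ⟶ N) :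
    (V.pull (lift (𝟙 R) (𝟙 R))).map f ≫ P.genericTr N =
      P.genericTr M ≫ (V.pull (toUnit R)).map (P.shMap f) :=
  P.ins_naturality _ _

/-- The trace map `M(r, r) ⟶ ⟨M⟩`. -/
noncomputable def tr (M : V.Fib (R ⊗ R)) (r : Z ⟶ R) :
    ev M r r ⟶ (V.pull (toUnit Z)).obj (P.sh M) :=
  inv (evCmpr M r (r := 𝟙 R) (t := 𝟙 R) (by simp) (by simp)) ≫ (V.pull r).map (P.genericTr M) ≫
    V.cmpr r (toUnit R) (toUnit Z) (by simp) _

theorem carries_genericTr (M : V.Fib (R ⊗ R)) (r : Z ⟶ R) :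
    Carries (V.pull r) (evCmpr M r (by simp) (by simp)) (V.cmpr r (toUnit R) (toUnit Z) (by simp) _)
      (P.genericTr M) (P.tr M r) := by
  simp [Carries, tr]

theorem carries_tr (M : V.Fib (R ⊗ R)) {Z' : S} (w : Z' ⟶ Z) {r : Z ⟶ R} {r' : Z' ⟶ R}
    (hr : w ≫ r = r') :
    Carries (V.pull w) (evCmpr M w hr hr) (V.cmpr w (toUnit Z) (toUnit Z') (by simp) _)
      (P.tr M r) (P.tr M r') :=
  carries_of_carries hr (P.carries_genericTr M r) (P.carries_genericTr M r')
    (V.pullComp_assoc ..) (V.pullComp_assoc ..)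

theorem tr_naturality {M N : V.Fib (R ⊗ R)} (f : M ⟶ N) (r : Z ⟶ R) :
    (V.pull (lift r r)).map f ≫ P.tr N r = P.tr M r ≫ (V.pull (toUnit Z)).map (P.shMap f) := by
  have h := P.carries_genericTr M r
  have h' := P.carries_genericTr N r
  have hf := V.carries_pull_map r (lift (𝟙 R) (𝟙 R)) (lift r r) (by simp) f
  have hs := V.carries_pull_map r (toUnit R) (toUnit Z) (by simp) (P.shMap f)
  refine (hf.comp h').unique ?_
  rw [genericTr_naturality]
  exact h.comp hs

theorem tr_naturality_assoc {M N : V.Fib (R ⊗ R)} (f : M ⟶ N) (r : Z ⟶ R) {E : V.Fib Z}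
    (g : (V.pull (toUnit Z)).obj (P.sh N) ⟶ E) :
    (V.pull (lift r r)).map f ≫ P.tr N r ≫ g =
      P.tr M r ≫ (V.pull (toUnit Z)).map (P.shMap f) ≫ g := by
  rw [← Category.assoc, tr_naturality, Category.assoc]

theorem isUniversalArrow_comp_tr (M : V.Fib (R ⊗ R)) {E : V.Fib Z} {r : Z ⟶ R} (e : E ⟶ ev M r r)
    (he : IsUniversalArrow (V.pull r)
      (e ≫ inv (evCmpr M r (r := 𝟙 R) (t := 𝟙 R) (by simp) (by simp)))) :
    IsUniversalArrow (V.pull (toUnit Z)) (e ≫ P.tr M r) := by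
  have h := he.comp_pull (y := toUnit Z) (by simp) (P.isUniversalArrow_genericTr M)
  simpa only [tr, Category.assoc] using h

/-- The composite `M(r, t) ⊗ N(t, r) ⟶ (M ⊙ N)(r, r) ⟶ ⟨M ⊙ N⟩`. -/
noncomputable def balTr (M : V.Fib (R ⊗ T)) (N : V.Fib (T ⊗ R)) (r : Z ⟶ R) (t : Z ⟶ T) :
    ev M r t ⊗ ev N t r ⟶ (V.pull (toUnit Z)).obj (P.sh (P.comp M N)) :=
  P.bal M N r t r ≫ P.tr _ r

theorem carries_balTr (M : V.Fib (R ⊗ T)) (N : V.Fib (T ⊗ R)) {Z' : S} (w : Z' ⟶ Z) {r : Z ⟶ R}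
    {r' : Z' ⟶ R} {t : Z ⟶ T} {t' : Z' ⟶ T} (hr : w ≫ r = r') (ht : w ≫ t = t') :
    Carries (V.pull w) (tensorComparison (V.pull w) (evCmpr M w hr ht) (evCmpr N w ht hr))
      (V.cmpr w (toUnit Z) (toUnit Z') (by simp) _) (P.balTr M N r t) (P.balTr M N r' t') :=
  (P.carries_bal M N w hr ht hr).comp (P.carries_tr _ w hr)

theorem balTr_naturality {M M' : V.Fib (R ⊗ T)} {N N' : V.Fib (T ⊗ R)} (f : M ⟶ M') (g : N ⟶ N')
    (r : Z ⟶ R) (t : Z ⟶ T) :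
    ((V.pull (lift r t)).map f ⊗ₘ (V.pull (lift t r)).map g) ≫ P.balTr M' N' r t =
      P.balTr M N r t ≫ (V.pull (toUnit Z)).map (P.shMap (P.compMap f g)) := by
  rw [balTr, balTr, Category.assoc, ← tr_naturality, reassoc_of% P.bal_naturality f g r t r]

theorem isUniversalArrow_balTr (M : V.Fib (R ⊗ T)) (N : V.Fib (T ⊗ R)) (r : Z ⟶ R) (t : Z ⟶ T)
    [IsIso (lift r t)] : IsUniversalArrow (V.pull (toUnit Z)) (P.balTr M N r t) :=
  P.isUniversalArrow_comp_tr _ _ (P.isUniversalArrow_bal M N r t (by simp) (by simp))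

theorem sh_hom_ext {M : V.Fib (R ⊗ R)} {K : V.Fib (𝟙_ S)} {f g : P.sh M ⟶ K}
    (h : ∀ {Z : S} (r : Z ⟶ R),
      P.tr M r ≫ (V.pull (toUnit Z)).map f = P.tr M r ≫ (V.pull (toUnit Z)).map g) : f = g := by
  refine (P.isUniversalArrow_comp_tr M (E := ev M (𝟙 R) (𝟙 R)) (𝟙 _) ?_).hom_ext
    (by simpa using h (𝟙 R))
  exact IsUniversalArrow.of_isIso _

theorem sh_comp_hom_ext {M : V.Fib (R ⊗ T)} {N : V.Fib (T ⊗ R)} {K : V.Fib (𝟙_ S)}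
    {f g : P.sh (P.comp M N) ⟶ K}
    (h : ∀ {Z : S} (r : Z ⟶ R) (t : Z ⟶ T), P.balTr M N r t ≫ (V.pull (toUnit Z)).map f =
      P.balTr M N r t ≫ (V.pull (toUnit Z)).map g) : f = g := by
  have : IsIso (lift (p₁ R T) (p₂ R T)) := by rw [lift_fst_snd]; infer_instance
  exact (P.isUniversalArrow_balTr M N (p₁ R T) (p₂ R T)).hom_ext (h _ _)

theorem sh_comp_comp_hom_ext {M : V.Fib (R ⊗ T)} {N : V.Fib (T ⊗ U)} {L : V.Fib (U ⊗ R)}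
    {K : V.Fib (𝟙_ S)} {f g : P.sh (P.comp (P.comp M N) L) ⟶ K}
    (h : ∀ {Z : S} (r : Z ⟶ R) (t : Z ⟶ T) (u : Z ⟶ U),
      P.bal M N r t u ▷ ev L u r ≫ P.balTr (P.comp M N) L r u ≫ (V.pull (toUnit Z)).map f =
      P.bal M N r t u ▷ ev L u r ≫ P.balTr (P.comp M N) L r u ≫ (V.pull (toUnit Z)).map g) :
    f = g := by
  have : IsIso (lift (p₁ R (T ⊗ U)) (lift (p₂ R (T ⊗ U) ≫ p₁ _ _) (p₂ R (T ⊗ U) ≫ p₂ _ _))) :=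
    ⟨𝟙 _, by ext <;> simp, by ext <;> simp⟩
  refine (P.isUniversalArrow_comp_tr _ (P.balLeft M N L (p₁ R (T ⊗ U)) (p₂ R (T ⊗ U) ≫ p₁ _ _)
    (p₂ R (T ⊗ U) ≫ p₂ _ _) _) (P.isUniversalArrow_balLeft_local M N L _ _ _ (by simp)
      (by simp))).hom_ext ?_
  simpa only [balLeft, balTr, Category.assoc] using h _ _ _

section Symmetric

variable [∀ Z, SymmetricCategory (V.Fib Z)]

/-- The symmetries of the fibres are compatible with restriction. -/
def PullBraided (V : IndexedMonoidalCategory.{v, u} S) [∀ Z, SymmetricCategory (V.Fib Z)] :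
    Prop :=
  ∀ {Z X : S} (x : Z ⟶ X) (M N : V.Fib X),
    μ (V.pull x) M N ≫ (V.pull x).map (β_ M N).hom = (β_ _ _).hom ≫ μ (V.pull x) N M

theorem exists_cyc (M : V.Fib (R ⊗ T)) (N : V.Fib (T ⊗ R)) :
    ∃ c : P.sh (P.comp M N) ⟶ P.sh (P.comp N M),
      P.balTr M N (p₁ R T) (p₂ R T) ≫ (V.pull (toUnit (R ⊗ T))).map c =
        (β_ _ _).hom ≫ P.balTr N M (p₂ R T) (p₁ R T) := by
  have : IsIso (lift (p₁ R T) (p₂ R T)) := by rw [lift_fst_snd]; infer_instance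
  exact (P.isUniversalArrow_balTr M N (p₁ R T) (p₂ R T)).exists_fac _

/-- The cyclicity map `⟨M ⊙ N⟩ ⟶ ⟨N ⊙ M⟩`, characterized by `balTr_comp_cyc`. -/
noncomputable def cyc (M : V.Fib (R ⊗ T)) (N : V.Fib (T ⊗ R)) :
    P.sh (P.comp M N) ⟶ P.sh (P.comp N M) :=
  (P.exists_cyc M N).choose

instance isIso_cyc (M : V.Fib (R ⊗ T)) (N : V.Fib (T ⊗ R)) : IsIso (P.cyc M N) := by
  have : IsIso (lift (p₁ R T) (p₂ R T)) := by rw [lift_fst_snd]; infer_instance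
  have : IsIso (lift (p₂ R T) (p₁ R T)) := ⟨lift (p₂ _ _) (p₁ _ _), by simp, by simp⟩
  exact (P.isUniversalArrow_balTr M N (p₁ R T) (p₂ R T)).isIso_of_fac
    ((P.isUniversalArrow_balTr N M (p₂ R T) (p₁ R T)).iso_comp (β_ _ _).hom) _
    (P.exists_cyc M N).choose_spec

variable (hV : PullBraided V)

include hV

/-- At all generalized elements, the cyclicity map is the symmetry of `⊗`. -/
theorem balTr_comp_cyc (M : V.Fib (R ⊗ T)) (N : V.Fib (T ⊗ R)) (r : Z ⟶ R) (t : Z ⟶ T) :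
    P.balTr M N r t ≫ (V.pull (toUnit Z)).map (P.cyc M N) = (β_ _ _).hom ≫ P.balTr N M t r := by
  have hl := P.carries_balTr M N (lift r t) (r := p₁ R T) (t := p₂ R T) (r' := r) (t' := t)
    (by simp) (by simp)
  have hr := P.carries_balTr N M (lift r t) (r := p₂ R T) (t := p₁ R T) (r' := t) (t' := r)
    (by simp) (by simp)
  refine (hl.comp (V.carries_pull_map _ _ _ (by simp) (P.cyc M N))).unique ?_
  have := (Carries.braiding (hV (lift r t)) (evCmpr M (lift r t) (r := p₁ R T) (t := p₂ R T)
    (r' := r) (t' := t) (by simp) (by simp)) (evCmpr N (lift r t) (r := p₂ R T) (t := p₁ R T)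
    (r' := t) (t' := r) (by simp) (by simp))).comp hr
  rwa [← (P.exists_cyc M N).choose_spec] at this

theorem cyc_naturality {M M' : V.Fib (R ⊗ T)} {N N' : V.Fib (T ⊗ R)} (f : M ⟶ M') (g : N ⟶ N') :
    P.shMap (P.compMap f g) ≫ P.cyc M' N' = P.cyc M N ≫ P.shMap (P.compMap g f) := by
  refine P.sh_comp_hom_ext fun r t => ?_
  rw [Functor.map_comp, Functor.map_comp, ← Category.assoc, ← balTr_naturality, Category.assoc,
    balTr_comp_cyc P hV, ← Category.assoc (P.balTr M N r t), balTr_comp_cyc P hV, Category.assoc,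
    ← balTr_naturality, BraidedCategory.braiding_naturality_assoc]

theorem hexagon (M : V.Fib (R ⊗ T)) (N : V.Fib (T ⊗ U)) (L : V.Fib (U ⊗ R)) :
    P.shMap (P.assocHom M N L) ≫ P.cyc M (P.comp N L) ≫ P.shMap (P.assocHom N L M) =
      P.cyc (P.comp M N) L ≫ P.shMap (inv (P.assocHom L M N)) ≫ P.cyc (P.comp L M) N := by
  refine P.sh_comp_comp_hom_ext fun {Z} r t u => ?_
  have hl : P.bal M N r t u ▷ ev L u r ≫ P.balTr (P.comp M N) L r u ≫ (V.pull (toUnit Z)).map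
      (P.shMap (P.assocHom M N L) ≫ P.cyc M (P.comp N L) ≫ P.shMap (P.assocHom N L M)) =
      (αₘ _ _ _).hom ≫ (β_ _ _).hom ≫ (αₘ _ _ _).hom ≫ P.balRight N L M t u r t ≫ P.tr _ t := by
    rw [balTr, Functor.map_comp, Functor.map_comp, Category.assoc, ← tr_naturality_assoc,
      ← Category.assoc, ← Category.assoc, ← balLeft, balLeft_comp_assocHom, balRight]
    simp only [Category.assoc]
    rw [← Category.assoc (P.bal M _ _ _ _), ← balTr, ← Category.assoc (P.balTr _ _ _ _),
      balTr_comp_cyc P hV, Category.assoc, BraidedCategory.braiding_naturality_right_assoc, balTr,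
      Category.assoc, ← tr_naturality, ← Category.assoc (P.bal _ _ _ _ _),
      ← Category.assoc (P.bal N L t u r ▷ _), ← Category.assoc (P.bal N L t u r ▷ _), ← balLeft,
      balLeft_comp_assocHom, Category.assoc]
  have hr : P.bal M N r t u ▷ ev L u r ≫ P.balTr (P.comp M N) L r u ≫ (V.pull (toUnit Z)).map
      (P.cyc (P.comp M N) L ≫ P.shMap (inv (P.assocHom L M N)) ≫ P.cyc (P.comp L M) N) =
      (β_ _ _).hom ≫ (αₘ _ _ _).inv ≫ (β_ _ _).hom ≫ P.balRight N L M t u r t ≫ P.tr _ t := by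
    rw [Functor.map_comp, Functor.map_comp, ← Category.assoc (P.balTr _ _ _ _),
      balTr_comp_cyc P hV, Category.assoc, BraidedCategory.braiding_naturality_left_assoc, balTr,
      Category.assoc, ← tr_naturality_assoc, ← Category.assoc (P.bal _ _ _ _ _),
      ← Category.assoc (ev L u r ◁ P.bal M N r t u), ← Category.assoc (ev L u r ◁ P.bal M N r t u),
      ← balRight, balRight_comp_inv_assocHom, balLeft]
    simp only [Category.assoc]
    rw [← Category.assoc (P.bal _ N _ _ _), ← balTr, balTr_comp_cyc P hV,
      BraidedCategory.braiding_naturality_left_assoc, balTr, balRight, Category.assoc]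
  rw [hl, hr]
  -- What remains is a consequence of the two hexagons of the symmetric tensor product.
  have hb : (αₘ (ev M r t) (ev N t u) (ev L u r)).hom ≫ (β_ _ _).hom ≫ (αₘ _ _ _).hom =
      (β_ _ _).hom ≫ (αₘ _ _ _).inv ≫ (β_ _ _).hom := by
    have h := BraidedCategory.hexagon_reverse (ev M r t) (ev N t u) (ev L u r)
    rw [Iso.inv_comp_eq] at h
    rw [BraidedCategory.hexagon_forward, reassoc_of% h, BraidedCategory.braiding_naturality_left,
      BraidedCategory.braiding_tensor_left_hom]
    simp [← MonoidalCategory.whiskerLeft_comp_assoc]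
  simp only [← Category.assoc] at hb ⊢
  rw [hb]

theorem cyc_runitInv (M : V.Fib (R ⊗ R)) :
    P.shMap (P.runitInv M) ≫ P.cyc M (P.unitObj R) = P.shMap (P.lunitInv M) := by
  refine P.sh_hom_ext fun r => ?_
  rw [Functor.map_comp, ← tr_naturality_assoc, ← tr_naturality, map_runitInv, map_lunitInv,
    insRight, insLeft]
  simp only [Category.assoc]
  rw [← Category.assoc (P.bal _ _ _ _ _), ← balTr, balTr_comp_cyc P hV,
    BraidedCategory.braiding_naturality_right_assoc, balTr]
  simp

theorem cyc_lunitInv (M : V.Fib (R ⊗ R)) :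
    P.shMap (P.lunitInv M) ≫ P.cyc (P.unitObj R) M = P.shMap (P.runitInv M) := by
  refine P.sh_hom_ext fun r => ?_
  rw [Functor.map_comp, ← tr_naturality_assoc, ← tr_naturality, map_runitInv, map_lunitInv,
    insRight, insLeft]
  simp only [Category.assoc]
  rw [← Category.assoc (P.bal _ _ _ _ _), ← balTr, balTr_comp_cyc P hV,
    BraidedCategory.braiding_naturality_left_assoc, balTr]
  simp

theorem cyc_comp_shMap_inv_lunitInv (M : V.Fib (R ⊗ R)) :
    P.cyc M (P.unitObj R) ≫ P.shMap (inv (P.lunitInv M)) = P.shMap (inv (P.runitInv M)) := by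
  rw [shMap_inv, shMap_inv, IsIso.comp_inv_eq, IsIso.eq_inv_comp, cyc_runitInv P hV]

theorem cyc_comp_shMap_inv_runitInv (M : V.Fib (R ⊗ R)) :
    P.cyc (P.unitObj R) M ≫ P.shMap (inv (P.runitInv M)) = P.shMap (inv (P.lunitInv M)) := by
  rw [shMap_inv, shMap_inv, IsIso.comp_inv_eq, IsIso.eq_inv_comp, cyc_lunitInv P hV]

end Symmetric

end Coproducts

end

end IndexedMonoidalCategory

namespace IndexedMonoidalCategory

open Functor.LaxMonoidal Functor.OplaxMonoidal

open CartesianMonoidalCategory renaming fst → p₁, snd → p₂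

/-! ### Morphisms of indexed monoidal categories -/

section

variable {S : Type u'} [Category.{v'} S]

/-- A strong monoidal morphism of indexed monoidal categories. -/
structure Hom (V V' : IndexedMonoidalCategory.{v, u} S) where
  app : ∀ Z, V.Fib Z ⥤ V'.Fib Z
  appMon : ∀ Z, (app Z).Monoidal
  pullIso : ∀ {Z X : S} (x : Z ⟶ X), V.pull x ⋙ app Z ≅ app X ⋙ V'.pull x
  pullIso_isMonoidal : ∀ {Z X : S} (x : Z ⟶ X), NatTrans.IsMonoidal (pullIso x).hom
  pullIso_comp : ∀ {Z' Z X : S} (z : Z' ⟶ Z) (x : Z ⟶ X) (y : Z' ⟶ X) (h : z ≫ x = y)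
    (M : V.Fib X), (app Z').map (V.cmpr z x y h M) ≫ (pullIso y).hom.app M =
      (pullIso z).hom.app ((V.pull x).obj M) ≫ (V'.pull z).map ((pullIso x).hom.app M) ≫
        V'.cmpr z x y h ((app X).obj M)

attribute [instance] Hom.appMon Hom.pullIso_isMonoidal

namespace Hom

variable {V V' : IndexedMonoidalCategory.{v, u} S} (Φ : Hom V V')

/-- The comparison map `Φ (x^* M) ⟶ x^* M'` obtained from a comparison map `Φ M ⟶ M'`. -/
noncomputable def pullCmpr {Z X : S} (x : Z ⟶ X) {M : V.Fib X} {M' : V'.Fib X}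
    (c : (Φ.app X).obj M ⟶ M') : (Φ.app Z).obj ((V.pull x).obj M) ⟶ (V'.pull x).obj M' :=
  (Φ.pullIso x).hom.app M ≫ (V'.pull x).map c

instance {Z X : S} (x : Z ⟶ X) {M : V.Fib X} {M' : V'.Fib X} (c : (Φ.app X).obj M ⟶ M') [IsIso c] :
    IsIso (Φ.pullCmpr x c) := by
  unfold pullCmpr; infer_instance

theorem carries_pull {Z X : S} (x : Z ⟶ X) {M N : V.Fib X} {M' N' : V'.Fib X}
    {c : (Φ.app X).obj M ⟶ M'} {d : (Φ.app X).obj N ⟶ N'} {f : M ⟶ N} {f' : M' ⟶ N'}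
    (h : Carries (Φ.app X) c d f f') :
    Carries (Φ.app Z) (Φ.pullCmpr x c) (Φ.pullCmpr x d) ((V.pull x).map f)
      ((V'.pull x).map f') := by
  have hn := (Φ.pullIso x).hom.naturality f
  dsimp only [Functor.comp_map] at hn
  unfold Carries pullCmpr at *
  rw [reassoc_of% hn, ← Functor.map_comp, h, Functor.map_comp, Category.assoc]

theorem carries_cmpr {Z' Z X : S} (z : Z' ⟶ Z) (x : Z ⟶ X) (y : Z' ⟶ X) (h : z ≫ x = y)
    {M : V.Fib X} {M' : V'.Fib X} (c : (Φ.app X).obj M ⟶ M') :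
    Carries (Φ.app Z') (Φ.pullCmpr z (Φ.pullCmpr x c)) (Φ.pullCmpr y c) (V.cmpr z x y h M)
      (V'.cmpr z x y h M') := by
  have hn := (V'.pullComp z x y h).hom.naturality c
  dsimp only [Functor.comp_map] at hn
  unfold Carries pullCmpr
  rw [← Category.assoc, pullIso_comp, Functor.map_comp]
  simp only [Category.assoc]
  rw [hn]

theorem carries_tensorComparison {Z X : S} (x : Z ⟶ X) {M N : V.Fib X} {M' N' : V'.Fib X}
    {M₁ N₁ : V.Fib Z} {M₁' N₁' : V'.Fib Z} {c : (Φ.app X).obj M ⟶ M'} {d : (Φ.app X).obj N ⟶ N'}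
    {c₁ : (Φ.app Z).obj M₁ ⟶ M₁'} {d₁ : (Φ.app Z).obj N₁ ⟶ N₁'}
    {a : (V.pull x).obj M ⟶ M₁} {b : (V.pull x).obj N ⟶ N₁} {a' : (V'.pull x).obj M' ⟶ M₁'}
    {b' : (V'.pull x).obj N' ⟶ N₁'}
    (ha : Carries (Φ.app Z) (Φ.pullCmpr x c) c₁ a a')
    (hb : Carries (Φ.app Z) (Φ.pullCmpr x d) d₁ b b') :
    Carries (Φ.app Z) (Φ.pullCmpr x (tensorComparison (Φ.app X) c d))
      (tensorComparison (Φ.app Z) c₁ d₁) (tensorComparison (V.pull x) a b)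
      (tensorComparison (V'.pull x) a' b') := by
  have hm := NatTrans.IsMonoidal.tensor (τ := (Φ.pullIso x).hom) M N
  simp only [Functor.LaxMonoidal.comp_μ, Category.assoc] at hm
  unfold Carries pullCmpr at *
  rw [← cancel_epi ((Φ.app Z).map (μ (V.pull x) M N)), ← cancel_epi (μ (Φ.app Z) _ _),
    ← Functor.map_comp_assoc, μ_comp_tensorComparison, map_tensorHom_comp_tensorComparison,
    μ_comp_tensorComparison, ha, hb]
  simp only [Category.assoc]
  rw [reassoc_of% hm, ← Functor.map_comp_assoc,
    μ_comp_tensorComparison, map_tensorHom_comp_tensorComparison, μ_comp_tensorComparison,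
    tensorHom_comp_tensorHom]

theorem carries_ε {Z X : S} (x : Z ⟶ X) :
    Carries (Φ.app Z) (η (Φ.app Z)) (Φ.pullCmpr x (η (Φ.app X))) (Functor.LaxMonoidal.ε (V.pull x))
      (Functor.LaxMonoidal.ε (V'.pull x)) := by
  have hm := NatTrans.IsMonoidal.unit (τ := (Φ.pullIso x).hom)
  simp only [Functor.LaxMonoidal.comp_ε, Category.assoc] at hm
  unfold Carries pullCmpr
  rw [← cancel_epi (Functor.LaxMonoidal.ε (Φ.app Z)), reassoc_of% hm, ← Functor.map_comp]
  simp

/-- When the comparison map of the source is invertible, any morphism is carried to some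
morphism. -/
theorem exists_carries {X : S} {M N : V.Fib X} {M' N' : V'.Fib X} (c : (Φ.app X).obj M ⟶ M')
    (d : (Φ.app X).obj N ⟶ N') [IsIso c] (f : M ⟶ N) :
    ∃ f' : M' ⟶ N', Carries (Φ.app X) c d f f' :=
  ⟨inv c ≫ (Φ.app X).map f ≫ d, by simp [Carries]⟩

end Hom

end

section

variable {S : Type u'} [Category.{v'} S] [CartesianMonoidalCategory S]
  {V V' : IndexedMonoidalCategory.{v, u} S}

/-- Compatibility of a morphism with given indexed coproducts: isomorphisms `Φ (k_! E) ≅ k_! Φ E`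
under which `Φ` carries insertions to insertions. -/
structure Hom.PreservesCoproducts (Φ : Hom V V') (P : V.Coproducts) (P' : V'.Coproducts) where
  pushIso : ∀ {C D : S} (k : C ⟶ D), P.push k ⋙ Φ.app D ≅ Φ.app C ⋙ P'.push k
  carries_ins : ∀ {C D : S} (k : C ⟶ D) (E : V.Fib C),
    (Φ.app C).map (P.ins k E) ≫ (Φ.pullIso k).hom.app _ ≫ (V'.pull k).map ((pushIso k).hom.app E) =
      P'.ins k ((Φ.app C).obj E)

namespace Hom.PreservesCoproducts

variable {Φ : Hom V V'} {P : V.Coproducts} {P' : V'.Coproducts} (H : Φ.PreservesCoproducts P P')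

/-- The comparison map `Φ (k_! E) ⟶ k_! E'` obtained from a comparison map `Φ E ⟶ E'`. -/
noncomputable def pushCmpr {C D : S} (k : C ⟶ D) {E : V.Fib C} {E' : V'.Fib C}
    (c : (Φ.app C).obj E ⟶ E') : (Φ.app D).obj ((P.push k).obj E) ⟶ (P'.push k).obj E' :=
  (H.pushIso k).hom.app E ≫ (P'.push k).map c

instance isIso_pushCmpr {C D : S} (k : C ⟶ D) {E : V.Fib C} {E' : V'.Fib C}
    (c : (Φ.app C).obj E ⟶ E') [IsIso c] : IsIso (H.pushCmpr k c) := by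
  unfold pushCmpr; infer_instance

theorem carries_ins' {C D : S} (k : C ⟶ D) {E : V.Fib C} {E' : V'.Fib C}
    (c : (Φ.app C).obj E ⟶ E') :
    Carries (Φ.app C) c (Φ.pullCmpr k (H.pushCmpr k c)) (P.ins k E) (P'.ins k E') := by
  have h := H.carries_ins k E
  unfold Carries pullCmpr pushCmpr
  rw [Functor.map_comp, reassoc_of% h, ← P'.ins_naturality]

variable {R T U W Z : S}

/-- The comparison map `Φ (M ⊙ N) ⟶ M' ⊙ N'` obtained from comparison maps for `M` and `N`. -/
noncomputable def compCmpr {M : V.Fib (R ⊗ T)} {N : V.Fib (T ⊗ U)} {M' : V'.Fib (R ⊗ T)}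
    {N' : V'.Fib (T ⊗ U)} (c : (Φ.app _).obj M ⟶ M') (d : (Φ.app _).obj N ⟶ N') :
    (Φ.app _).obj (P.comp M N) ⟶ P'.comp M' N' :=
  H.pushCmpr (projectMiddle R T U) (Φ.pullCmpr (insertDiagonal R T U)
    (tensorComparison (Φ.app _) (Φ.pullCmpr (p₁ _ _) c) (Φ.pullCmpr (p₂ _ _) d)))

/-- The comparison map `Φ I ⟶ I`. -/
noncomputable def unitCmpr (R : S) : (Φ.app _).obj (P.unitObj R) ⟶ P'.unitObj R :=
  H.pushCmpr (lift (𝟙 R) (𝟙 R)) (Φ.pullCmpr (toUnit R) (η (Φ.app _)))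

/-- The comparison map `Φ ⟨M⟩ ⟶ ⟨M'⟩` obtained from a comparison map for `M`. -/
noncomputable def shCmpr {M : V.Fib (R ⊗ R)} {M' : V'.Fib (R ⊗ R)} (c : (Φ.app _).obj M ⟶ M') :
    (Φ.app _).obj (P.sh M) ⟶ P'.sh M' :=
  H.pushCmpr (toUnit R) (Φ.pullCmpr (lift (𝟙 R) (𝟙 R)) c)

section

variable {M : V.Fib (R ⊗ T)} {N : V.Fib (T ⊗ U)} {L : V.Fib (U ⊗ W)} {M' : V'.Fib (R ⊗ T)}
  {N' : V'.Fib (T ⊗ U)} {L' : V'.Fib (U ⊗ W)} (c : (Φ.app _).obj M ⟶ M')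
  (d : (Φ.app _).obj N ⟶ N') (e : (Φ.app _).obj L ⟶ L')

instance [IsIso c] [IsIso d] : IsIso (H.compCmpr c d) := H.isIso_pushCmpr _ _

theorem carries_genericBal :
    Carries (Φ.app _) (tensorComparison (Φ.app _) (Φ.pullCmpr _ c) (Φ.pullCmpr _ d))
      (Φ.pullCmpr _ (H.compCmpr c d)) (P.genericBal M N) (P'.genericBal M' N') :=
  ((Φ.carries_tensorComparison _ (Φ.carries_cmpr _ _ _ _ c) (Φ.carries_cmpr _ _ _ _ d)).inv).comp
    (H.carries_ins' _ _)

theorem carries_bal (r : Z ⟶ R) (t : Z ⟶ T) (u : Z ⟶ U) :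
    Carries (Φ.app _) (tensorComparison (Φ.app _) (Φ.pullCmpr _ c) (Φ.pullCmpr _ d))
      (Φ.pullCmpr _ (H.compCmpr c d)) (P.bal M N r t u) (P'.bal M' N' r t u) :=
  ((Φ.carries_tensorComparison _ (Φ.carries_cmpr _ _ _ _ c) (Φ.carries_cmpr _ _ _ _ d)).inv).comp
    ((Φ.carries_pull _ (H.carries_genericBal c d)).comp (Φ.carries_cmpr _ _ _ _ _))

theorem carries_balLeft (r : Z ⟶ R) (t : Z ⟶ T) (u : Z ⟶ U) (w : Z ⟶ W) :
    Carries (Φ.app _) (tensorComparison (Φ.app _) (tensorComparison (Φ.app _) (Φ.pullCmpr _ c)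
      (Φ.pullCmpr _ d)) (Φ.pullCmpr _ e)) (Φ.pullCmpr _ (H.compCmpr (H.compCmpr c d) e))
      (P.balLeft M N L r t u w) (P'.balLeft M' N' L' r t u w) :=
  ((H.carries_bal c d r t u).whiskerRight _).comp (H.carries_bal _ e r u w)

theorem carries_balRight (r : Z ⟶ R) (t : Z ⟶ T) (u : Z ⟶ U) (w : Z ⟶ W) :
    Carries (Φ.app _) (tensorComparison (Φ.app _) (Φ.pullCmpr _ c) (tensorComparison (Φ.app _)
      (Φ.pullCmpr _ d) (Φ.pullCmpr _ e))) (Φ.pullCmpr _ (H.compCmpr c (H.compCmpr d e)))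
      (P.balRight M N L r t u w) (P'.balRight M' N' L' r t u w) :=
  ((H.carries_bal d e t u w).whiskerLeft _).comp (H.carries_bal c _ r t w)

/-- The map that `Φ` carries the associativity map to has the property that characterizes the
associativity map in the target. -/
theorem carries_assocHom [IsIso c] [IsIso d] [IsIso e] :
    Carries (Φ.app _) (H.compCmpr (H.compCmpr c d) e) (H.compCmpr c (H.compCmpr d e))
      (P.assocHom M N L) (P'.assocHom M' N' L') := by
  obtain ⟨f, hf⟩ := Φ.exists_carries (H.compCmpr (H.compCmpr c d) e)
    (H.compCmpr c (H.compCmpr d e)) (P.assocHom M N L)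
  obtain rfl : f = P'.assocHom M' N' L' := by
    refine P'.comp_comp_hom_ext fun r t u w => ?_
    have h₁ := (H.carries_balLeft c d e r t u w).comp (Φ.carries_pull _ hf)
    have h₂ := (Carries.associator (F := Φ.app _) _ _ _).comp (H.carries_balRight c d e r t u w)
    rw [Coproducts.balLeft_comp_assocHom] at h₁ ⊢
    exact h₁.unique h₂
  exact hf

theorem carries_point (r : Z ⟶ R) :
    Carries (Φ.app _) (η (Φ.app _)) (Φ.pullCmpr _ (H.unitCmpr R)) (P.point r) (P'.point r) :=
  (Φ.carries_ε r).comp ((Φ.carries_pull _ ((Φ.carries_ε _).comp (H.carries_ins' _ _))).comp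
    (Φ.carries_cmpr _ _ _ _ _))

theorem carries_lunitInv [IsIso c] :
    Carries (Φ.app _) c (H.compCmpr (H.unitCmpr R) c) (P.lunitInv M) (P'.lunitInv M') := by
  obtain ⟨f, hf⟩ := Φ.exists_carries c (H.compCmpr (H.unitCmpr R) c) (P.lunitInv M)
  obtain rfl : f = P'.lunitInv M' := by
    refine hom_ext_ev fun r t => ?_
    have h₁ := Φ.carries_pull (lift r t) hf
    rw [Coproducts.map_lunitInv] at h₁ ⊢
    exact h₁.unique ((Carries.leftUnitor_inv _).comp
      (((H.carries_point r).whiskerRight _).comp (H.carries_bal (H.unitCmpr R) c r r t)))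
  exact hf

theorem carries_runitInv [IsIso c] :
    Carries (Φ.app _) c (H.compCmpr c (H.unitCmpr T)) (P.runitInv M) (P'.runitInv M') := by
  obtain ⟨f, hf⟩ := Φ.exists_carries c (H.compCmpr c (H.unitCmpr T)) (P.runitInv M)
  obtain rfl : f = P'.runitInv M' := by
    refine hom_ext_ev fun r t => ?_
    have h₁ := Φ.carries_pull (lift r t) hf
    rw [Coproducts.map_runitInv] at h₁ ⊢
    exact h₁.unique ((Carries.rightUnitor_inv _).comp
      (((H.carries_point t).whiskerLeft _).comp (H.carries_bal c (H.unitCmpr T) r t t)))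
  exact hf

end

section

variable {M : V.Fib (R ⊗ T)} {N : V.Fib (T ⊗ R)} {M' : V'.Fib (R ⊗ T)}
  {N' : V'.Fib (T ⊗ R)} (c : (Φ.app _).obj M ⟶ M') (d : (Φ.app _).obj N ⟶ N')

theorem carries_tr {M : V.Fib (R ⊗ R)} {M' : V'.Fib (R ⊗ R)} (c : (Φ.app _).obj M ⟶ M')
    (r : Z ⟶ R) :
    Carries (Φ.app _) (Φ.pullCmpr _ c) (Φ.pullCmpr _ (H.shCmpr c)) (P.tr M r) (P'.tr M' r) :=
  ((Φ.carries_cmpr _ _ _ _ c).inv).comp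
    ((Φ.carries_pull _ (H.carries_ins' _ _)).comp (Φ.carries_cmpr _ _ _ _ _))

instance {M : V.Fib (R ⊗ R)} {M' : V'.Fib (R ⊗ R)} (c : (Φ.app _).obj M ⟶ M') [IsIso c] :
    IsIso (H.shCmpr c) := H.isIso_pushCmpr _ _

theorem carries_balTr (r : Z ⟶ R) (t : Z ⟶ T) :
    Carries (Φ.app _) (tensorComparison (Φ.app _) (Φ.pullCmpr _ c) (Φ.pullCmpr _ d))
      (Φ.pullCmpr _ (H.shCmpr (H.compCmpr c d))) (P.balTr M N r t) (P'.balTr M' N' r t) :=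
  (H.carries_bal c d r t r).comp (H.carries_tr _ r)

theorem carries_cyc [∀ Z, SymmetricCategory (V.Fib Z)] [∀ Z, SymmetricCategory (V'.Fib Z)]
    (hV : Coproducts.PullBraided V) (hV' : Coproducts.PullBraided V')
    (hΦ : ∀ (Z : S) (X Y : V.Fib Z),
      μ (Φ.app Z) X Y ≫ (Φ.app Z).map (β_ X Y).hom = (β_ _ _).hom ≫ μ (Φ.app Z) Y X)
    [IsIso c] [IsIso d] :
    Carries (Φ.app _) (H.shCmpr (H.compCmpr c d)) (H.shCmpr (H.compCmpr d c))
      (P.cyc M N) (P'.cyc M' N') := by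
  obtain ⟨f, hf⟩ := Φ.exists_carries (H.shCmpr (H.compCmpr c d)) (H.shCmpr (H.compCmpr d c))
    (P.cyc M N)
  obtain rfl : f = P'.cyc M' N' := by
    refine P'.sh_comp_hom_ext fun r t => ?_
    have h₁ := (H.carries_balTr c d r t).comp (Φ.carries_pull _ hf)
    rw [P.balTr_comp_cyc hV] at h₁
    rw [P'.balTr_comp_cyc hV']
    exact h₁.unique ((Carries.braiding (hΦ _) _ _).comp (H.carries_balTr d c t r))
  exact hf

end

end Hom.PreservesCoproducts

end

end IndexedMonoidalCategory

/-! ### Squares preserving universal arrows -/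

section PreservesUniversalArrows

universe v₁ u₁ v₂ u₂ v₃ u₃ v₄ u₄ v₅ u₅ v₆ u₆

variable {C : Type u₁} [Category.{v₁} C] {D : Type u₂} [Category.{v₂} D]
  {C' : Type u₃} [Category.{v₃} C'] {D' : Type u₄} [Category.{v₄} D']
  {C'' : Type u₅} [Category.{v₅} C''] {D'' : Type u₆} [Category.{v₆} D'']
  {R : D ⥤ C} {R' : D' ⥤ C'} {R'' : D'' ⥤ C''} {G : C ⥤ C'} {H : D ⥤ D'} {G' : C' ⥤ C''}
  {H' : D' ⥤ D''}

/-- A square of functors filled by `β : R ⋙ G ⟶ H ⋙ R'` preserves universal arrows if `G` takes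
universal arrows to `R` to universal arrows to `R'`.  When `R` and `R'` have left adjoints, this
says that the mate of `β` is invertible. -/
def PreservesUniversalArrows (β : R ⋙ G ⟶ H ⋙ R') : Prop :=
  ∀ ⦃X : C⦄ ⦃Y : D⦄ (e : X ⟶ R.obj Y), IsUniversalArrow R e →
    IsUniversalArrow R' (Y := H.obj Y) (G.map e ≫ β.app Y)

theorem preservesUniversalArrows_of_isIso_mate {L : C ⥤ D} {L' : C' ⥤ D'} (adj : L ⊣ R)
    (adj' : L' ⊣ R') (β : R ⋙ G ⟶ H ⋙ R') (α : ∀ X, L'.obj (G.obj X) ⟶ H.obj (L.obj X))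
    (hα : ∀ X, G.map (adj.unit.app X) ≫ β.app (L.obj X) =
      adj'.unit.app (G.obj X) ≫ R'.map (α X)) (hα' : ∀ X, IsIso (α X)) :
    PreservesUniversalArrows β := by
  intro X Y e he
  obtain ⟨f, rfl⟩ := (isUniversalArrow_unit adj X).exists_fac e
  have := (isUniversalArrow_unit adj X).isIso_of_fac he f rfl
  have hn := β.naturality f
  dsimp only [Functor.comp_map] at hn
  rw [Functor.map_comp, Category.assoc, hn, reassoc_of% hα X, ← Functor.map_comp]
  exact (isUniversalArrow_unit adj' _).comp_map_iso _

theorem PreservesUniversalArrows.isIso_mate {β : R ⋙ G ⟶ H ⋙ R'}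
    (hβ : PreservesUniversalArrows β) {L : C ⥤ D} {L' : C' ⥤ D'} (adj : L ⊣ R)
    (adj' : L' ⊣ R') (X : C) (α : L'.obj (G.obj X) ⟶ H.obj (L.obj X))
    (hα : G.map (adj.unit.app X) ≫ β.app (L.obj X) = adj'.unit.app (G.obj X) ≫ R'.map α) :
    IsIso α :=
  (isUniversalArrow_unit adj' _).isIso_of_fac (hβ _ (isUniversalArrow_unit adj X)) α hα.symm

theorem unit_app_comp_map_eq {L : C ⥤ D} (adj : L ⊣ R) {X X' : C} {Y : D} (f : X ⟶ X')
    (g : X' ⟶ R.obj Y) :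
    adj.unit.app X ≫ R.map (L.map f ≫ L.map g ≫ adj.counit.app Y) = f ≫ g := by
  simp

theorem comp_inv_eq_of_comp_hom_eq {X Y Z W Y' : C} {i : Z ≅ Y} {a : X ≅ W}
    {b : W ≅ Y'} {g : Y' ⟶ Y} {f : X ⟶ Z} (h : f ≫ i.hom = (a.hom ≫ b.hom) ≫ g) :
    g ≫ i.inv = b.inv ≫ a.inv ≫ f := by
  rw [Iso.comp_inv_eq, Category.assoc, Category.assoc, h]
  simp

theorem comp_inv_comp_inv_eq {X Y W Z : C} {f : X ⟶ Y} {a : Y ≅ W} {b : W ≅ Z} {g : X ⟶ Z}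
    (h : f ≫ a.hom ≫ b.hom = g) : g ≫ b.inv ≫ a.inv = f := by
  simp [← h]

end PreservesUniversalArrows

/-! ### Evaluation of an indexed monoidal derivator at a small category -/

namespace Prederivator

variable {D E F : Prederivator.{w, v, u}}

/-- The functor `D(A) ⥤ E(A)` underlying a morphism `D ⟶ E`. -/
abbrev functorAt (φ : D ⟶ E) (A : Cat.{w, w}) : D.diag A ⥤ E.diag A :=
  (φ.app (op A)).toFunctor

/-- The functor `D(B) ⥤ D(A)` given by restriction along `p : A ⟶ B`. -/
abbrev restr (D : Prederivator.{w, v, u}) {A B : Cat.{w, w}} (p : A ⟶ B) : D.diag B ⥤ D.diag A :=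
  (D.pull p).toFunctor

/-- The natural isomorphism underlying an invertible modification. -/
def isoAt {φ ψ : D ⟶ E} (Γ : φ ≅ ψ) (A : Cat.{w, w}) : functorAt φ A ≅ functorAt ψ A where
  hom := (Γ.hom.as.app (op A)).toNatTrans
  inv := (Γ.inv.as.app (op A)).toNatTrans
  hom_inv_id := congr(($(Γ.hom_inv_id).as.app (op A)).toNatTrans)
  inv_hom_id := congr(($(Γ.inv_hom_id).as.app (op A)).toNatTrans)

theorem isIso_app {φ ψ : D ⟶ E} (Γ : φ ⟶ ψ) [IsIso Γ] (A : Cat.{w, w}) (X : D.diag A) :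
    IsIso ((Γ.as.app (op A)).toNatTrans.app X) :=
  inferInstanceAs (IsIso ((isoAt (asIso Γ) A).hom.app X))

/-- The pseudonaturality isomorphism of a morphism of prederivators. -/
def restrIso (φ : D ⟶ E) {A B : Cat.{w, w}} (p : A ⟶ B) :
    D.restr p ⋙ functorAt φ A ≅ functorAt φ B ⋙ E.restr p :=
  Cat.Hom.toNatIso (φ.naturality p.op)

theorem modification_naturality_app {φ ψ : D ⟶ E} (Γ : φ ⟶ ψ) {A B : Cat.{w, w}} (p : A ⟶ B)
    (X : D.diag B) :
    (Γ.as.app (op A)).toNatTrans.app ((D.restr p).obj X) ≫ (restrIso ψ p).hom.app X =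
      (restrIso φ p).hom.app X ≫ (E.restr p).map ((Γ.as.app (op B)).toNatTrans.app X) :=
  congr($(Γ.as.naturality p.op).toNatTrans.app X)

theorem restrIso_comp_hom_app (φ : D ⟶ E) (ψ : E ⟶ F) {A B : Cat.{w, w}} (p : A ⟶ B)
    (X : D.diag B) :
    (restrIso (φ ≫ ψ) p).hom.app X =
      (functorAt ψ A).map ((restrIso φ p).hom.app X) ≫
        (restrIso ψ p).hom.app ((functorAt φ B).obj X) := by
  change 𝟙 _ ≫ (functorAt ψ A).map ((restrIso φ p).hom.app X) ≫ 𝟙 _ ≫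
    (restrIso ψ p).hom.app ((functorAt φ B).obj X) ≫ 𝟙 _ = _
  simp

/-- The adjunction `D(A) ⇄ E(A)` underlying an adjunction of morphisms. -/
def adjunctionAt {φ : D ⟶ E} {ψ : E ⟶ D} (adj : Bicategory.Adjunction φ ψ) (A : Cat.{w, w}) :
    Bicategory.Adjunction (φ.app (op A)) (ψ.app (op A)) where
  unit := adj.unit.as.app (op A)
  counit := adj.counit.as.app (op A)
  left_triangle := by
    have h := congr(($(adj.left_triangle)).as.app (op A))
    simp only [bicategoricalComp, Bicategory.leftZigzag] at h ⊢
    exact h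
  right_triangle := by
    have h := congr(($(adj.right_triangle)).as.app (op A))
    simp only [bicategoricalComp, Bicategory.rightZigzag] at h ⊢
    exact h

/-- The adjunction of functors underlying an adjunction of morphisms. -/
abbrev functorAdjunctionAt {φ : D ⟶ E} {ψ : E ⟶ D} (adj : Bicategory.Adjunction φ ψ)
    (A : Cat.{w, w}) : functorAt φ A ⊣ functorAt ψ A :=
  Adjunction.ofCat (adjunctionAt adj A)

theorem cat_mate_app {C C' K K' : Cat.{v, u}} {g : C ⟶ C'} {h : K ⟶ K'} {l₁ : C ⟶ K} {r₁ : K ⟶ C}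
    {l₂ : C' ⟶ K'} {r₂ : K' ⟶ C'} (adj₁ : Bicategory.Adjunction l₁ r₁)
    (adj₂ : Bicategory.Adjunction l₂ r₂) (β : r₁ ≫ g ⟶ h ≫ r₂) (X : C) :
    g.toFunctor.map ((Adjunction.ofCat adj₁).unit.app X) ≫ β.toNatTrans.app (l₁.toFunctor.obj X) =
      (Adjunction.ofCat adj₂).unit.app (g.toFunctor.obj X) ≫ r₂.toFunctor.map
        (((Bicategory.mateEquiv adj₁ adj₂).symm β).toNatTrans.app X) := by
  obtain ⟨α, rfl⟩ := (Bicategory.mateEquiv adj₁ adj₂).surjective β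
  rw [Equiv.symm_apply_apply, Bicategory.toNatTrans_mateEquiv]
  exact (unit_mateEquiv _ _ (α.toNatTrans : TwoSquare _ _ _ _) X)

/-- The unit of an adjunction of morphisms is a modification, that is, it is compatible with
restriction. -/
theorem unit_app_restr {φ : D ⟶ E} {ψ : E ⟶ D} (adj : Bicategory.Adjunction φ ψ)
    {A B : Cat.{w, w}} (p : A ⟶ B) (X : D.diag B) :
    (functorAdjunctionAt adj A).unit.app ((D.restr p).obj X) ≫
        (functorAt ψ A).map ((restrIso φ p).hom.app X) ≫
          (restrIso ψ p).hom.app ((functorAt φ B).obj X) =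
      (D.restr p).map ((functorAdjunctionAt adj B).unit.app X) := by
  have h := modification_naturality_app adj.unit p X
  rw [restrIso_comp_hom_app] at h
  refine h.trans ?_
  change (𝟙 _ ≫ 𝟙 _) ≫ _ = _
  rw [Category.id_comp]
  exact Category.id_comp _

end Prederivator

namespace IndexedMonoidalDerivator

variable {S : Type u'} [Category.{v'} S] (V : IndexedMonoidalDerivator.{w, v, u} S)

/-- The indexed monoidal category `R ↦ V^R(A)`. -/
noncomputable abbrev level (A : Cat.{w, w}) : IndexedMonoidalCategory.{v, u} S where
  Fib Z := (V.fib Z).diag A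
  cat Z := inferInstance
  mon Z := Monoidal.cat (op A)
  pull x := functorAt (V.pb x) A
  pullMon x := StrongMonoidal.app (op A)
  pullComp z x y h := (isoAt (V.functor.mapComp' x.op.toLoc z.op.toLoc y.op.toLoc
    (by subst h; rfl)) A).symm
  pullComp_isMonoidal z x y h := by
    subst h
    have h := (V.mapComp_monoidal x.op.toLoc z.op.toLoc).app (op A)
    rw [← Pseudofunctor.mapComp'_eq_mapComp] at h
    have : NatTrans.IsMonoidal (isoAt (V.functor.mapComp' x.op.toLoc z.op.toLoc (z ≫ x).op.toLoc
      rfl) A).hom := h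
    exact inferInstanceAs (NatTrans.IsMonoidal (isoAt (V.functor.mapComp' x.op.toLoc z.op.toLoc
      (z ≫ x).op.toLoc rfl) A).inv)
  pullComp_assoc w z x wz zx y h h' h₁ h₂ M := by
    have h := V.functor.whiskerLeft_mapComp'_inv_comp_mapComp'₀₁₃_inv x.op.toLoc z.op.toLoc
      w.op.toLoc zx.op.toLoc wz.op.toLoc y.op.toLoc (by subst h'; rfl) (by subst h; rfl)
      (by subst h₂; rfl)
    have h := congr((($h).as.app (op A)).toNatTrans.app M)
    exact (h.trans (Category.id_comp _)).symm
  pullId Z := isoAt (V.functor.mapId ⟨op Z⟩) A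

/-- Restriction along `p : A ⟶ B`, as a morphism of indexed monoidal categories. -/
noncomputable def restrictHom {A B : Cat.{w, w}} (p : A ⟶ B) :
    IndexedMonoidalCategory.Hom (V.level B) (V.level A) where
  app Z := (V.fib Z).restr p
  appMon Z := Monoidal.map p.op
  pullIso x := (restrIso (V.pb x) p).symm
  pullIso_isMonoidal x := by
    have : NatTrans.IsMonoidal (restrIso (V.pb x) p).hom := StrongMonoidal.naturality p.op
    exact inferInstanceAs (NatTrans.IsMonoidal (restrIso (V.pb x) p).inv)
  pullIso_comp z x y h M := by
    have h := modification_naturality_app (V.functor.mapComp' x.op.toLoc z.op.toLoc y.op.toLoc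
      (by subst h; rfl)).inv p M
    have h : (V.level A).cmpr z x y ‹_› _ ≫ (restrIso (V.pb y) p).hom.app M =
        (((V.level A).pull z).map ((restrIso (V.pb x) p).hom.app M) ≫
          (restrIso (V.pb z) p).hom.app _) ≫
          ((V.fib _).restr p).map ((V.level B).cmpr z x y ‹_› M) :=
      h.trans congr($(restrIso_comp_hom_app (V.pb x) (V.pb z) p M) ≫ _)
    exact comp_inv_eq_of_comp_hom_eq (i := (restrIso (V.pb y) p).app M)
      (a := ((V.level A).pull z).mapIso ((restrIso (V.pb x) p).app M))
      (b := (restrIso (V.pb z) p).app _) h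

section

variable [CartesianMonoidalCategory S] {V}

theorem IndexedHomotopyCoproducts.isBeckChevalley_level (P : V.IndexedHomotopyCoproducts)
    {A B C D : S} {f : A ⟶ B} {h : A ⟶ C} {g : B ⟶ D} {k : C ⟶ D}
    (sq : IsHomotopyPullback f h g k) (X : Cat.{w, w}) :
    (V.level X).IsBeckChevalley f h g k := by
  have := P.beckChevalley sq
  have h₁ := preservesUniversalArrows_of_isIso_mate (functorAdjunctionAt (P.adj k) X)
    (functorAdjunctionAt (P.adj f) X) (G := functorAt (V.pb h) X) (H := functorAt (V.pb g) X)
    ((V.pbSquare sq.w).hom.as.app (op X)).toNatTrans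
    (fun M => (((Bicategory.mateEquiv (P.adj k) (P.adj f)).symm
      (V.pbSquare sq.w).hom).as.app (op X)).toNatTrans.app M)
    (fun M => cat_mate_app (adjunctionAt (P.adj k) X) (adjunctionAt (P.adj f) X)
      ((V.pbSquare sq.w).hom.as.app (op X)) M) (hα' := fun M => isIso_app _ X M)
  intro y hy hy' E L e he
  have h₂ := h₁ e he
  unfold IndexedMonoidalDerivator.pbSquare at h₂
  rw [Pseudofunctor.isoMapOfCommSq_eq _ _ y.op.toLoc (by subst hy; rfl)] at h₂
  exact h₂

/-- The coproducts in the indexed monoidal category `R ↦ V^R(A)`. -/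
noncomputable abbrev IndexedHomotopyCoproducts.level (P : V.IndexedHomotopyCoproducts)
    (hP : P.PreservedByTensor) (A : Cat.{w, w}) : (V.level A).Coproducts where
  push k := functorAt (P.pf k) A
  ins k E := (functorAdjunctionAt (P.adj k) A).unit.app E
  ins_naturality k _ _ f := (functorAdjunctionAt (P.adj k) A).unit.naturality f
  universal k E := isUniversalArrow_unit (functorAdjunctionAt (P.adj k) A) E
  exchange f g := P.isBeckChevalley_level (.exchange f g) A
  projLeft k M E := by
    have := hP.left k M E
    refine (isUniversalArrow_unit (functorAdjunctionAt (P.adj k) A) _).of_isIso_fac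
      (P.projLeft k M E) ?_
    exact unit_app_comp_map_eq _ _ _
  projRight k M E := by
    have := hP.right k M E
    refine (isUniversalArrow_unit (functorAdjunctionAt (P.adj k) A) _).of_isIso_fac
      (P.projRight k M E) ?_
    exact unit_app_comp_map_eq _ _ _

/-- Restriction along `p : A ⟶ B` preserves indexed coproducts. -/
noncomputable def IndexedHomotopyCoproducts.restrict (P : V.IndexedHomotopyCoproducts)
    (hP : P.PreservedByTensor) {A B : Cat.{w, w}}
    (p : A ⟶ B) : (V.restrictHom p).PreservesCoproducts (P.level hP B) (P.level hP A) where
  pushIso k := (restrIso (P.pf k) p).symm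
  carries_ins k E := by
    have h := unit_app_restr (P.adj k) p E
    exact comp_inv_comp_inv_eq (a := (functorAt (V.pb k) A).mapIso ((restrIso (P.pf k) p).app E))
      (b := (restrIso (V.pb k) p).app _) h

end

end IndexedMonoidalDerivator

/-! ### Cocontinuity -/

namespace Prederivator

theorem isIso_mate_iff {C C' K K' : Cat.{v, u}} {g : C ⟶ C'} {h : K ⟶ K'} {l₁ : C ⟶ K}
    {r₁ : K ⟶ C} {l₂ : C' ⟶ K'} {r₂ : K' ⟶ C'} (adj₁ : Bicategory.Adjunction l₁ r₁)
    (adj₂ : Bicategory.Adjunction l₂ r₂) (β : r₁ ≫ g ⟶ h ≫ r₂) :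
    IsIso ((Bicategory.mateEquiv adj₁ adj₂).symm β) ↔
      PreservesUniversalArrows (R := r₁.toFunctor) (G := g.toFunctor) (H := h.toFunctor)
        (R' := r₂.toFunctor) β.toNatTrans := by
  constructor
  · intro hi
    exact preservesUniversalArrows_of_isIso_mate (Adjunction.ofCat adj₁) (Adjunction.ofCat adj₂)
      β.toNatTrans _ (cat_mate_app adj₁ adj₂ β)
      fun X => inferInstanceAs (IsIso ((Cat.Hom.toNatIso
        (asIso ((Bicategory.mateEquiv adj₁ adj₂).symm β))).hom.app X))
  · intro hβ
    have := fun X => hβ.isIso_mate (Adjunction.ofCat adj₁) (Adjunction.ofCat adj₂) X _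
      (cat_mate_app adj₁ adj₂ β X)
    have := NatIso.isIso_of_isIso_app ((Bicategory.mateEquiv adj₁ adj₂).symm β).toNatTrans
    exact inferInstanceAs (IsIso (Cat.Hom.isoMk
      (asIso ((Bicategory.mateEquiv adj₁ adj₂).symm β).toNatTrans)).hom)

variable {D E F D' E' : Prederivator.{w, v, u}}

/-- For morphisms of derivators, preservation of homotopy left Kan extensions amounts to
preservation of the arrows universal to the restriction functors. -/
theorem isCocontinuous_iff (hD : D.IsDerivator) (hE : E.IsDerivator) (φ : D ⟶ E) :
    IsCocontinuous φ ↔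
      ∀ {A B : Cat.{w, w}} (p : A ⟶ B), PreservesUniversalArrows (restrIso φ p).hom := by
  constructor
  · intro hφ A B p
    obtain ⟨L, ⟨adj⟩⟩ := hD.der3_left p
    obtain ⟨L', ⟨adj'⟩⟩ := hE.der3_left p
    exact (isIso_mate_iff adj adj' _).1 (hφ p adj adj')
  · intro hφ A B p L adj L' adj'
    exact (isIso_mate_iff adj adj' _).2 (hφ p)

theorem isCocontinuousLeft_iff (hD : D.IsDerivator) (hF : F.IsDerivator) (φ : D.prod E ⟶ F) :
    IsCocontinuousLeft φ ↔ ∀ {A B C : Cat.{w, w}} (p : A ⟶ B) (Y : E.diag C),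
      PreservesUniversalArrows (R := D.restr p) (G := (extLeft φ Y A).toFunctor)
        (H := (extLeft φ Y B).toFunctor) (R' := F.restr (prodHom p (𝟙 C)))
        (extLeftPull φ p Y).toNatTrans := by
  constructor
  · intro hφ A B C p Y
    obtain ⟨L, ⟨adj⟩⟩ := hD.der3_left p
    obtain ⟨L', ⟨adj'⟩⟩ := hF.der3_left (prodHom p (𝟙 C))
    exact (isIso_mate_iff adj adj' _).1 (hφ p Y adj adj')
  · intro hφ A B C p Y L adj L' adj'
    exact (isIso_mate_iff adj adj' _).2 (hφ p Y)

theorem isCocontinuousRight_iff (hE : E.IsDerivator) (hF : F.IsDerivator) (φ : D.prod E ⟶ F) :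
    IsCocontinuousRight φ ↔ ∀ {A B C : Cat.{w, w}} (p : A ⟶ B) (X : D.diag C),
      PreservesUniversalArrows (R := E.restr p) (G := (extRight φ X A).toFunctor)
        (H := (extRight φ X B).toFunctor) (R' := F.restr (prodHom (𝟙 C) p))
        (extRightPull φ p X).toNatTrans := by
  constructor
  · intro hφ A B C p X
    obtain ⟨L, ⟨adj⟩⟩ := hE.der3_left p
    obtain ⟨L', ⟨adj'⟩⟩ := hF.der3_left (prodHom (𝟙 C) p)
    exact (isIso_mate_iff adj adj' _).1 (hφ p X adj adj')
  · intro hφ A B C p X L adj L' adj'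
    exact (isIso_mate_iff adj adj' _).2 (hφ p X)

/-- Left adjoints are cocontinuous: both `φ p_!` and `p_! φ` are left adjoint to
`p^* ψ ≅ ψ p^*`. -/
theorem isCocontinuous_of_adjunction (hD : D.IsDerivator) (hE : E.IsDerivator) {φ : D ⟶ E}
    {ψ : E ⟶ D} (adj : Bicategory.Adjunction φ ψ) : IsCocontinuous φ := by
  refine (isCocontinuous_iff hD hE φ).2 fun {A B} p X Y e he => ?_
  refine (isUniversalArrow_unit (functorAdjunctionAt adj A) X).of_comp_map ?_
  have h := (he.trans (isUniversalArrow_unit (functorAdjunctionAt adj B) Y)).comp_natIso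
    (restrIso ψ p).symm
  refine h.congr ?_
  have h₁ := unit_app_restr adj p Y
  have h₂ := (functorAdjunctionAt adj A).unit.naturality e
  dsimp only [Functor.id_map, Functor.comp_map] at h₂
  rw [Functor.map_comp, ← reassoc_of% h₂, Category.assoc, ← h₁]
  simp

theorem IsCocontinuous.comp (hD : D.IsDerivator) (hE : E.IsDerivator) (hF : F.IsDerivator)
    {φ : D ⟶ E} {ψ : E ⟶ F} (hφ : IsCocontinuous φ) (hψ : IsCocontinuous ψ) :
    IsCocontinuous (φ ≫ ψ) := by
  refine (isCocontinuous_iff hD hF _).2 fun p X Y e he => ?_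
  have h := (isCocontinuous_iff hE hF ψ).1 hψ p _ ((isCocontinuous_iff hD hE φ).1 hφ p e he)
  rw [Functor.map_comp, Category.assoc] at h
  exact congr(_ ≫ $(restrIso_comp_hom_app φ ψ p Y)) ▸ h

/-- The arrow `(pr₁^* X, pr₂^* Y) ⟶ (p × 1)^* (pr₁^* X', pr₂^* Y)` induced by an arrow
`X ⟶ p^* X'`. -/
def extLeftArrow {A B C : Cat.{w, w}} (p : A ⟶ B) (Y : E.diag C) {X : D.diag A} {X' : D.diag B}
    (e : X ⟶ (D.restr p).obj X') :
    @Quiver.Hom ((D.prod E).diag (prodCat A C)) _ ((D.restr (pr₁ A C)).obj X,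
        (E.restr (pr₂ A C)).obj Y) (((D.prod E).restr (prodHom p (𝟙 C))).obj
          ((D.restr (pr₁ B C)).obj X', (E.restr (pr₂ B C)).obj Y)) :=
  Prod.mkHom ((D.restr (pr₁ A C)).map e ≫
    (D.pullSquare (pr₁ A C) p (prodHom p (𝟙 C)) (pr₁ B C) (𝟙 _)).toNatTrans.app X')
    ((E.mapComp (pr₂ B C).op (prodHom p (𝟙 C)).op).hom.toNatTrans.app Y)

/-- The arrow `(pr₁^* X, pr₂^* Y) ⟶ (1 × p)^* (pr₁^* X, pr₂^* Y')` induced by an arrow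
`Y ⟶ p^* Y'`. -/
def extRightArrow {A B C : Cat.{w, w}} (p : A ⟶ B) (X : D.diag C) {Y : E.diag A} {Y' : E.diag B}
    (e : Y ⟶ (E.restr p).obj Y') :
    @Quiver.Hom ((D.prod E).diag (prodCat C A)) _ ((D.restr (pr₁ C A)).obj X,
        (E.restr (pr₂ C A)).obj Y) (((D.prod E).restr (prodHom (𝟙 C) p)).obj
          ((D.restr (pr₁ C B)).obj X, (E.restr (pr₂ C B)).obj Y')) :=
  Prod.mkHom ((D.mapComp (pr₁ C B).op (prodHom (𝟙 C) p).op).hom.toNatTrans.app X)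
    ((E.restr (pr₂ C A)).map e ≫
      (E.pullSquare (pr₂ C A) p (prodHom (𝟙 C) p) (pr₂ C B) (𝟙 _)).toNatTrans.app Y')

theorem extLeft_map_comp (φ : D.prod E ⟶ F) {A B C : Cat.{w, w}} (p : A ⟶ B) (Y : E.diag C)
    {X : D.diag A} {X' : D.diag B} (e : X ⟶ (D.restr p).obj X') :
    (extLeft φ Y A).toFunctor.map e ≫ (extLeftPull φ p Y).toNatTrans.app X' =
      (functorAt φ (prodCat A C)).map (extLeftArrow p Y e) ≫
        (restrIso φ (prodHom p (𝟙 C))).hom.app _ := by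
  refine (Category.assoc _ _ _).symm.trans (congr($(?_) ≫ _))
  refine ((functorAt φ (prodCat A C)).map_comp _ _).symm.trans ?_
  exact congrArg _ (Prod.ext rfl (Category.id_comp _))

theorem extRight_map_comp (φ : D.prod E ⟶ F) {A B C : Cat.{w, w}} (p : A ⟶ B) (X : D.diag C)
    {Y : E.diag A} {Y' : E.diag B} (e : Y ⟶ (E.restr p).obj Y') :
    (extRight φ X A).toFunctor.map e ≫ (extRightPull φ p X).toNatTrans.app Y' =
      (functorAt φ (prodCat C A)).map (extRightArrow p X e) ≫
        (restrIso φ (prodHom (𝟙 C) p)).hom.app _ := by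
  refine (Category.assoc _ _ _).symm.trans (congr($(?_) ≫ _))
  refine ((functorAt φ (prodCat C A)).map_comp _ _).symm.trans ?_
  exact congrArg _ (Prod.ext (Category.id_comp _) rfl)

/-- Cocontinuity in the first variable, in terms of the functors underlying `φ` and its
pseudonaturality isomorphisms. -/
theorem isCocontinuousLeft_iff' (hD : D.IsDerivator) (hF : F.IsDerivator) (φ : D.prod E ⟶ F) :
    IsCocontinuousLeft φ ↔ ∀ {A B C : Cat.{w, w}} (p : A ⟶ B) (Y : E.diag C) (X : D.diag A)
      (X' : D.diag B) (e : X ⟶ (D.restr p).obj X'), IsUniversalArrow (D.restr p) e →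
      IsUniversalArrow (F.restr (prodHom p (𝟙 C))) ((functorAt φ (prodCat A C)).map
        (extLeftArrow p Y e) ≫ (restrIso φ (prodHom p (𝟙 C))).hom.app _) := by
  rw [isCocontinuousLeft_iff hD hF]
  exact ⟨fun h _ _ _ p Y X X' e he => (h p Y e he).congr (extLeft_map_comp φ p Y e),
    fun h _ _ _ p Y X X' e he => (h p Y X X' e he).congr (extLeft_map_comp φ p Y e).symm⟩

theorem isCocontinuousRight_iff' (hE : E.IsDerivator) (hF : F.IsDerivator) (φ : D.prod E ⟶ F) :
    IsCocontinuousRight φ ↔ ∀ {A B C : Cat.{w, w}} (p : A ⟶ B) (X : D.diag C) (Y : E.diag A)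
      (Y' : E.diag B) (e : Y ⟶ (E.restr p).obj Y'), IsUniversalArrow (E.restr p) e →
      IsUniversalArrow (F.restr (prodHom (𝟙 C) p)) ((functorAt φ (prodCat C A)).map
        (extRightArrow p X e) ≫ (restrIso φ (prodHom (𝟙 C) p)).hom.app _) := by
  rw [isCocontinuousRight_iff hE hF]
  exact ⟨fun h _ _ _ p X Y Y' e he => (h p X e he).congr (extRight_map_comp φ p X e),
    fun h _ _ _ p X Y Y' e he => (h p X Y Y' e he).congr (extRight_map_comp φ p X e).symm⟩

theorem map_comp_restrIso_comp (φ : D ⟶ E) (ψ : E ⟶ F) {A B : Cat.{w, w}} {p : A ⟶ B}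
    {X : D.diag A} {Y : D.diag B} (f : X ⟶ (D.restr p).obj Y) :
    (functorAt ψ A).map ((functorAt φ A).map f ≫ (restrIso φ p).hom.app Y) ≫
        (restrIso ψ p).hom.app ((functorAt φ B).obj Y) =
      (functorAt (φ ≫ ψ) A).map f ≫ (restrIso (φ ≫ ψ) p).hom.app Y := by
  rw [restrIso_comp_hom_app, Functor.map_comp, Category.assoc]
  rfl

theorem IsCocontinuousLeft.comp (hD : D.IsDerivator) (hF : F.IsDerivator) (hE' : E'.IsDerivator)
    {φ : D.prod E ⟶ F} {ψ : F ⟶ E'} (hφ : IsCocontinuousLeft φ) (hψ : IsCocontinuous ψ) :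
    IsCocontinuousLeft (φ ≫ ψ) :=
  (isCocontinuousLeft_iff' hD hE' _).2 fun p Y X X' e he =>
    ((isCocontinuous_iff hF hE' ψ).1 hψ _ _
      ((isCocontinuousLeft_iff' hD hF φ).1 hφ p Y X X' e he)).congr
        (map_comp_restrIso_comp φ ψ (extLeftArrow p Y e))

theorem IsCocontinuousRight.comp (hE : E.IsDerivator) (hF : F.IsDerivator) (hE' : E'.IsDerivator)
    {φ : D.prod E ⟶ F} {ψ : F ⟶ E'} (hφ : IsCocontinuousRight φ) (hψ : IsCocontinuous ψ) :
    IsCocontinuousRight (φ ≫ ψ) :=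
  (isCocontinuousRight_iff' hE hE' _).2 fun p X Y Y' e he =>
    ((isCocontinuous_iff hF hE' ψ).1 hψ _ _
      ((isCocontinuousRight_iff' hE hF φ).1 hφ p X Y Y' e he)).congr
        (map_comp_restrIso_comp φ ψ (extRightArrow p X e))

theorem map_mapComp_app (a : D ⟶ D') {A B C : Cat.{w, w}} (q : A ⟶ B) (s : B ⟶ C) (X : D.diag C) :
    (functorAt a A).map ((D.mapComp s.op q.op).hom.toNatTrans.app X) ≫
        (restrIso a q).hom.app ((D.restr s).obj X) ≫ (D'.restr q).map ((restrIso a s).hom.app X) =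
      (restrIso a (q ≫ s)).hom.app X ≫
        (D'.mapComp s.op q.op).hom.toNatTrans.app ((functorAt a C).obj X) := by
  have h := congr(($(a.naturality_comp s.op q.op)).toNatTrans.app X)
  have h : _ = _ ≫ 𝟙 _ ≫ _ ≫ 𝟙 _ ≫ _ ≫ 𝟙 _ := h
  simp only [Category.id_comp, Category.comp_id] at h
  exact h.symm

/-- A morphism of prederivators is compatible with the transformations `pullSquare`. -/
theorem map_pullSquare_app (a : D ⟶ D') {X A C B : Cat.{w, w}} (p : X ⟶ A) (r : A ⟶ B) (q : X ⟶ C)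
    (s : C ⟶ B) (α : p ≫ r ⟶ q ≫ s) (M : D.diag B) :
    (functorAt a X).map ((D.pullSquare p r q s α).toNatTrans.app M) ≫
        (restrIso a q).hom.app ((D.restr s).obj M) ≫ (D'.restr q).map ((restrIso a s).hom.app M) =
      (restrIso a p).hom.app ((D.restr r).obj M) ≫ (D'.restr p).map ((restrIso a r).hom.app M) ≫
        (D'.pullSquare p r q s α).toNatTrans.app ((functorAt a B).obj M) := by
  have h₁ := map_mapComp_app a q s M
  have h₂ := map_mapComp_app a p r M
  have h₃ : (functorAt a X).map ((D.map₂ (Bicategory.Opposite.op2 α)).toNatTrans.app M) ≫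
      (restrIso a (q ≫ s)).hom.app M = (restrIso a (p ≫ r)).hom.app M ≫
        (D'.map₂ (Bicategory.Opposite.op2 α)).toNatTrans.app ((functorAt a B).obj M) :=
    congr(($(a.naturality_naturality (Bicategory.Opposite.op2 α))).toNatTrans.app M)
  let i := (Cat.Hom.toNatIso (D.mapComp r.op p.op)).app M
  let i' := (Cat.Hom.toNatIso (D'.mapComp r.op p.op)).app ((functorAt a B).obj M)
  change (functorAt a X).map (i.inv ≫ (D.map₂ (Bicategory.Opposite.op2 α)).toNatTrans.app M ≫
    (D.mapComp s.op q.op).hom.toNatTrans.app M) ≫ _ = _ ≫ _ ≫ i'.inv ≫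
      (D'.map₂ (Bicategory.Opposite.op2 α)).toNatTrans.app ((functorAt a B).obj M) ≫
        (D'.mapComp s.op q.op).hom.toNatTrans.app _
  change (functorAt a X).map i.hom ≫ _ = _ ≫ i'.hom at h₂
  rw [← cancel_epi ((functorAt a X).map i.hom), reassoc_of% h₂]
  simp only [Functor.map_comp, Category.assoc]
  rw [h₁, reassoc_of% h₃]
  simp

/-- The pseudonaturality isomorphisms of `a` and `b`, as an isomorphism of external products. -/
def extIso (a : D ⟶ D') (b : E ⟶ E') (A C : Cat.{w, w}) (X : D.diag A) (Y : E.diag C) :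
    @CategoryTheory.Iso ((D'.prod E').diag (prodCat A C)) _
      ((functorAt (prodMap a b) (prodCat A C)).obj
        ((D.restr (pr₁ A C)).obj X, (E.restr (pr₂ A C)).obj Y))
      ((D'.restr (pr₁ A C)).obj ((functorAt a A).obj X),
        (E'.restr (pr₂ A C)).obj ((functorAt b C).obj Y)) :=
  Iso.prod ((restrIso a (pr₁ A C)).app X) ((restrIso b (pr₂ A C)).app Y)

theorem map_extLeftArrow (a : D ⟶ D') (b : E ⟶ E') {A B C : Cat.{w, w}} (p : A ⟶ B) (Y : E.diag C)
    {X : D.diag A} {X' : D.diag B} (e : X ⟶ (D.restr p).obj X') :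
    (extIso a b A C X Y).hom ≫
        extLeftArrow p ((functorAt b C).obj Y) ((functorAt a A).map e ≫ (restrIso a p).hom.app X') =
      ((functorAt (prodMap a b) (prodCat A C)).map (extLeftArrow p Y e) ≫
        (restrIso (prodMap a b) (prodHom p (𝟙 C))).hom.app _) ≫
          ((D'.prod E').restr (prodHom p (𝟙 C))).map (extIso a b B C X' Y).hom := by
  have ha := map_pullSquare_app a (pr₁ A C) p (prodHom p (𝟙 C)) (pr₁ B C) (𝟙 _) X'
  have ha' := (restrIso a (pr₁ A C)).hom.naturality e
  have hb := map_mapComp_app b (prodHom p (𝟙 C)) (pr₂ B C) Y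
  refine Prod.ext ?_ ?_
  · change (restrIso a (pr₁ A C)).hom.app X ≫ (D'.restr (pr₁ A C)).map _ ≫ _ =
      ((functorAt a (prodCat A C)).map ((D.restr (pr₁ A C)).map e ≫
        (D.pullSquare (pr₁ A C) p (prodHom p (𝟙 C)) (pr₁ B C) (𝟙 _)).toNatTrans.app X') ≫
        (restrIso a (prodHom p (𝟙 C))).hom.app _) ≫
        (D'.restr (prodHom p (𝟙 C))).map ((restrIso a (pr₁ B C)).hom.app X')
    dsimp only [Functor.comp_map] at ha'
    simp only [Functor.map_comp, Category.assoc]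
    rw [ha, reassoc_of% ha']
  · exact (hb.symm).trans (Category.assoc _ _ _).symm

theorem map_extRightArrow (a : D ⟶ D') (b : E ⟶ E') {A B C : Cat.{w, w}} (p : A ⟶ B) (X : D.diag C)
    {Y : E.diag A} {Y' : E.diag B} (e : Y ⟶ (E.restr p).obj Y') :
    (extIso a b C A X Y).hom ≫
        extRightArrow p ((functorAt a C).obj X)
          ((functorAt b A).map e ≫ (restrIso b p).hom.app Y') =
      ((functorAt (prodMap a b) (prodCat C A)).map (extRightArrow p X e) ≫
        (restrIso (prodMap a b) (prodHom (𝟙 C) p)).hom.app _) ≫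
          ((D'.prod E').restr (prodHom (𝟙 C) p)).map (extIso a b C B X Y').hom := by
  have hb := map_pullSquare_app b (pr₂ C A) p (prodHom (𝟙 C) p) (pr₂ C B) (𝟙 _) Y'
  have hb' := (restrIso b (pr₂ C A)).hom.naturality e
  have ha := map_mapComp_app a (prodHom (𝟙 C) p) (pr₁ C B) X
  refine Prod.ext ?_ ?_
  · exact (ha.symm).trans (Category.assoc _ _ _).symm
  · change (restrIso b (pr₂ C A)).hom.app Y ≫ (E'.restr (pr₂ C A)).map _ ≫ _ =
      ((functorAt b (prodCat C A)).map ((E.restr (pr₂ C A)).map e ≫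
        (E.pullSquare (pr₂ C A) p (prodHom (𝟙 C) p) (pr₂ C B) (𝟙 _)).toNatTrans.app Y') ≫
        (restrIso b (prodHom (𝟙 C) p)).hom.app _) ≫
        (E'.restr (prodHom (𝟙 C) p)).map ((restrIso b (pr₂ C B)).hom.app Y')
    dsimp only [Functor.comp_map] at hb'
    simp only [Functor.map_comp, Category.assoc]
    rw [hb, reassoc_of% hb']

theorem isUniversalArrow_map_of_iso (φ : D ⟶ E) {A B : Cat.{w, w}} {p : A ⟶ B} {X X' : D.diag A}
    {Y Y' : D.diag B} {f : X ⟶ (D.restr p).obj Y} {f' : X' ⟶ (D.restr p).obj Y'} (i : X ≅ X')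
    (j : Y ≅ Y') (h : i.hom ≫ f' = f ≫ (D.restr p).map j.hom)
    (h' : IsUniversalArrow (E.restr p) ((functorAt φ A).map f' ≫ (restrIso φ p).hom.app Y')) :
    IsUniversalArrow (E.restr p) ((functorAt φ A).map f ≫ (restrIso φ p).hom.app Y) := by
  refine ((h'.iso_comp ((functorAt φ A).map i.hom)).comp_map_iso
    ((functorAt φ B).map j.inv)).congr ?_
  have hn := (restrIso φ p).hom.naturality j.inv
  dsimp only [Functor.comp_map] at hn
  rw [Category.assoc, Category.assoc, ← hn, ← Functor.map_comp_assoc, ← Category.assoc,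
    ← Functor.map_comp, Category.assoc, reassoc_of% h]
  simp

theorem IsCocontinuousLeft.prodMap_comp (hD : D.IsDerivator) (hD' : D'.IsDerivator)
    (hF : F.IsDerivator) {a : D ⟶ D'} (b : E ⟶ E') {t : D'.prod E' ⟶ F} (ha : IsCocontinuous a)
    (ht : IsCocontinuousLeft t) : IsCocontinuousLeft (prodMap a b ≫ t) :=
  (isCocontinuousLeft_iff' hD hF _).2 fun p Y X X' e he =>
    (isUniversalArrow_map_of_iso t (extIso a b _ _ X Y) (extIso a b _ _ X' Y)
      (map_extLeftArrow a b p Y e) ((isCocontinuousLeft_iff' hD' hF t).1 ht p _ _ _ _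
        ((isCocontinuous_iff hD hD' a).1 ha p e he))).congr
          (map_comp_restrIso_comp (prodMap a b) t (extLeftArrow p Y e))

theorem IsCocontinuousRight.prodMap_comp (hE : E.IsDerivator) (hE' : E'.IsDerivator)
    (hF : F.IsDerivator) (a : D ⟶ D') {b : E ⟶ E'} {t : D'.prod E' ⟶ F} (hb : IsCocontinuous b)
    (ht : IsCocontinuousRight t) : IsCocontinuousRight (prodMap a b ≫ t) :=
  (isCocontinuousRight_iff' hE hF _).2 fun p X Y Y' e he =>
    (isUniversalArrow_map_of_iso t (extIso a b _ _ X Y) (extIso a b _ _ X Y')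
      (map_extRightArrow a b p X e) ((isCocontinuousRight_iff' hE' hF t).1 ht p _ _ _ _
        ((isCocontinuous_iff hE hE' b).1 hb p e he))).congr
          (map_comp_restrIso_comp (prodMap a b) t (extRightArrow p X e))

end Prederivator

/-! ### The derivator bicategory of an indexed monoidal derivator -/

/-- The pseudonaturality isomorphism of a composite, relative to comparison maps. -/
theorem Prederivator.restrIso_comp_comp_of_eq {D E F : Prederivator.{w, v, u}} (φ : D ⟶ E)
    (ψ : E ⟶ F) {A B : Cat.{w, w}} {p : A ⟶ B} {X : D.diag B} {Y : E.diag A}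
    {f : (functorAt φ A).obj ((D.restr p).obj X) ⟶ Y}
    {c : (E.restr p).obj ((functorAt φ B).obj X) ⟶ Y}
    {d : (F.restr p).obj ((functorAt ψ B).obj ((functorAt φ B).obj X)) ⟶ (functorAt ψ A).obj Y}
    (hf : (restrIso φ p).hom.app X ≫ c = f)
    (hd : (restrIso ψ p).hom.app ((functorAt φ B).obj X) ≫ d = (functorAt ψ A).map c) :
    (restrIso (φ ≫ ψ) p).hom.app X ≫ d = (functorAt ψ A).map f := by
  subst hf
  rw [restrIso_comp_hom_app, Functor.map_comp, ← hd]
  exact Category.assoc _ _ _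

theorem Prederivator.restrIso_comp_comp_eq_id {D E F : Prederivator.{w, v, u}} (φ : D ⟶ E)
    (ψ : E ⟶ F) {A B : Cat.{w, w}} {p : A ⟶ B} {X : D.diag B}
    {c : (E.restr p).obj ((functorAt φ B).obj X) ⟶ (functorAt φ A).obj ((D.restr p).obj X)}
    {d : (F.restr p).obj ((functorAt ψ B).obj ((functorAt φ B).obj X)) ⟶
      (functorAt ψ A).obj ((functorAt φ A).obj ((D.restr p).obj X))}
    (hf : (restrIso φ p).hom.app X ≫ c = 𝟙 _)
    (hd : (restrIso ψ p).hom.app ((functorAt φ B).obj X) ≫ d = (functorAt ψ A).map c) :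
    (restrIso (φ ≫ ψ) p).hom.app X ≫ d = 𝟙 _ :=
  (restrIso_comp_comp_of_eq φ ψ hf hd).trans ((functorAt ψ A).map_id _)

theorem Prederivator.restrIso_id_comp_id (D : Prederivator.{w, v, u}) {A B : Cat.{w, w}} (p : A ⟶ B)
    (X : D.diag B) :
    (restrIso (𝟙 D) p).hom.app X ≫ 𝟙 ((D.restr p).obj X) = 𝟙 ((D.restr p).obj X) :=
  (Category.comp_id _).trans (Category.id_comp _)

theorem Prederivator.restrIso_prodMap_comp_mkHom {D D' E E' : Prederivator.{w, v, u}} (φ : D ⟶ D')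
    (ψ : E ⟶ E') {A B : Cat.{w, w}} {p : A ⟶ B} {X : D.diag B} {Y : E.diag B}
    {c : (D'.restr p).obj ((functorAt φ B).obj X) ⟶ (functorAt φ A).obj ((D.restr p).obj X)}
    {d : (E'.restr p).obj ((functorAt ψ B).obj Y) ⟶ (functorAt ψ A).obj ((E.restr p).obj Y)}
    (hc : (restrIso φ p).hom.app X ≫ c = 𝟙 _) (hd : (restrIso ψ p).hom.app Y ≫ d = 𝟙 _) :
    (restrIso (prodMap φ ψ) p).hom.app (X, Y) ≫ Prod.mkHom c d = 𝟙 _ :=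
  Prod.ext hc hd

theorem Prederivator.restrIso_pair_comp_mkHom {D E E' : Prederivator.{w, v, u}} (φ : D ⟶ E)
    (ψ : D ⟶ E') {A B : Cat.{w, w}} {p : A ⟶ B} {X : D.diag B}
    {c : (E.restr p).obj ((functorAt φ B).obj X) ⟶ (functorAt φ A).obj ((D.restr p).obj X)}
    {d : (E'.restr p).obj ((functorAt ψ B).obj X) ⟶ (functorAt ψ A).obj ((D.restr p).obj X)}
    (hc : (restrIso φ p).hom.app X ≫ c = 𝟙 _) (hd : (restrIso ψ p).hom.app X ≫ d = 𝟙 _) :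
    (restrIso (pair φ ψ) p).hom.app X ≫ Prod.mkHom c d = 𝟙 _ :=
  Prod.ext hc hd

theorem Prederivator.restrIso_prodAssoc {D E F : Prederivator.{w, v, u}} {A B : Cat.{w, w}}
    (p : A ⟶ B) (X : D.diag B) (Y : E.diag B) (Z : F.diag B) :
    (restrIso (prodAssoc D E F) p).hom.app ((X, Y), Z) ≫
      Prod.mkHom (𝟙 ((D.restr p).obj X)) (Prod.mkHom (𝟙 ((E.restr p).obj Y))
        (𝟙 ((F.restr p).obj Z))) = 𝟙 _ :=
  restrIso_pair_comp_mkHom _ _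
    (restrIso_comp_comp_eq_id (fst (D.prod E) F) (fst D E) (p := p) (X := ((X, Y), Z))
      (c := 𝟙 _) (d := 𝟙 _) (Category.comp_id _) (Category.comp_id _))
    (restrIso_pair_comp_mkHom _ _
      (restrIso_comp_comp_eq_id (fst (D.prod E) F) (snd D E) (p := p) (X := ((X, Y), Z))
        (c := 𝟙 _) (d := 𝟙 _) (Category.comp_id _) (Category.comp_id _))
      (Category.comp_id _))

/-- A family of isomorphisms over each small category, natural and compatible with restriction,
as an invertible modification.  Compatibility is stated relative to comparison maps which are
inverse to the pseudonaturality isomorphisms; in this form it is a consequence of the fact that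
restriction is a morphism of indexed monoidal categories. -/
noncomputable def Prederivator.isoOfComparison {D E : Prederivator.{w, v, u}} {φ ψ : D ⟶ E}
    (a : ∀ (A : Cat.{w, w}) (X : D.diag A), (functorAt φ A).obj X ⟶ (functorAt ψ A).obj X)
    (ha : ∀ A X, IsIso (a A X))
    (naturality : ∀ (A : Cat.{w, w}) {X Y : D.diag A} (f : X ⟶ Y),
      (functorAt φ A).map f ≫ a A Y = a A X ≫ (functorAt ψ A).map f)
    (compat : ∀ {A B : Cat.{w, w}} (p : A ⟶ B) (X : D.diag B),
      ∃ (c : (E.restr p).obj ((functorAt φ B).obj X) ⟶ (functorAt φ A).obj ((D.restr p).obj X))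
        (d : (E.restr p).obj ((functorAt ψ B).obj X) ⟶ (functorAt ψ A).obj ((D.restr p).obj X)),
        (restrIso φ p).hom.app X ≫ c = 𝟙 _ ∧ (restrIso ψ p).hom.app X ≫ d = 𝟙 _ ∧
          Carries (E.restr p) c d (a B X) (a A ((D.restr p).obj X))) : φ ≅ ψ :=
  Pseudofunctor.StrongTrans.isoMk
    (fun A => Cat.Hom.isoMk (NatIso.ofComponents (fun X => @asIso _ _ _ _ (a A.unop X) (ha _ X))
      (fun f => naturality A.unop f)))
    (fun {B A} p => Cat.Hom₂.ext <| NatTrans.ext <| funext fun X => by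
      obtain ⟨c, d, hc, hd, h⟩ := compat p.unop X
      change a A.unop _ ≫ (restrIso ψ p.unop).hom.app X =
        (restrIso φ p.unop).hom.app X ≫ (E.restr p.unop).map (a B.unop X)
      unfold Carries at h
      have hc' : c = inv ((restrIso φ p.unop).hom.app X) := IsIso.eq_inv_of_hom_inv_id hc
      have hd' : d = inv ((restrIso ψ p.unop).hom.app X) := IsIso.eq_inv_of_hom_inv_id hd
      subst hc' hd'
      rw [← IsIso.eq_comp_inv, Category.assoc, h]
      simp)

namespace IndexedMonoidalDerivator

namespace IndexedHomotopyCoproducts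

variable {S : Type u'} [Category.{v'} S] [CartesianMonoidalCategory S]
  {V : IndexedMonoidalDerivator.{w, v, u} S} (P : V.IndexedHomotopyCoproducts)
  (hP : P.PreservedByTensor)

/-- The objects, homs, composition and units of the derivator bicategory. -/
abbrev bicategoryData : DerivatorBicategoryData.{w, v, u, u'} where
  Obj := S
  hom := fun R T => V.fib (R ⊗ T)
  comp := fun R T U =>
    V.ext (R ⊗ T) (T ⊗ U) ≫ V.pb (insertDiagonal R T U) ≫ P.pf (projectMiddle R T U)
  unit := fun R =>
    unit (V.fib (𝟙_ S)) ≫ V.pb (toUnit R) ≫ P.pf (lift (𝟙 R) (𝟙 R))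

/-- The underlying morphisms of the shadow. -/
abbrev shadowMor (R : S) : V.fib (R ⊗ R) ⟶ V.fib (𝟙_ S) :=
  V.pb (lift (𝟙 R) (𝟙 R)) ≫ P.pf (toUnit R)

section Naturality

variable {A B : Cat.{w, w}} (p : A ⟶ B)

theorem restrIso_pb_pullCmpr {S : Type u'} [Category.{v'} S]
    {V : IndexedMonoidalDerivator.{w, v, u} S} {R T : S} (f : R ⟶ T) {M : (V.fib T).diag B}
    {M' : (V.fib T).diag A} (c : ((V.fib T).restr p).obj M ⟶ M') :
    (restrIso (V.pb f) p).hom.app M ≫ (V.restrictHom p).pullCmpr f c =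
      (functorAt (V.pb f) A).map c :=
  Iso.hom_inv_id_assoc ((restrIso (V.pb f) p).app M) _

theorem restrIso_pf_pushCmpr {R T : S} (f : R ⟶ T) {M : (V.fib R).diag B} {M' : (V.fib R).diag A}
    (c : ((V.fib R).restr p).obj M ⟶ M') :
    (restrIso (P.pf f) p).hom.app M ≫ (P.restrict hP p).pushCmpr f c =
      (functorAt (P.pf f) A).map c :=
  Iso.hom_inv_id_assoc ((restrIso (P.pf f) p).app M) _

theorem restrIso_pb_pf_comp {R T U : S} (f : R ⟶ T) (g : R ⟶ U) {M : (V.fib T).diag B}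
    {M' : (V.fib T).diag A} (c : ((V.fib T).restr p).obj M ⟶ M') :
    (restrIso (V.pb f ≫ P.pf g) p).hom.app M ≫
        (P.restrict hP p).pushCmpr g ((V.restrictHom p).pullCmpr f c) =
      (functorAt (V.pb f ≫ P.pf g) A).map c :=
  restrIso_comp_comp_of_eq (V.pb f) (P.pf g) (restrIso_pb_pullCmpr p f c)
    (P.restrIso_pf_pushCmpr hP p g _)

/-- The pseudonaturality isomorphism of the composition morphism is inverse to the comparison map
`compCmpr` of restriction along `p`, relative to further comparison maps `c` and `d`. -/
theorem restrIso_comp_compCmpr {R T U : S} {M : (V.fib (R ⊗ T)).diag B}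
    {N : (V.fib (T ⊗ U)).diag B} {M' : (V.fib (R ⊗ T)).diag A} {N' : (V.fib (T ⊗ U)).diag A}
    (c : ((V.fib (R ⊗ T)).restr p).obj M ⟶ M') (d : ((V.fib (T ⊗ U)).restr p).obj N ⟶ N') :
    (restrIso (P.bicategoryData.comp R T U) p).hom.app (M, N) ≫
        (P.restrict hP p).compCmpr c d = (P.level hP A).compMap c d :=
  restrIso_comp_comp_of_eq (V.ext (R ⊗ T) (T ⊗ U)) _
    (restrIso_comp_comp_of_eq (prodMap (V.pb (CartesianMonoidalCategory.fst (R ⊗ T) (T ⊗ U)))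
        (V.pb (CartesianMonoidalCategory.snd (R ⊗ T) (T ⊗ U)))) (tensor _) (X := (M, N))
      (Y := ((functorAt (V.pb (CartesianMonoidalCategory.fst (R ⊗ T) (T ⊗ U))) A).obj M',
        (functorAt (V.pb (CartesianMonoidalCategory.snd (R ⊗ T) (T ⊗ U))) A).obj N'))
      (c := Prod.mkHom ((V.restrictHom p).pullCmpr _ c) ((V.restrictHom p).pullCmpr _ d))
      (f := Prod.mkHom ((functorAt (V.pb _) A).map c) ((functorAt (V.pb _) A).map d))
      (Prod.ext (restrIso_pb_pullCmpr p _ c) (restrIso_pb_pullCmpr p _ d))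
      (μ_comp_tensorComparison (F := (V.fib _).restr p) _ _))
    (P.restrIso_pb_pf_comp hP p _ _ _)

theorem restrIso_unit_unitCmpr (R : S) :
    (restrIso (P.bicategoryData.unit R) p).hom.app Point.star ≫
      (P.restrict hP p).unitCmpr R = 𝟙 _ :=
  (restrIso_comp_comp_of_eq (unit (V.fib (𝟙_ S))) _ (X := Point.star) (f := 𝟙 _)
    (Functor.Monoidal.ε_η ((V.fib (𝟙_ S)).restr p))
    (P.restrIso_pb_pf_comp hP p _ _ _)).trans
      ((functorAt (V.pb (toUnit R) ≫ P.pf (lift (𝟙 R) (𝟙 R))) A).map_id _)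

theorem restrIso_shadowMor_shCmpr {R : S} {M : (V.fib (R ⊗ R)).diag B}
    {M' : (V.fib (R ⊗ R)).diag A} (c : ((V.fib (R ⊗ R)).restr p).obj M ⟶ M') :
    (restrIso (P.shadowMor R) p).hom.app M ≫ (P.restrict hP p).shCmpr c =
      (P.level hP A).shMap c :=
  P.restrIso_pb_pf_comp hP p _ _ c

end Naturality

section Comparison

variable {A B : Cat.{w, w}} (p : A ⟶ B) {R T U W : S}

theorem restrIso_comp_compCmpr_id (M : (V.fib (R ⊗ T)).diag B) (N : (V.fib (T ⊗ U)).diag B) :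
    (restrIso (P.bicategoryData.comp R T U) p).hom.app (M, N) ≫
      (P.restrict hP p).compCmpr (𝟙 _) (𝟙 _) = 𝟙 _ :=
  (P.restrIso_comp_compCmpr hP p _ _).trans ((P.level hP A).compMap_id _ _)

theorem restrIso_comp_left (M : (V.fib (R ⊗ T)).diag B) (N : (V.fib (T ⊗ U)).diag B)
    (L : (V.fib (U ⊗ W)).diag B) :
    (restrIso (prodMap (P.bicategoryData.comp R T U) (𝟙 (V.fib (U ⊗ W))) ≫
      P.bicategoryData.comp R U W) p).hom.app ((M, N), L) ≫
        (P.restrict hP p).compCmpr ((P.restrict hP p).compCmpr (𝟙 _) (𝟙 _)) (𝟙 _) = 𝟙 _ :=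
  restrIso_comp_comp_eq_id (prodMap _ _) _
    (restrIso_prodMap_comp_mkHom _ _ (P.restrIso_comp_compCmpr_id hP p M N)
      (restrIso_id_comp_id _ p _)) (P.restrIso_comp_compCmpr hP p _ _)

theorem restrIso_comp_right (M : (V.fib (R ⊗ T)).diag B) (N : (V.fib (T ⊗ U)).diag B)
    (L : (V.fib (U ⊗ W)).diag B) :
    (restrIso (prodAssoc _ _ _ ≫ prodMap (𝟙 (V.fib (R ⊗ T))) (P.bicategoryData.comp T U W) ≫
      P.bicategoryData.comp R T W) p).hom.app ((M, N), L) ≫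
        (P.restrict hP p).compCmpr (𝟙 _) ((P.restrict hP p).compCmpr (𝟙 _) (𝟙 _)) = 𝟙 _ :=
  restrIso_comp_comp_eq_id (prodAssoc _ _ _) _ (restrIso_prodAssoc p M N L)
    ((restrIso_comp_comp_eq_id (prodMap _ _) _
      (restrIso_prodMap_comp_mkHom _ _ (restrIso_id_comp_id _ p _)
        (P.restrIso_comp_compCmpr_id hP p N L)) (P.restrIso_comp_compCmpr hP p _ _)).trans
      ((functorAt (prodMap (𝟙 (V.fib (R ⊗ T))) (P.bicategoryData.comp T U W) ≫
        P.bicategoryData.comp R T W) A).map_id (((V.fib (R ⊗ T)).restr p).obj M,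
          (((V.fib (T ⊗ U)).restr p).obj N, ((V.fib (U ⊗ W)).restr p).obj L))).symm)

theorem restrIso_toOne_unit (D : Prederivator.{w, v, u}) (X : D.diag B) :
    (restrIso (D.toOne ≫ P.bicategoryData.unit R) p).hom.app X ≫
      (P.restrict hP p).unitCmpr R = 𝟙 _ :=
  restrIso_comp_comp_eq_id D.toOne _ (c := 𝟙 _) (Category.comp_id _)
    ((P.restrIso_unit_unitCmpr hP p R).trans (CategoryTheory.Functor.map_id _ _).symm)

theorem restrIso_unit_left (M : (V.fib (R ⊗ T)).diag B) :
    (restrIso (pair (toOne (V.fib (R ⊗ T)) ≫ P.bicategoryData.unit R) (𝟙 (V.fib (R ⊗ T))) ≫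
      P.bicategoryData.comp R R T) p).hom.app M ≫
        (P.restrict hP p).compCmpr ((P.restrict hP p).unitCmpr R) (𝟙 _) = 𝟙 _ :=
  restrIso_comp_comp_eq_id (pair _ _) _
    (restrIso_pair_comp_mkHom _ _ (P.restrIso_toOne_unit hP p _ M) (restrIso_id_comp_id _ p _))
    (P.restrIso_comp_compCmpr hP p _ _)

theorem restrIso_unit_right (M : (V.fib (R ⊗ T)).diag B) :
    (restrIso (pair (𝟙 (V.fib (R ⊗ T))) (toOne (V.fib (R ⊗ T)) ≫ P.bicategoryData.unit T) ≫
      P.bicategoryData.comp R T T) p).hom.app M ≫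
        (P.restrict hP p).compCmpr (𝟙 _) ((P.restrict hP p).unitCmpr T) = 𝟙 _ :=
  restrIso_comp_comp_eq_id (pair _ _) _
    (restrIso_pair_comp_mkHom _ _ (restrIso_id_comp_id _ p _) (P.restrIso_toOne_unit hP p _ M))
    (P.restrIso_comp_compCmpr hP p _ _)

theorem restrIso_comp_shadow (M : (V.fib (R ⊗ T)).diag B) (N : (V.fib (T ⊗ R)).diag B) :
    (restrIso (P.bicategoryData.comp R T R ≫ P.shadowMor R) p).hom.app (M, N) ≫
      (P.restrict hP p).shCmpr ((P.restrict hP p).compCmpr (𝟙 _) (𝟙 _)) = 𝟙 _ :=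
  restrIso_comp_comp_eq_id (P.bicategoryData.comp R T R) _ (P.restrIso_comp_compCmpr_id hP p M N)
    (P.restrIso_shadowMor_shCmpr hP p _)

theorem restrIso_swap_comp_shadow (M : (V.fib (R ⊗ T)).diag B) (N : (V.fib (T ⊗ R)).diag B) :
    (restrIso (prodSwap _ _ ≫ P.bicategoryData.comp T R T ≫ P.shadowMor T) p).hom.app (M, N) ≫
      (P.restrict hP p).shCmpr ((P.restrict hP p).compCmpr (𝟙 _) (𝟙 _)) = 𝟙 _ :=
  restrIso_comp_comp_eq_id (prodSwap (V.fib (R ⊗ T)) (V.fib (T ⊗ R))) _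
    (restrIso_pair_comp_mkHom (snd _ _) (fst _ _) (X := (M, N)) (c := 𝟙 _) (d := 𝟙 _)
      (Category.comp_id _) (Category.comp_id _))
    ((P.restrIso_comp_shadow hP p N M).trans
      ((functorAt (P.bicategoryData.comp T R T ≫ P.shadowMor T) A).map_id
        (((V.fib (T ⊗ R)).restr p).obj N, ((V.fib (R ⊗ T)).restr p).obj M)).symm)

end Comparison

open IndexedMonoidalCategory in
/-- The constraints of the derivator bicategory, given over each small category by those of the
indexed monoidal category `R ↦ V^R(A)`. -/
noncomputable def constraints : DerivatorBicategoryConstraints P.bicategoryData where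
  associator _ _ _ _ := isoOfComparison
    (fun A X => (P.level hP A).assocHom X.1.1 X.1.2 X.2)
    (fun A X => (P.level hP A).isIso_assocHom X.1.1 X.1.2 X.2)
    (fun A X _ f => (P.level hP A).assocHom_naturality X.1.1 X.1.2 X.2 f.1.1 f.1.2 f.2)
    (fun p X => ⟨_, _, P.restrIso_comp_left hP p X.1.1 X.1.2 X.2,
      P.restrIso_comp_right hP p X.1.1 X.1.2 X.2,
      (P.restrict hP p).carries_assocHom (𝟙 _) (𝟙 _) (𝟙 _)⟩)
  leftUnitor R T := (isoOfComparison (φ := 𝟙 (V.fib (R ⊗ T)))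
    (ψ := pair (toOne (V.fib (R ⊗ T)) ≫ P.bicategoryData.unit R) (𝟙 (V.fib (R ⊗ T))) ≫
      P.bicategoryData.comp R R T)
    (fun A X => (P.level hP A).lunitInv X) (fun A X => (P.level hP A).isIso_lunitInv X)
    (fun A _ _ f => ((P.level hP A).lunitInv_naturality f).trans
      congr(_ ≫ (P.level hP A).compMap
        $(((functorAt (P.bicategoryData.unit R) A).map_id Point.star).symm) f))
    (fun p X => ⟨𝟙 _, _, restrIso_id_comp_id _ p _, P.restrIso_unit_left hP p X,
      (P.restrict hP p).carries_lunitInv (𝟙 _)⟩)).symm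
  rightUnitor R T := (isoOfComparison (φ := 𝟙 (V.fib (R ⊗ T)))
    (ψ := pair (𝟙 (V.fib (R ⊗ T))) (toOne (V.fib (R ⊗ T)) ≫ P.bicategoryData.unit T) ≫
      P.bicategoryData.comp R T T)
    (fun A X => (P.level hP A).runitInv X) (fun A X => (P.level hP A).isIso_runitInv X)
    (fun A _ _ f => ((P.level hP A).runitInv_naturality f).trans
      congr(_ ≫ (P.level hP A).compMap f
        $(((functorAt (P.bicategoryData.unit T) A).map_id Point.star).symm)))
    (fun p X => ⟨𝟙 _, _, restrIso_id_comp_id _ p _, P.restrIso_unit_right hP p X,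
      (P.restrict hP p).carries_runitInv (𝟙 _)⟩)).symm

end IndexedHomotopyCoproducts

end IndexedMonoidalDerivator

/-! ### Cocontinuity and axioms -/

namespace IndexedMonoidalDerivator

namespace IndexedHomotopyCoproducts

variable {S : Type u'} [Category.{v'} S] [CartesianMonoidalCategory S]
  {V : IndexedMonoidalDerivator.{w, v, u} S} (P : V.IndexedHomotopyCoproducts)
  (hP : P.PreservedByTensor)

/-- Restriction is cocontinuous by assumption, and coproducts are cocontinuous as left adjoints. -/
theorem isCocontinuous_pb_pf {R T U : S} (f : R ⟶ T) (g : R ⟶ U) :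
    IsCocontinuous (V.pb f ≫ P.pf g) :=
  IsCocontinuous.comp (V.isDerivator _) (V.isDerivator _) (V.isDerivator _)
    (V.cocontinuous f.op.toLoc)
    (isCocontinuous_of_adjunction (V.isDerivator _) (V.isDerivator _) (P.adj g))

theorem isCocontinuousLeft_comp (R T U : S) : IsCocontinuousLeft (P.bicategoryData.comp R T U) :=
  IsCocontinuousLeft.comp (V.isDerivator _) (V.isDerivator _) (V.isDerivator _)
    (IsCocontinuousLeft.prodMap_comp (V.isDerivator _) (V.isDerivator _) (V.isDerivator _) _
      (V.cocontinuous _) (V.tensor_cocontinuousLeft _)) (P.isCocontinuous_pb_pf _ _)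

theorem isCocontinuousRight_comp (R T U : S) :
    IsCocontinuousRight (P.bicategoryData.comp R T U) :=
  IsCocontinuousRight.comp (V.isDerivator _) (V.isDerivator _) (V.isDerivator _)
    (IsCocontinuousRight.prodMap_comp (V.isDerivator _) (V.isDerivator _) (V.isDerivator _) _
      (V.cocontinuous _) (V.tensor_cocontinuousRight _)) (P.isCocontinuous_pb_pf _ _)

/-- The derivator bicategory of an indexed monoidal derivator.  The axioms hold over each small
category `A`, being those of the indexed monoidal category `R ↦ V^R(A)`. -/
noncomputable def derivatorBicategory : DerivatorBicategory P.bicategoryData where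
  toDerivatorBicategoryConstraints := P.constraints hP
  isDerivator _ _ := V.isDerivator _
  cocontinuousLeft := P.isCocontinuousLeft_comp
  cocontinuousRight := P.isCocontinuousRight_comp
  pentagon {_ _ _ _ _ A} M N L Q := (P.level hP A).pentagon M N L Q
  triangle {_ _ _ A} M N := (P.level hP A).assocHom_comp_compMap_inv M N

open IndexedMonoidalCategory in
/-- The shadow on the derivator bicategory of a symmetric indexed monoidal derivator. -/
noncomputable def shadow (s : V.Symmetric) :
    (P.derivatorBicategory hP).Shadow (V.fib (𝟙_ S)) P.shadowMor :=
  letI := s.symmetric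
  have hV (A : Cat.{w, w}) : Coproducts.PullBraided (V.level A) := fun x M N => s.pb_braided x A M N
  { isDerivator := V.isDerivator _
    cocontinuous := fun _ => P.isCocontinuous_pb_pf _ _
    cyclic := fun R T => isoOfComparison
      (φ := P.bicategoryData.comp R T R ≫ P.shadowMor R)
      (ψ := prodSwap _ _ ≫ P.bicategoryData.comp T R T ≫ P.shadowMor T)
      (fun A X => (P.level hP A).cyc X.1 X.2)
      (fun A X => (P.level hP A).isIso_cyc X.1 X.2)
      (fun A _ _ f => (P.level hP A).cyc_naturality (hV A) f.1 f.2)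
      (fun {A B} p X => ⟨_, _, P.restrIso_comp_shadow hP p X.1 X.2,
        P.restrIso_swap_comp_shadow hP p X.1 X.2,
        (P.restrict hP p).carries_cyc (𝟙 _) (𝟙 _) (hV B) (hV A)
          (fun Z M N => s.pull_braided Z p M N)⟩)
    hexagon := fun {_ _ _ A} M N L => (P.level hP A).hexagon (hV A) M N L
    cyclic_lunit := fun {_ A} M => (P.level hP A).cyc_comp_shMap_inv_lunitInv (hV A) M
    cyclic_runit := fun {_ A} M => (P.level hP A).cyc_comp_shMap_inv_runitInv (hV A) M }

end IndexedHomotopyCoproducts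

end IndexedMonoidalDerivator

theorem mainTheorem8 {S : Type u'} [Category.{v'} S] [CartesianMonoidalCategory S]
    (V : IndexedMonoidalDerivator.{w, v, u} S) (P : V.IndexedHomotopyCoproducts)
    (hP : P.PreservedByTensor) :
    ∃ W : DerivatorBicategory
        { Obj := S
          hom := fun R T => V.fib (R ⊗ T)
          comp := fun R T U =>
            V.ext (R ⊗ T) (T ⊗ U) ≫ V.pb (insertDiagonal R T U) ≫ P.pf (projectMiddle R T U)
          unit := fun R =>
            unit (V.fib (𝟙_ S)) ≫ V.pb (toUnit R) ≫ P.pf (lift (𝟙 R) (𝟙 R)) },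
      ∀ _ : V.Symmetric,
        Nonempty (W.Shadow (V.fib (𝟙_ S))
          (fun R => V.pb (lift (𝟙 R) (𝟙 R)) ≫ P.pf (toUnit R))) :=
  ⟨P.derivatorBicategory hP, fun s => ⟨P.shadow hP s⟩⟩
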